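/- Identify $\mathbb R^4=\mathbb H$, $\mathbb R^3=\operatorname{Im}\mathbb H$, $S^3=\{q\in\mathbb H:|q|=1\}$, $\mathbb RP^3=S^3/\{\pm1\}$, and let $z=x+iy$ be the coordinate of $\mathbb C$. All maps are $C^\infty$. A conformal immersion $f:U\to\mathbb H$ of an open set $U\subseteq\mathbb C$ is called *isothermic* (with isothermic coordinate $z$) if $f_{xy}\in\operatorname{span}\{f_x,f_y\}$ at every point; put $df^*:=-f_x^{-1}dx+f_y^{-1}dy$. A *Bonnet pair* (pair of Bonnet mates) is a pair of conformal immersions $F_1,F_2:\mathbb C\to\operatorname{Im}\mathbb H$ with the same induced metric and the same mean curvature function (with respect to the normals $F_x\times F_y/|F_x|^2$) which are not congruent (there is no isometry $g$ of $\mathbb R^3$ with $F_2=g\circ F_1$). It is *normalized* if its Hopf differentials $Q_k\,dz^2$, $Q_k=\langle (F_k)_{zz},N_k\rangle$, satisfy $Q_2-Q_1=-i$. Let $\mathcal L\subset\mathbb C$ be a lattice. An *isothermic torus in $S^3$* is a map $T:\mathbb C/\mathcal L\to S^3$ whose pull-back to $\mathbb C$ is isothermic; an *isothermic torus in $\mathbb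 RP^3$* is a map $\tau:\mathbb C/\mathcal L\to\mathbb RP^3$ whose pull-back to $\mathbb C$ has, near every point, a lift to $S^3$ which is isothermic. Let $\mathcal B(\mathcal L)$ be the set of pairs $(dF_1,dF_2)$ of $\mathcal L$-periodic one-forms which are the differentials of a normalized Bonnet pair. The *spin structure* of $F_k$ is the homomorphism $p_k:\mathcal L\to\mathbb Z/2$ with $\Phi_k(z+\ell)=(-1)^{p_k(\ell)}\Phi_k(z)$, where $\Phi_k:\mathbb C\to S^3$ is a smooth frame with $(F_k)_x=|(F_k)_x|\,\Phi_k^{-1}\mathbf i\,\Phi_k$ and $(F_k)_y=|(F_k)_y|\,\Phi_k^{-1}\mathbf j\,\Phi_k$. Then: 1. (Normalization.) If $(F_1,F_2)$ is any Bonnet pair on $\mathbb C$ such that $dF_1,dF_2$ are $\mathcal L$-periodic, then there is $c\in\mathbb C\setminus\{0\}$ such that, for $c'\in\mathbb C$, the pair of differentials of $z\mapsto F_1(c'z)$ and $z\mapsto F_2(c'z)$ belongs to $\mathcal B(\{z:c'z\in\mathcal L\})$ if and only if $c'=\pm c$. 2. There is a bijection from the set of isothermic tori $\tau:\mathbb C/\mathcal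 L\to\mathbb RP^3$ onto $\mathcal B(\mathcal L)$, $\tau\mapsto(dF_1,dF_2)$, given by $$dF_1=dT^*\,T=\tfrac12(1-R)\,dR^*\,(1+R),\qquad dF_2=T\,dT^*=\tfrac12(1+R)\,dR^*\,(1-R),$$ where $T$ is any smooth local lift of $\tau$ to $S^3$, and where the expressions in $R$ hold wherever $T=(1+R)(1-R)^{-1}$ with $R$ valued in $\operatorname{Im}\mathbb H$; such an $R$ is then isothermic in $\mathbb R^3$. 3. The same formulas give a bijection from the set of isothermic tori $T:\mathbb C/\mathcal L\to S^3$, with $T$ and $-T$ identified, onto the set of those $(dF_1,dF_2)\in\mathcal B(\mathcal L)$ for which the spin structures of $F_1$ and $F_2$ coincide. -/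

import Mathlib

open scoped Quaternion ContDiff

noncomputable section

namespace BonnetIsothermic

/-! ### Surfaces in the quaternions, with `ℝ³` the imaginary quaternions -/

/-- `f_x`, where `z = x + i y`. -/
def dx (f : ℂ → ℍ[ℝ]) (z : ℂ) : ℍ[ℝ] := fderiv ℝ f z 1

/-- `f_y`, where `z = x + i y`. -/
def dy (f : ℂ → ℍ[ℝ]) (z : ℂ) : ℍ[ℝ] := fderiv ℝ f z Complex.I

/-- A smooth conformal immersion of the open set `U ⊆ ℂ` into `ℝ⁴ = ℍ`. -/
structure IsConformalImmersionOn (f : ℂ → ℍ[ℝ]) (U : Set ℂ) : Prop where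
  smooth : ContDiffOn ℝ ∞ f U
  immersion : ∀ z ∈ U, dx f z ≠ 0
  equal_norm : ∀ z ∈ U, ‖dx f z‖ = ‖dy f z‖
  orthogonal : ∀ z ∈ U, inner ℝ (dx f z) (dy f z) = 0

/-- `f` is an isothermic surface on `U`, with isothermic coordinate `z = x + i y`:
it is a conformal immersion and `f_xy` is tangent to it. -/
structure IsIsothermicOn (f : ℂ → ℍ[ℝ]) (U : Set ℂ) : Prop where
  conformal : IsConformalImmersionOn f U
  mixed_tangent : ∀ z ∈ U, dy (dx f) z ∈ Submodule.span ℝ {dx f z, dy f z}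

/-- The differential `df* = -f_x⁻¹ dx + f_y⁻¹ dy` of the dual isothermic surface,
at the point `z` and on the tangent vector `v`. -/
def dualForm (f : ℂ → ℍ[ℝ]) (z v : ℂ) : ℍ[ℝ] :=
  -(v.re • (dx f z)⁻¹) + v.im • (dy f z)⁻¹

/-- The unit normal `F_x × F_y / |F_x|²` of a conformal immersion into the imaginary quaternions
(for orthogonal imaginary quaternions the cross product is the product). -/
def normal (F : ℂ → ℍ[ℝ]) (z : ℂ) : ℍ[ℝ] := (‖dx F z‖ ^ 2)⁻¹ • (dx F z * dy F z)

/-- The mean curvature of a conformal immersion into the imaginary quaternions: half the trace of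
the second fundamental form with respect to the metric `|F_x|² (dx² + dy²)`. -/
def meanCurvature (F : ℂ → ℍ[ℝ]) (z : ℂ) : ℝ :=
  (inner ℝ (dx (dx F) z) (normal F z) + inner ℝ (dy (dy F) z) (normal F z)) / (2 * ‖dx F z‖ ^ 2)

/-- The coefficient `Q = ⟨F_zz, N⟩` of the Hopf differential `Q dz²`, where
`F_zz = (F_xx - F_yy - 2 i F_xy) / 4` and the scalar product is extended complex bilinearly. -/
def hopf (F : ℂ → ℍ[ℝ]) (z : ℂ) : ℂ :=
  ((inner ℝ (dx (dx F) z) (normal F z) - inner ℝ (dy (dy F) z) (normal F z) : ℝ)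
    - 2 * Complex.I * (inner ℝ (dy (dx F) z) (normal F z) : ℝ)) / 4

/-- A Bonnet pair on `ℂ`: two conformal immersions into `ℝ³` which are isometric and not congruent,
and whose mean curvature functions coincide. (`Congruent F₁ F₂` says that
`|F₁ z - F₁ w| = |F₂ z - F₂ w|` for all `z, w`, that is, that `F₂` is the composition of `F₁`
with an isometry of `ℝ³`.) -/
structure IsBonnetPair (F₁ F₂ : ℂ → ℍ[ℝ]) : Prop where
  imaginary : ∀ z, (F₁ z).re = 0 ∧ (F₂ z).re = 0
  conformal₁ : IsConformalImmersionOn F₁ Set.univ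
  conformal₂ : IsConformalImmersionOn F₂ Set.univ
  isometric : ∀ z, ‖dx F₁ z‖ = ‖dx F₂ z‖
  mean_eq : ∀ z, meanCurvature F₁ z = meanCurvature F₂ z
  not_congruent : ¬ Congruent F₁ F₂

/-- The coordinate is normalized: the difference `h = Q₂ - Q₁` of the Hopf differentials
is `-i`. -/
def IsNormalized (F₁ F₂ : ℂ → ℍ[ℝ]) : Prop :=
  ∀ z, hopf F₂ z - hopf F₁ z = -Complex.I

/-! ### Doubly periodic frames and spin structures -/

/-- The type of `ℍ`-valued one-forms on `ℂ`. -/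
abbrev Form : Type := ℂ → ℂ →L[ℝ] ℍ[ℝ]

/-- The one-form `θ` has all elements of `L` as periods. -/
def IsPeriodic (L : Submodule ℤ ℂ) (θ : Form) : Prop :=
  ∀ l ∈ L, ∀ z, θ (z + l) = θ z

/-- The pairs `(dF₁, dF₂)` of frames, doubly periodic with period lattice `L`, of normalized Bonnet
pairs `(F₁, F₂)`. -/
def BonnetFrames (L : Submodule ℤ ℂ) : Set (Form × Form) :=
  {θ | IsPeriodic L θ.1 ∧ IsPeriodic L θ.2 ∧
    ∃ F₁ F₂ : ℂ → ℍ[ℝ], IsBonnetPair F₁ F₂ ∧ IsNormalized F₁ F₂ ∧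
      fderiv ℝ F₁ = θ.1 ∧ fderiv ℝ F₂ = θ.2}

/-- The quaternion `i`. -/
def quatI : ℍ[ℝ] := ⟨0, 1, 0, 0⟩

/-- The quaternion `j`. -/
def quatJ : ℍ[ℝ] := ⟨0, 0, 1, 0⟩

/-- `Φ` is a unitary conformal frame of a conformal immersion `F` with `dF = θ`:
`F_x = |F_x| Φ⁻¹ i Φ` and `F_y = |F_y| Φ⁻¹ j Φ` (hence also `N = Φ⁻¹ k Φ`). -/
structure IsSpinFrame (θ : Form) (Φ : ℂ → ℍ[ℝ]) : Prop where
  smooth : ContDiff ℝ ∞ Φ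
  unitary : ∀ z, ‖Φ z‖ = 1
  frame_x : ∀ z, θ z 1 = ‖θ z 1‖ • ((Φ z)⁻¹ * quatI * Φ z)
  frame_y : ∀ z, θ z Complex.I = ‖θ z Complex.I‖ • ((Φ z)⁻¹ * quatJ * Φ z)

/-- `p : L → ℤ/2` is the spin structure of the immersion with differential `θ`: the frame satisfies
`Φ (z + l) = (-1)^(p l) Φ z` for `l` in `L`. -/
def HasSpinStructure (L : Submodule ℤ ℂ) (θ : Form) (p : L →+ ZMod 2) : Prop :=
  ∃ Φ : ℂ → ℍ[ℝ], IsSpinFrame θ Φ ∧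
    ∀ (l : L) (z : ℂ), Φ (z + l) = (-1) ^ (p l).val * Φ z

/-- The two spin structures coincide. -/
def SameSpin (L : Submodule ℤ ℂ) (θ : Form × Form) : Prop :=
  ∃ p : L →+ ZMod 2, HasSpinStructure L θ.1 p ∧ HasSpinStructure L θ.2 p

/-! ### Isothermic tori in `S³` and in `ℝP³ = S³/{±1}` -/

/-- `S³`, the unit sphere of `ℍ = ℝ⁴`. -/
abbrev S3 : Type := Metric.sphere (0 : ℍ[ℝ]) 1

/-- Two points of `S³` are identified if they are equal or antipodal. -/
def antipodal : Setoid S3 where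
  r p q := q = p ∨ q = -p
  iseqv :=
    { refl := fun _ => Or.inl rfl
      symm := by
        rintro p q (rfl | rfl)
        · exact Or.inl rfl
        · exact Or.inr (neg_neg p).symm
      trans := by
        rintro p q r (rfl | rfl) (rfl | rfl)
        · exact Or.inl rfl
        · exact Or.inr rfl
        · exact Or.inr rfl
        · exact Or.inl (neg_neg p) }

/-- Real projective space `ℝP³ = S³/{±1}`. -/
def RP3 : Type := Quotient antipodal

/-- The projection `S³ → ℝP³`. -/
def RP3.mk (p : S3) : RP3 := Quotient.mk antipodal p

/-- `T` is, on `U ⊆ ℂ`, a smooth lift to `S³` of the map `τ : ℂ/L → ℝP³`. -/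
structure IsLiftOn (L : Submodule ℤ ℂ) (τ : ℂ ⧸ L → RP3) (T : ℂ → S3) (U : Set ℂ) : Prop where
  smooth : ContDiffOn ℝ ∞ (fun z => (T z : ℍ[ℝ])) U
  lifts : ∀ z ∈ U, RP3.mk (T z) = τ (L.mkQ z)

/-- An isothermic torus in `ℝP³` with period lattice `L` (and isothermic coordinate `z`): a map
`ℂ/L → ℝP³` which near every point lifts to an isothermic surface in `S³`. -/
def IsIsothermicRP3 (L : Submodule ℤ ℂ) (τ : ℂ ⧸ L → RP3) : Prop :=
  ∀ z₀ : ℂ, ∃ (U : Set ℂ) (T : ℂ → S3), IsOpen U ∧ z₀ ∈ U ∧ IsLiftOn L τ T U ∧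
    IsIsothermicOn (fun z => (T z : ℍ[ℝ])) U

/-- An isothermic torus in `S³` with period lattice `L` (and isothermic coordinate `z`). -/
def IsIsothermicS3 (L : Submodule ℤ ℂ) (T : ℂ ⧸ L → S3) : Prop :=
  IsIsothermicOn (fun z => (T (L.mkQ z) : ℍ[ℝ])) Set.univ

/-- Two isothermic tori in `S³` are identified if they are equal or antipodal. -/
def antipodalTori (L : Submodule ℤ ℂ) : Setoid {T : ℂ ⧸ L → S3 // IsIsothermicS3 L T} where
  r T T' := T'.1 = T.1 ∨ T'.1 = -T.1
  iseqv :=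
    { refl := fun _ => Or.inl rfl
      symm := by
        rintro T T' (h | h)
        · exact Or.inl h.symm
        · exact Or.inr (by rw [h, neg_neg])
      trans := by
        rintro T T' T'' (h | h) (h' | h')
        · exact Or.inl (h'.trans h)
        · exact Or.inr (by rw [h', h])
        · exact Or.inr (by rw [h', h])
        · exact Or.inl (by rw [h', h, neg_neg]) }

/-- The torus `τ` in `ℝP³` and the pair `θ = (dF₁, dF₂)` are related by
`dF₁ = dT* T`, `dF₂ = T dT*`, where `T` is any local lift of `τ` to `S³`. If
`T = (1 + R)(1 - R)⁻¹` with `R` imaginary (stereographic projection), then `R` is an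
isothermic surface in `ℝ³`, and the relation reads
`dF₁ = ½ (1 - R) dR* (1 + R)`, `dF₂ = ½ (1 + R) dR* (1 - R)`. -/
structure IsBonnetRelation (L : Submodule ℤ ℂ) (τ : ℂ ⧸ L → RP3) (θ : Form × Form) : Prop where
  sphere : ∀ (U : Set ℂ) (T : ℂ → S3), IsOpen U → IsLiftOn L τ T U →
    ∀ z ∈ U, ∀ v : ℂ,
      θ.1 z v = dualForm (fun w => (T w : ℍ[ℝ])) z v * (T z : ℍ[ℝ]) ∧
      θ.2 z v = (T z : ℍ[ℝ]) * dualForm (fun w => (T w : ℍ[ℝ])) z v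
  stereographic : ∀ (U : Set ℂ) (T : ℂ → S3) (R : ℂ → ℍ[ℝ]), IsOpen U → IsLiftOn L τ T U →
    (∀ z ∈ U, (R z).re = 0 ∧ (T z : ℍ[ℝ]) = (1 + R z) * (1 - R z)⁻¹) →
    IsIsothermicOn R U ∧ ∀ z ∈ U, ∀ v : ℂ,
      θ.1 z v = (1 / 2 : ℝ) • ((1 - R z) * dualForm R z v * (1 + R z)) ∧
      θ.2 z v = (1 / 2 : ℝ) • ((1 + R z) * dualForm R z v * (1 - R z))

end BonnetIsothermic

end

noncomputable section

namespace BonnetIsothermic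

open Topology Filter

/-! ### Calculus of quaternion valued functions -/

section Calculus

variable {E : Type*} [NormedAddCommGroup E] [NormedSpace ℝ E] {a b : E → ℍ[ℝ]} {z : E}

/-! Two conformal immersions of `ℂ` into `ℝ³` with the same metric have frames that differ by a
rotation at each point. Since `ℂ` is simply connected, this rotation lifts to a smooth `T : ℂ → S³`
with `dF₂ = T dF₁ T⁻¹`, unique up to a global sign (`exists_intertwiner`, `exists_gauge`). Put `α =
T⁻¹ dT`. Symmetry of the mixed derivatives of `F₂` forces `α` to be tangent to `F₁`, and the
tangential components of `α` are the differences of the two second fundamental forms divided by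
`2|F_x|²` (`dx_gauge`, `dy_gauge`). For equal mean curvatures and `Q₂ - Q₁ = -i` the differences of
`⟨F_xx, N⟩`, `⟨F_xy, N⟩`, `⟨F_yy, N⟩` are `0, 2, 0`. This says exactly `T⁻¹ T_x = -F_x⁻¹` and `T⁻¹
T_y = F_y⁻¹` with `F = F₁`, that is, `dF₁ = dT* T` and `dF₂ = T dT*`; differentiating once more
shows that `T` is isothermic (`isothermic_of_gauge`).

Conversely, for an isothermic `T` in `S³` the form `dT*` is closed and its wedge products with `dT`
vanish on both sides, so `dT* T` and `T dT*` are closed. They are imaginary because `dT ⊥ T`. Their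
primitives have the required second fundamental forms by the same formulas (`sff_of_isDualAt`). Both
forms are unchanged under `T ↦ -T`, so only the map to `ℝP³` matters, and `T` up to sign is
recovered from the frames. This gives the bijection of part 2.

A periodic pair of differentials makes `T` periodic up to sign. If `Φ` is a spin frame of `F₁`, then
`Φ T⁻¹` is one of `F₂`; so `T` itself is periodic exactly when the two spin structures agree, which
is part 3.

For part 1, the Codazzi equations make `Q₂ - Q₁` holomorphic, and periodicity with Liouville's
theorem makes it a constant `h`. If `h = 0`, then `T` is constant and the surfaces are congruent.
Substituting `cz` for `z` multiplies `h` by `c²`, so `c² h = -i` has exactly two solutions.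
Noncongruence of a normalized pair also has to be proved: congruence would force both surfaces to be
minimal, and a minimal surface with periodic differential is a plane
(`not_congruent_of_normalized`). -/

theorem fderiv_mul_apply (ha : DifferentiableAt ℝ a z) (hb : DifferentiableAt ℝ b z) (v : E) :
    fderiv ℝ (fun w => a w * b w) z v = fderiv ℝ a z v * b z + a z * fderiv ℝ b z v := by
  rw [fderiv_fun_mul' ha hb]
  simp [add_comm]

instance : StarModule ℝ ℍ[ℝ] := ⟨fun r x => by simp⟩

theorem fderiv_star_apply (a : E → ℍ[ℝ]) (z v : E) :
    fderiv ℝ (fun w => star (a w)) z v = star (fderiv ℝ a z v) := by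
  rw [fderiv_star]
  rfl

theorem differentiableAt_star (ha : DifferentiableAt ℝ a z) :
    DifferentiableAt ℝ (fun w => star (a w)) z := ha.star

theorem contDiffAt_quaternion_inv {n : WithTop ℕ∞} (ha : ContDiffAt ℝ n a z) (h : a z ≠ 0) :
    ContDiffAt ℝ n (fun w => (a w)⁻¹) z := by
  have h1 := contDiffAt_ringInverse (n := n) ℝ (Units.mk0 (a z) h)
  have h2 := h1.comp z (f := a) ha
  simpa [Ring.inverse_eq_inv', Function.comp_def] using h2

theorem fderiv_inv_apply (ha : DifferentiableAt ℝ a z) (h : a z ≠ 0) (v : E) :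
    fderiv ℝ (fun w => (a w)⁻¹) z v = -((a z)⁻¹ * fderiv ℝ a z v * (a z)⁻¹) := by
  have h1 := (hasFDerivAt_inv' (𝕜 := ℝ) h).comp z ha.hasFDerivAt
  have h2 : fderiv ℝ (fun w => (a w)⁻¹) z = _ := h1.fderiv
  rw [h2]
  simp

theorem differentiableAt_quaternion_inv (ha : DifferentiableAt ℝ a z) (h : a z ≠ 0) :
    DifferentiableAt ℝ (fun w => (a w)⁻¹) z :=
  ((hasFDerivAt_inv' (𝕜 := ℝ) h).comp z ha.hasFDerivAt).differentiableAt

theorem fderiv_smul_apply' {g : E → ℝ} (hg : DifferentiableAt ℝ g z) (hb : DifferentiableAt ℝ b z)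
    (v : E) :
    fderiv ℝ (fun w => g w • b w) z v = fderiv ℝ g z v • b z + g z • fderiv ℝ b z v := by
  rw [fderiv_fun_smul hg hb]
  simp [add_comm]

theorem fderiv_add_apply' (ha : DifferentiableAt ℝ a z) (hb : DifferentiableAt ℝ b z) (v : E) :
    fderiv ℝ (fun w => a w + b w) z v = fderiv ℝ a z v + fderiv ℝ b z v := by
  rw [fderiv_fun_add ha hb]
  rfl

theorem fderiv_neg_apply' (a : E → ℍ[ℝ]) (z v : E) :
    fderiv ℝ (fun w => -(a w)) z v = -fderiv ℝ a z v := by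
  rw [fderiv_fun_neg]
  rfl

theorem contDiffAt_fderiv_apply (ha : ContDiffAt ℝ ∞ a z) (v : E) :
    ContDiffAt ℝ ∞ (fun w => fderiv ℝ a w v) z :=
  (ha.fderiv_right (m := ∞) (by rfl)).clm_apply contDiffAt_const

theorem fderiv_fderiv_apply (ha : ContDiffAt ℝ ∞ a z) (v w : E) :
    fderiv ℝ (fun u => fderiv ℝ a u v) z w = fderiv ℝ (fderiv ℝ a) z w v := by
  have h : DifferentiableAt ℝ (fderiv ℝ a) z :=
    (ha.fderiv_right (m := ∞) (by rfl)).differentiableAt (by simp)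
  rw [fderiv_clm_apply h (differentiableAt_const v)]
  simp

theorem fderiv_fderiv_comm (ha : ContDiffAt ℝ ∞ a z) (v w : E) :
    fderiv ℝ (fun u => fderiv ℝ a u v) z w = fderiv ℝ (fun u => fderiv ℝ a u w) z v := by
  rw [fderiv_fderiv_apply ha, fderiv_fderiv_apply ha]
  exact ha.isSymmSndFDerivAt (by simpa using ENat.LEInfty.out) w v

theorem fderiv_re_apply (ha : DifferentiableAt ℝ a z) (v : E) :
    fderiv ℝ (fun w => (a w).re) z v = (fderiv ℝ a z v).re := by
  have : (fun w => (a w).re) = fun w => inner ℝ (a w) (1 : ℍ[ℝ]) := by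
    ext w
    simp [Quaternion.inner_def]
  rw [this, fderiv_inner_apply ℝ ha (differentiableAt_const _)]
  simp [Quaternion.inner_def]

end Calculus

theorem dy_dx_eq_dx_dy {f : ℂ → ℍ[ℝ]} {z : ℂ} (hf : ContDiffAt ℝ ∞ f z) :
    dy (dx f) z = dx (dy f) z :=
  fderiv_fderiv_comm hf 1 Complex.I

theorem contDiffAt_dx {f : ℂ → ℍ[ℝ]} {z : ℂ} (hf : ContDiffAt ℝ ∞ f z) :
    ContDiffAt ℝ ∞ (dx f) z :=
  contDiffAt_fderiv_apply hf 1

theorem contDiffAt_dy {f : ℂ → ℍ[ℝ]} {z : ℂ} (hf : ContDiffAt ℝ ∞ f z) :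
    ContDiffAt ℝ ∞ (dy f) z :=
  contDiffAt_fderiv_apply hf Complex.I

theorem fderiv_apply_complex (f : ℂ → ℍ[ℝ]) (z v : ℂ) :
    fderiv ℝ f z v = v.re • dx f z + v.im • dy f z := by
  have : v = v.re • (1 : ℂ) + v.im • Complex.I := by
    simp
  conv_lhs => rw [this]
  rw [map_add, map_smul, map_smul]
  rfl

/-! ### Algebra of quaternions -/

theorem star_eq_neg_of_re {a : ℍ[ℝ]} (h : a.re = 0) : star a = -a := by
  ext <;> simp [h]

theorem re_eq_zero_of_star {a : ℍ[ℝ]} (h : star a = -a) : a.re = 0 := by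
  have := congrArg (fun q => q.re) h
  simp at this
  linarith

theorem inner_conj {T : ℍ[ℝ]} (hT : ‖T‖ = 1) (a b : ℍ[ℝ]) :
    inner ℝ (T * a * star T) (T * b * star T) = (inner ℝ a b : ℝ) := by
  have h := Quaternion.normSq_eq_norm_mul_self T
  rw [hT, Quaternion.normSq_def'] at h
  rw [Quaternion.inner_def, Quaternion.inner_def]
  simp
  linear_combination
    ((T.re ^ 2 + T.imI ^ 2 + T.imJ ^ 2 + T.imK ^ 2) + 1) *
      (a.re * b.re + a.imI * b.imI + a.imJ * b.imJ + a.imK * b.imK) * h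

theorem star_mul_self_of_norm {T : ℍ[ℝ]} (hT : ‖T‖ = 1) : star T * T = 1 := by
  have h := Quaternion.star_mul_self (a := T)
  rw [Quaternion.normSq_eq_norm_mul_self, hT] at h
  simpa using h

theorem self_mul_star_of_norm {T : ℍ[ℝ]} (hT : ‖T‖ = 1) : T * star T = 1 := by
  have h := Quaternion.self_mul_star (a := T)
  rw [Quaternion.normSq_eq_norm_mul_self, hT] at h
  simpa using h

theorem inv_eq_star_of_norm {T : ℍ[ℝ]} (hT : ‖T‖ = 1) : T⁻¹ = star T :=
  inv_eq_of_mul_eq_one_right (self_mul_star_of_norm hT)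

theorem norm_sq_eq (a : ℍ[ℝ]) : ‖a‖ ^ 2 = a.re ^ 2 + a.imI ^ 2 + a.imJ ^ 2 + a.imK ^ 2 := by
  rw [sq, ← Quaternion.normSq_eq_norm_mul_self, Quaternion.normSq_def']

theorem inner_eq (a b : ℍ[ℝ]) :
    inner ℝ a b = a.re * b.re + a.imI * b.imI + a.imJ * b.imJ + a.imK * b.imK := by
  rw [Quaternion.inner_def]
  simp

/-- Two orthogonal imaginary quaternions of the same nonzero length. -/
structure IsConformalPair (X Y : ℍ[ℝ]) : Prop where
  ne_zero : X ≠ 0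
  re_x : X.re = 0
  re_y : Y.re = 0
  norm_eq : ‖X‖ = ‖Y‖
  inner_eq_zero : inner ℝ X Y = (0 : ℝ)

namespace IsConformalPair

variable {X Y : ℍ[ℝ]} (h : IsConformalPair X Y)
include h

theorem norm_sq_pos : 0 < ‖X‖ ^ 2 := by
  have := norm_pos_iff.2 h.ne_zero
  positivity

theorem eqs : X.imI ^ 2 + X.imJ ^ 2 + X.imK ^ 2 = ‖X‖ ^ 2 ∧
    Y.imI ^ 2 + Y.imJ ^ 2 + Y.imK ^ 2 = ‖X‖ ^ 2 ∧
    X.imI * Y.imI + X.imJ * Y.imJ + X.imK * Y.imK = 0 := by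
  refine ⟨?_, ?_, ?_⟩
  · rw [norm_sq_eq, h.re_x]; ring
  · rw [h.norm_eq, norm_sq_eq, h.re_y]; ring
  · have := h.inner_eq_zero
    rw [inner_eq, h.re_x, h.re_y] at this
    linarith

theorem mul_comm_neg : Y * X = -(X * Y) := by
  obtain ⟨-, -, h3⟩ := h.eqs
  ext <;> simp [h.re_x, h.re_y] <;> linarith

theorem mul_self_x : X * X = -((‖X‖ ^ 2 : ℝ) : ℍ[ℝ]) := by
  obtain ⟨h1, -, -⟩ := h.eqs
  ext <;> simp [h.re_x, -Quaternion.coe_pow] <;> linarith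

theorem mul_self_y : Y * Y = -((‖X‖ ^ 2 : ℝ) : ℍ[ℝ]) := by
  obtain ⟨-, h1, -⟩ := h.eqs
  ext <;> simp [h.re_y, -Quaternion.coe_pow] <;> linarith

theorem re_mul : (X * Y).re = 0 := by
  obtain ⟨-, -, h3⟩ := h.eqs
  simp [h.re_x, h.re_y]
  linarith

/-- Commuting with `α` is twice the cross product with its imaginary part. This identity and the
next three therefore read off the components of `α` in the frame `X, Y, XY` from the infinitesimal
rotation that `α` generates. -/
theorem inner_commutator_x (α : ℍ[ℝ]) :
    inner ℝ (α * X - X * α) ((‖X‖ ^ 2)⁻¹ • (X * Y)) = -2 * (inner ℝ α Y : ℝ) := by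
  obtain ⟨h1, h2, h3⟩ := h.eqs
  have hE := h.norm_sq_pos.ne'
  rw [inner_smul_right, inv_mul_eq_iff_eq_mul₀ hE, ← h1, inner_eq, inner_eq]
  simp [h.re_x, h.re_y]
  linear_combination 2 * (α.imI * X.imI + α.imJ * X.imJ + α.imK * X.imK) * h3

theorem inner_commutator_y (α : ℍ[ℝ]) :
    inner ℝ (α * Y - Y * α) ((‖X‖ ^ 2)⁻¹ • (X * Y)) = 2 * (inner ℝ α X : ℝ) := by
  obtain ⟨h1, h2, h3⟩ := h.eqs
  have hE := h.norm_sq_pos.ne'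
  rw [inner_smul_right, inv_mul_eq_iff_eq_mul₀ hE, ← h2, inner_eq, inner_eq]
  simp [h.re_x, h.re_y]
  linear_combination -2 * (α.imI * Y.imI + α.imJ * Y.imJ + α.imK * Y.imK) * h3

theorem inner_commutator_x_y (α : ℍ[ℝ]) :
    inner ℝ (α * X - X * α) Y = 2 * (inner ℝ α (X * Y) : ℝ) := by
  obtain ⟨h1, h2, h3⟩ := h.eqs
  rw [inner_eq, inner_eq]
  simp [h.re_x, h.re_y]
  linear_combination 2 * α.re * h3

theorem inner_commutator_y_x (α : ℍ[ℝ]) :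
    inner ℝ (α * Y - Y * α) X = -2 * (inner ℝ α (X * Y) : ℝ) := by
  obtain ⟨h1, h2, h3⟩ := h.eqs
  rw [inner_eq, inner_eq]
  simp [h.re_x, h.re_y]
  linear_combination -2 * α.re * h3

/-- Parseval's identity in the orthogonal frame `X, Y, XY` of the imaginary quaternions. -/
theorem parseval {u v : ℍ[ℝ]} (hu : u.re = 0) (hv : v.re = 0) :
    ‖X‖ ^ 2 * (inner ℝ u v : ℝ) = inner ℝ u X * inner ℝ v X + inner ℝ u Y * inner ℝ v Y +
      ‖X‖ ^ 2 * (inner ℝ u ((‖X‖ ^ 2)⁻¹ • (X * Y)) * inner ℝ v ((‖X‖ ^ 2)⁻¹ • (X * Y))) := by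
  obtain ⟨h1, h2, h3⟩ := h.eqs
  have hE := h.norm_sq_pos.ne'
  simp only [inner_smul_right]
  generalize ‖X‖ ^ 2 = e at *
  -- Cleared of denominators, this follows from the Gram relations `h1`, `h2`, `h3` of the frame.
  -- The coefficients come from expanding the Gram determinant of `u, X, Y` against `v, X, Y`, whose
  -- value is the product of the two triple products.
  have key : e * (e * (inner ℝ u v : ℝ)) = e * (inner ℝ u X * inner ℝ v X) +
      e * (inner ℝ u Y * inner ℝ v Y) + inner ℝ u (X * Y) * inner ℝ v (X * Y) := by
    simp only [inner_eq, Quaternion.re_mul, Quaternion.imI_mul, Quaternion.imJ_mul,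
      Quaternion.imK_mul, h.re_x, h.re_y, hu, hv]
    linear_combination
      (-(u.imI * v.imI + u.imJ * v.imJ + u.imK * v.imK) *
          (Y.imI ^ 2 + Y.imJ ^ 2 + Y.imK ^ 2) +
        (u.imI * Y.imI + u.imJ * Y.imJ + u.imK * Y.imK) *
          (v.imI * Y.imI + v.imJ * Y.imJ + v.imK * Y.imK)) * h1 +
      (-(u.imI * v.imI + u.imJ * v.imJ + u.imK * v.imK) * e +
        (u.imI * X.imI + u.imJ * X.imJ + u.imK * X.imK) *
          (v.imI * X.imI + v.imJ * X.imJ + v.imK * X.imK)) * h2 +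
      ((u.imI * v.imI + u.imJ * v.imJ + u.imK * v.imK) *
          (X.imI * Y.imI + X.imJ * Y.imJ + X.imK * Y.imK) -
        (u.imI * X.imI + u.imJ * X.imJ + u.imK * X.imK) *
          (v.imI * Y.imI + v.imJ * Y.imJ + v.imK * Y.imK) -
        (u.imI * Y.imI + u.imJ * Y.imJ + u.imK * Y.imK) *
          (v.imI * X.imI + v.imJ * X.imJ + v.imK * X.imK)) * h3
  field_simp
  linear_combination key

theorem expansion {u : ℍ[ℝ]} (hu : u.re = 0) (h0 : inner ℝ u (X * Y) = (0 : ℝ)) :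
    u = (‖X‖ ^ 2)⁻¹ • ((inner ℝ u X : ℝ) • X + (inner ℝ u Y : ℝ) • Y) := by
  have hE := h.norm_sq_pos.ne'
  rw [eq_inv_smul_iff₀ hE]
  have key : ∀ v : ℍ[ℝ], inner ℝ ((‖X‖ ^ 2) • u) v =
      (inner ℝ ((inner ℝ u X : ℝ) • X + (inner ℝ u Y : ℝ) • Y) v : ℝ) := by
    intro v
    have h1 : inner ℝ u v = (inner ℝ u v.im : ℝ) := by simp [inner_eq, hu]
    have h2 : inner ℝ X v = (inner ℝ v.im X : ℝ) := by simp [inner_eq, h.re_x]; ring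
    have h3 : inner ℝ Y v = (inner ℝ v.im Y : ℝ) := by simp [inner_eq, h.re_y]; ring
    rw [inner_smul_left, inner_add_left, inner_smul_left, inner_smul_left, h1, h2, h3]
    have := h.parseval hu (v := v.im) (by simp)
    rw [inner_smul_right u, h0] at this
    simpa using this
  exact ext_inner_right ℝ key

end IsConformalPair

/-! ### Conformal immersions into the imaginary quaternions -/

/-- A smooth conformal immersion `F` of `ℂ` whose differential takes imaginary values. -/
structure IsImaginaryImmersion (F : ℂ → ℍ[ℝ]) : Prop where
  smooth : ContDiff ℝ ∞ F
  pair : ∀ z, IsConformalPair (dx F z) (dy F z)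

theorem re_fderiv_eq_zero {F : ℂ → ℍ[ℝ]} (hF : Differentiable ℝ F) (h : ∀ z, (F z).re = 0)
    (z v : ℂ) : (fderiv ℝ F z v).re = 0 := by
  rw [← fderiv_re_apply (hF z), funext h]
  simp

theorem IsBonnetPair.immersion₁ {F₁ F₂ : ℂ → ℍ[ℝ]} (h : IsBonnetPair F₁ F₂) :
    IsImaginaryImmersion F₁ := by
  have hs := contDiffOn_univ.1 h.conformal₁.smooth
  have hd : Differentiable ℝ F₁ := hs.differentiable (by simp)
  exact ⟨hs, fun z => ⟨h.conformal₁.immersion z trivial,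
    re_fderiv_eq_zero hd (fun z => (h.imaginary z).1) z 1,
    re_fderiv_eq_zero hd (fun z => (h.imaginary z).1) z Complex.I,
    h.conformal₁.equal_norm z trivial, h.conformal₁.orthogonal z trivial⟩⟩

theorem IsBonnetPair.immersion₂ {F₁ F₂ : ℂ → ℍ[ℝ]} (h : IsBonnetPair F₁ F₂) :
    IsImaginaryImmersion F₂ := by
  have hs := contDiffOn_univ.1 h.conformal₂.smooth
  have hd : Differentiable ℝ F₂ := hs.differentiable (by simp)
  exact ⟨hs, fun z => ⟨h.conformal₂.immersion z trivial,
    re_fderiv_eq_zero hd (fun z => (h.imaginary z).2) z 1,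
    re_fderiv_eq_zero hd (fun z => (h.imaginary z).2) z Complex.I,
    h.conformal₂.equal_norm z trivial, h.conformal₂.orthogonal z trivial⟩⟩

/-- The coefficient `⟨F_xx, N⟩` of the second fundamental form. -/
def sffXX (F : ℂ → ℍ[ℝ]) (z : ℂ) : ℝ := inner ℝ (dx (dx F) z) (normal F z)

/-- The coefficient `⟨F_xy, N⟩` of the second fundamental form. -/
def sffXY (F : ℂ → ℍ[ℝ]) (z : ℂ) : ℝ := inner ℝ (dy (dx F) z) (normal F z)

/-- The coefficient `⟨F_yy, N⟩` of the second fundamental form. -/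
def sffYY (F : ℂ → ℍ[ℝ]) (z : ℂ) : ℝ := inner ℝ (dy (dy F) z) (normal F z)

theorem hopf_eq (F : ℂ → ℍ[ℝ]) (z : ℂ) :
    hopf F z = ((sffXX F z - sffYY F z : ℝ) - 2 * Complex.I * (sffXY F z : ℝ)) / 4 := rfl

theorem meanCurvature_eq (F : ℂ → ℍ[ℝ]) (z : ℂ) :
    meanCurvature F z = (sffXX F z + sffYY F z) / (2 * ‖dx F z‖ ^ 2) := rfl

theorem hopf_sub_eq {F₁ F₂ : ℂ → ℍ[ℝ]} {z : ℂ}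
    (h : sffXX F₁ z + sffYY F₁ z = sffXX F₂ z + sffYY F₂ z) :
    hopf F₂ z - hopf F₁ z =
      ((sffXX F₂ z - sffXX F₁ z : ℝ) - Complex.I * (sffXY F₂ z - sffXY F₁ z : ℝ)) / 2 := by
  have h' : sffYY F₂ z = sffXX F₁ z + sffYY F₁ z - sffXX F₂ z := by linarith
  rw [hopf_eq, hopf_eq, h']
  push_cast
  ring

theorem mean_eq_iff {F₁ F₂ : ℂ → ℍ[ℝ]} {z : ℂ} (h₀ : dx F₁ z ≠ 0) (h : ‖dx F₁ z‖ = ‖dx F₂ z‖) :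
    meanCurvature F₁ z = meanCurvature F₂ z ↔
      sffXX F₁ z + sffYY F₁ z = sffXX F₂ z + sffYY F₂ z := by
  have : ‖dx F₂ z‖ ≠ 0 := by rw [← h]; exact norm_ne_zero_iff.2 h₀
  rw [meanCurvature_eq, meanCurvature_eq, h]
  constructor
  · intro h
    field_simp at h
    exact h
  · intro h
    rw [h]

/-- `Q₂ - Q₁ = -i` in terms of the second fundamental forms. -/
theorem hopf_sub_eq_neg_I_iff {F₁ F₂ : ℂ → ℍ[ℝ]} {z : ℂ}
    (h : sffXX F₁ z + sffYY F₁ z = sffXX F₂ z + sffYY F₂ z) :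
    hopf F₂ z - hopf F₁ z = -Complex.I ↔
      sffXX F₂ z - sffXX F₁ z = 0 ∧ sffXY F₂ z - sffXY F₁ z = 2 := by
  rw [hopf_sub_eq h, Complex.ext_iff]
  simp
  intro _
  constructor <;> intro h <;> linarith

theorem inner_fderiv_of_const {f g : ℂ → ℍ[ℝ]} {z : ℂ} {c : ℝ} (hf : DifferentiableAt ℝ f z)
    (hg : DifferentiableAt ℝ g z) (h : ∀ w, inner ℝ (f w) (g w) = c) (v : ℂ) :
    (inner ℝ (fderiv ℝ f z v) (g z) : ℝ) + inner ℝ (f z) (fderiv ℝ g z v) = 0 := by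
  have := fderiv_inner_apply ℝ hf hg v
  rw [funext h] at this
  simp at this
  linarith

theorem inner_fderiv_of_eq {f g f' g' : ℂ → ℍ[ℝ]} {z : ℂ} (hf : DifferentiableAt ℝ f z)
    (hg : DifferentiableAt ℝ g z) (hf' : DifferentiableAt ℝ f' z)
    (hg' : DifferentiableAt ℝ g' z)
    (h : ∀ w, (inner ℝ (f w) (g w) : ℝ) = inner ℝ (f' w) (g' w)) (v : ℂ) :
    (inner ℝ (f z) (fderiv ℝ g z v) + inner ℝ (fderiv ℝ f z v) (g z) : ℝ) =
      inner ℝ (f' z) (fderiv ℝ g' z v) + inner ℝ (fderiv ℝ f' z v) (g' z) := by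
  have h1 := fderiv_inner_apply ℝ hf hg v
  have h2 := fderiv_inner_apply ℝ hf' hg' v
  rw [← h1, ← h2, funext h]

namespace IsImaginaryImmersion

variable {F : ℂ → ℍ[ℝ]} (h : IsImaginaryImmersion F)
include h

theorem contDiffAt (z : ℂ) : ContDiffAt ℝ ∞ F z := h.smooth.contDiffAt

theorem contDiff_dx : ContDiff ℝ ∞ (dx F) :=
  contDiff_iff_contDiffAt.2 fun z => contDiffAt_dx (h.contDiffAt z)

theorem contDiff_dy : ContDiff ℝ ∞ (dy F) :=
  contDiff_iff_contDiffAt.2 fun z => contDiffAt_dy (h.contDiffAt z)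

theorem differentiable_dx : Differentiable ℝ (dx F) := h.contDiff_dx.differentiable (by simp)

theorem differentiable_dy : Differentiable ℝ (dy F) := h.contDiff_dy.differentiable (by simp)

theorem dx_dy (z : ℂ) : dx (dy F) z = dy (dx F) z := (dy_dx_eq_dx_dy (h.contDiffAt z)).symm

theorem re_xx (z : ℂ) : (dx (dx F) z).re = 0 :=
  re_fderiv_eq_zero h.differentiable_dx (fun z => (h.pair z).re_x) z 1

theorem re_xy (z : ℂ) : (dy (dx F) z).re = 0 :=
  re_fderiv_eq_zero h.differentiable_dx (fun z => (h.pair z).re_x) z Complex.I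

theorem re_yy (z : ℂ) : (dy (dy F) z).re = 0 :=
  re_fderiv_eq_zero h.differentiable_dy (fun z => (h.pair z).re_y) z Complex.I

theorem inner_xx_x (z : ℂ) :
    (inner ℝ (dx (dx F) z) (dx F z) : ℝ) = inner ℝ (dy (dx F) z) (dy F z) := by
  have := inner_fderiv_of_eq (h.differentiable_dx z) (h.differentiable_dx z)
    (h.differentiable_dy z) (h.differentiable_dy z) (fun w => by
      rw [real_inner_self_eq_norm_sq, real_inner_self_eq_norm_sq, (h.pair w).norm_eq]) 1
  rw [← h.dx_dy]
  change inner ℝ (fderiv ℝ (dx F) z 1) _ = inner ℝ (fderiv ℝ (dy F) z 1) _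
  linarith [real_inner_comm (fderiv ℝ (dx F) z 1) (dx F z),
    real_inner_comm (fderiv ℝ (dy F) z 1) (dy F z)]

theorem inner_xy_x (z : ℂ) :
    (inner ℝ (dy (dx F) z) (dx F z) : ℝ) = inner ℝ (dy (dy F) z) (dy F z) := by
  have := inner_fderiv_of_eq (h.differentiable_dx z) (h.differentiable_dx z)
    (h.differentiable_dy z) (h.differentiable_dy z) (fun w => by
      rw [real_inner_self_eq_norm_sq, real_inner_self_eq_norm_sq, (h.pair w).norm_eq]) Complex.I
  change inner ℝ (fderiv ℝ (dx F) z Complex.I) _ = inner ℝ (fderiv ℝ (dy F) z Complex.I) _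
  linarith [real_inner_comm (fderiv ℝ (dx F) z Complex.I) (dx F z),
    real_inner_comm (fderiv ℝ (dy F) z Complex.I) (dy F z)]

theorem inner_xx_y (z : ℂ) :
    (inner ℝ (dx (dx F) z) (dy F z) : ℝ) = -inner ℝ (dy (dx F) z) (dx F z) := by
  have := inner_fderiv_of_const (h.differentiable_dx z) (h.differentiable_dy z)
    (fun w => (h.pair w).inner_eq_zero) 1
  rw [← h.dx_dy, real_inner_comm (dx F z)]
  exact eq_neg_of_add_eq_zero_left this

theorem inner_yy_x (z : ℂ) :
    (inner ℝ (dy (dy F) z) (dx F z) : ℝ) = -inner ℝ (dy (dx F) z) (dy F z) := by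
  have := inner_fderiv_of_const (h.differentiable_dx z) (h.differentiable_dy z)
    (fun w => (h.pair w).inner_eq_zero) Complex.I
  rw [real_inner_comm (dx F z)]
  exact eq_neg_of_add_eq_zero_right this

theorem contDiff_normal : ContDiff ℝ ∞ (normal F) := by
  unfold normal
  refine ContDiff.smul (ContDiff.inv (h.contDiff_dx.norm_sq ℝ) fun z => ?_)
    (h.contDiff_dx.mul h.contDiff_dy)
  exact (h.pair z).norm_sq_pos.ne'

theorem differentiable_normal : Differentiable ℝ (normal F) :=
  h.contDiff_normal.differentiable (by simp)

theorem re_normal (z : ℂ) : (normal F z).re = 0 := by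
  simp only [normal, Quaternion.re_smul, (h.pair z).re_mul, smul_zero]

theorem inner_x_normal (z : ℂ) : inner ℝ (dx F z) (normal F z) = (0 : ℝ) := by
  obtain ⟨h1, h2, h3⟩ := (h.pair z).eqs
  rw [normal, inner_smul_right, inner_eq]
  simp [(h.pair z).re_x, (h.pair z).re_y]
  right
  ring

theorem inner_y_normal (z : ℂ) : inner ℝ (dy F z) (normal F z) = (0 : ℝ) := by
  obtain ⟨h1, h2, h3⟩ := (h.pair z).eqs
  rw [normal, inner_smul_right, inner_eq]
  simp [(h.pair z).re_x, (h.pair z).re_y]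
  right
  ring

theorem norm_normal (z : ℂ) : ‖normal F z‖ = 1 := by
  have := norm_ne_zero_iff.2 (h.pair z).ne_zero
  rw [normal, norm_smul, norm_mul, ← (h.pair z).norm_eq, norm_inv, norm_pow, norm_norm]
  field_simp

theorem inner_fderiv_normal_x (z v : ℂ) :
    (inner ℝ (fderiv ℝ (normal F) z v) (dx F z) : ℝ) =
      -inner ℝ (fderiv ℝ (dx F) z v) (normal F z) := by
  have := inner_fderiv_of_const (h.differentiable_dx z) (h.differentiable_normal z)
    h.inner_x_normal v
  rw [real_inner_comm (dx F z)]
  linarith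

theorem inner_fderiv_normal_y (z v : ℂ) :
    (inner ℝ (fderiv ℝ (normal F) z v) (dy F z) : ℝ) =
      -inner ℝ (fderiv ℝ (dy F) z v) (normal F z) := by
  have := inner_fderiv_of_const (h.differentiable_dy z) (h.differentiable_normal z)
    h.inner_y_normal v
  rw [real_inner_comm (dy F z)]
  linarith

theorem inner_fderiv_normal_normal (z v : ℂ) :
    inner ℝ (fderiv ℝ (normal F) z v) (normal F z) = (0 : ℝ) := by
  have := inner_fderiv_of_const (c := 1) (h.differentiable_normal z) (h.differentiable_normal z)
    (fun w => by rw [real_inner_self_eq_norm_sq, h.norm_normal]; norm_num) v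
  rw [real_inner_comm (fderiv ℝ (normal F) z v) (normal F z)] at this
  linarith

/-- The Weingarten equation: `dN` is tangent, since `N` has unit length, and its tangential
components are minus those of the second fundamental form. It is stated paired with `u` because the
Codazzi equations need it only in that form. -/
theorem inner_fderiv_normal (z v : ℂ) {u : ℍ[ℝ]} (hu : u.re = 0) :
    ‖dx F z‖ ^ 2 * (inner ℝ u (fderiv ℝ (normal F) z v) : ℝ) =
      -(inner ℝ u (dx F z) * inner ℝ (fderiv ℝ (dx F) z v) (normal F z) +
        inner ℝ u (dy F z) * inner ℝ (fderiv ℝ (dy F) z v) (normal F z)) := by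
  have := (h.pair z).parseval hu (re_fderiv_eq_zero h.differentiable_normal h.re_normal z v)
  change _ = _ + _ * (_ * inner ℝ _ (normal F z)) at this
  rw [h.inner_fderiv_normal_x, h.inner_fderiv_normal_y, h.inner_fderiv_normal_normal] at this
  rw [this]
  ring

theorem differentiable_sffXX : Differentiable ℝ (sffXX F) := fun z =>
  ((contDiffAt_dx h.contDiff_dx.contDiffAt).differentiableAt (by simp)).inner ℝ
    (h.differentiable_normal z)

theorem differentiable_sffXY : Differentiable ℝ (sffXY F) := fun z =>
  ((contDiffAt_dy h.contDiff_dx.contDiffAt).differentiableAt (by simp)).inner ℝ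
    (h.differentiable_normal z)

theorem differentiable_sffYY : Differentiable ℝ (sffYY F) := fun z =>
  ((contDiffAt_dy h.contDiff_dy.contDiffAt).differentiableAt (by simp)).inner ℝ
    (h.differentiable_normal z)

/-- The first Codazzi equation. -/
theorem codazzi₁ (z : ℂ) :
    ‖dx F z‖ ^ 2 * (fderiv ℝ (sffXX F) z Complex.I - fderiv ℝ (sffXY F) z 1) =
      inner ℝ (dy (dx F) z) (dx F z) * (sffXX F z + sffYY F z) := by
  have d1 := (contDiffAt_dx (h.contDiff_dx.contDiffAt (x := z))).differentiableAt (by simp)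
  have d2 := (contDiffAt_dy (h.contDiff_dx.contDiffAt (x := z))).differentiableAt (by simp)
  have e1 : fderiv ℝ (sffXX F) z Complex.I = _ :=
    fderiv_inner_apply ℝ d1 (h.differentiable_normal z) Complex.I
  have e2 : fderiv ℝ (sffXY F) z 1 = _ :=
    fderiv_inner_apply ℝ d2 (h.differentiable_normal z) 1
  -- The third derivatives cancel in the difference. What remains are products of second derivatives
  -- of `F` with derivatives of `N`, which Weingarten evaluates.
  have e3 : fderiv ℝ (dx (dx F)) z Complex.I = fderiv ℝ (dy (dx F)) z 1 :=
    dy_dx_eq_dx_dy h.contDiff_dx.contDiffAt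
  have e4 := h.inner_fderiv_normal z Complex.I (h.re_xx z)
  have e5 := h.inner_fderiv_normal z 1 (h.re_xy z)
  have e6 : fderiv ℝ (dy F) z 1 = dy (dx F) z := h.dx_dy z
  have e7 := h.inner_xx_x z
  have e8 := h.inner_xx_y z
  rw [e6] at e5
  rw [e1, e2, e3]
  simp only [sffXX, sffYY]
  change _ = -(_ * inner ℝ (dy (dx F) z) _ + _ * inner ℝ (dy (dy F) z) _) at e4
  change _ = -(_ * inner ℝ (dx (dx F) z) _ + _) at e5
  rw [e7, e8] at e4
  linear_combination e4 - e5

/-- The second Codazzi equation. -/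
theorem codazzi₂ (z : ℂ) :
    ‖dx F z‖ ^ 2 * (fderiv ℝ (sffYY F) z 1 - fderiv ℝ (sffXY F) z Complex.I) =
      inner ℝ (dx (dx F) z) (dx F z) * (sffXX F z + sffYY F z) := by
  have d1 := (contDiffAt_dy (h.contDiff_dy.contDiffAt (x := z))).differentiableAt (by simp)
  have d2 := (contDiffAt_dy (h.contDiff_dx.contDiffAt (x := z))).differentiableAt (by simp)
  have e1 : fderiv ℝ (sffYY F) z 1 = _ :=
    fderiv_inner_apply ℝ d1 (h.differentiable_normal z) 1
  have e2 : fderiv ℝ (sffXY F) z Complex.I = _ :=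
    fderiv_inner_apply ℝ d2 (h.differentiable_normal z) Complex.I
  have e3 : fderiv ℝ (dy (dy F)) z 1 = fderiv ℝ (dy (dx F)) z Complex.I := by
    rw [← funext h.dx_dy]
    exact (dy_dx_eq_dx_dy h.contDiff_dy.contDiffAt).symm
  have e4 := h.inner_fderiv_normal z 1 (h.re_yy z)
  have e5 := h.inner_fderiv_normal z Complex.I (h.re_xy z)
  have e6 : fderiv ℝ (dy F) z 1 = dy (dx F) z := h.dx_dy z
  have e7 := h.inner_yy_x z
  have e8 := h.inner_xy_x z
  rw [e6] at e4
  rw [e1, e2, e3, h.inner_xx_x]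
  simp only [sffXX, sffYY]
  change _ = -(_ * inner ℝ (dx (dx F) z) _ + _) at e4
  change _ = -(_ * inner ℝ (dy (dx F) z) _ + _ * inner ℝ (dy (dy F) z) _) at e5
  rw [e7, ← e8] at e4
  linear_combination e4 - e5

/-- In a conformal coordinate `F_xx + F_yy` has no tangential component, and its normal component is
the trace of the second fundamental form. -/
theorem laplacian_eq_zero {z : ℂ} (hm : sffXX F z + sffYY F z = 0) :
    dx (dx F) z + dy (dy F) z = 0 := by
  set u := dx (dx F) z + dy (dy F) z
  have hu : u.re = 0 := by
    simp [u, h.re_xx z, h.re_yy z]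
  have h1 := (h.pair z).parseval hu hu
  have hx : inner ℝ u (dx F z) = (0 : ℝ) := by
    rw [inner_add_left, h.inner_yy_x, h.inner_xx_x]; ring
  have hy : inner ℝ u (dy F z) = (0 : ℝ) := by
    rw [inner_add_left, h.inner_xx_y, h.inner_xy_x]; ring
  have hn : inner ℝ u (normal F z) = (0 : ℝ) := by
    rw [inner_add_left]; exact hm
  change _ = _ + _ * (_ * inner ℝ _ (normal F z)) at h1
  rw [hx, hy, hn] at h1
  have h2 : inner ℝ u u = (0 : ℝ) := by
    have := (h.pair z).norm_sq_pos.ne'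
    simpa [this] using h1
  exact inner_self_eq_zero.1 h2

end IsImaginaryImmersion

/-! ### Holomorphic functions from Cauchy-Riemann equations -/

/-- The combination `p - iq` is chosen to match `Q₂ - Q₁`, which is half of it when `p` and `q` are
the differences of `⟨F_xx, N⟩` and `⟨F_xy, N⟩` and the mean curvatures agree. -/
theorem differentiable_of_cauchyRiemann {p q : ℂ → ℝ} (hp : Differentiable ℝ p)
    (hq : Differentiable ℝ q) (h₁ : ∀ z, fderiv ℝ p z Complex.I = fderiv ℝ q z 1)
    (h₂ : ∀ z, fderiv ℝ p z 1 = -fderiv ℝ q z Complex.I) :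
    Differentiable ℂ (fun z => (p z : ℂ) - Complex.I * (q z : ℂ)) := by
  intro z
  have hp' : HasFDerivAt (fun w => (p w : ℂ)) (Complex.ofRealCLM ∘L fderiv ℝ p z) z :=
    Complex.ofRealCLM.hasFDerivAt.comp z (hp z).hasFDerivAt
  have hq' : HasFDerivAt (fun w => (q w : ℂ)) (Complex.ofRealCLM ∘L fderiv ℝ q z) z :=
    Complex.ofRealCLM.hasFDerivAt.comp z (hq z).hasFDerivAt
  have hd := hp'.sub (hq'.const_mul Complex.I)
  refine differentiableAt_complex_iff_differentiableAt_real.2 ⟨hd.differentiableAt, ?_⟩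
  have e : fderiv ℝ (fun z => (p z : ℂ) - Complex.I * (q z : ℂ)) z = _ := hd.fderiv
  rw [e]
  simp [h₁ z, h₂ z]
  linear_combination (fderiv ℝ q z 1 : ℂ) * Complex.I_mul_I

theorem bounded_of_periodic {V : Type*} [NormedAddCommGroup V] (L : Submodule ℤ ℂ)
    [DiscreteTopology L] [IsZLattice ℝ L] {f : ℂ → V} (hf : Continuous f)
    (h : ∀ l ∈ L, ∀ z, f (z + l) = f z) : Bornology.IsBounded (Set.range f) :=
  (IsZLattice.isCompact_range_of_periodic L f hf fun z w hw => h w hw z).isBounded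

/-- Liouville's theorem: a continuous function that is periodic under a full lattice is bounded. -/
theorem const_of_cauchyRiemann_periodic (L : Submodule ℤ ℂ)
    [DiscreteTopology L] [IsZLattice ℝ L] {p q : ℂ → ℝ} (hp : Differentiable ℝ p)
    (hq : Differentiable ℝ q) (h₁ : ∀ z, fderiv ℝ p z Complex.I = fderiv ℝ q z 1)
    (h₂ : ∀ z, fderiv ℝ p z 1 = -fderiv ℝ q z Complex.I)
    (hp' : ∀ l ∈ L, ∀ z, p (z + l) = p z) (hq' : ∀ l ∈ L, ∀ z, q (z + l) = q z) (z w : ℂ) :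
    p z = p w ∧ q z = q w := by
  have hd := differentiable_of_cauchyRiemann hp hq h₁ h₂
  have := hd.apply_eq_apply_of_bounded
    (bounded_of_periodic L hd.continuous fun l hl z => by simp only [hp' l hl, hq' l hl]) z w
  have := Complex.ext_iff.1 this
  simpa using this

/-- The difference of the Hopf differentials of a Bonnet pair with doubly periodic frames is
constant. -/
theorem sff_sub_const (L : Submodule ℤ ℂ)
    [DiscreteTopology L] [IsZLattice ℝ L] {F₁ F₂ : ℂ → ℍ[ℝ]} (h₁ : IsImaginaryImmersion F₁)
    (h₂ : IsImaginaryImmersion F₂) (hn : ∀ z, ‖dx F₁ z‖ = ‖dx F₂ z‖)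
    (hm : ∀ z, sffXX F₁ z + sffYY F₁ z = sffXX F₂ z + sffYY F₂ z)
    (p₁ : IsPeriodic L (fderiv ℝ F₁)) (p₂ : IsPeriodic L (fderiv ℝ F₂)) (z w : ℂ) :
    sffXX F₂ z - sffXX F₁ z = sffXX F₂ w - sffXX F₁ w ∧
      sffXY F₂ z - sffXY F₁ z = sffXY F₂ w - sffXY F₁ w := by
  -- These products are half the derivatives of the common metric factor. With the equal traces
  -- `hm`, the right-hand sides of the Codazzi equations agree for both surfaces, so the differences
  -- satisfy the Cauchy-Riemann equations.
  have key : ∀ z v, (inner ℝ (fderiv ℝ (dx F₁) z v) (dx F₁ z) : ℝ) =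
      inner ℝ (fderiv ℝ (dx F₂) z v) (dx F₂ z) := by
    intro z v
    have := inner_fderiv_of_eq (h₁.differentiable_dx z) (h₁.differentiable_dx z)
      (h₂.differentiable_dx z) (h₂.differentiable_dx z) (fun w => by
        rw [real_inner_self_eq_norm_sq, real_inner_self_eq_norm_sq, hn w]) v
    linarith [real_inner_comm (fderiv ℝ (dx F₁) z v) (dx F₁ z),
      real_inner_comm (fderiv ℝ (dx F₂) z v) (dx F₂ z)]
  have hpos := fun z => (h₁.pair z).norm_sq_pos.ne'
  have dXX := h₂.differentiable_sffXX.sub h₁.differentiable_sffXX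
  have dXY := h₂.differentiable_sffXY.sub h₁.differentiable_sffXY
  have per : ∀ F : ℂ → ℍ[ℝ], IsPeriodic L (fderiv ℝ F) → ∀ l ∈ L, ∀ z,
      sffXX F (z + l) = sffXX F z ∧ sffXY F (z + l) = sffXY F z := by
    intro F hF l hl z
    have hx : ∀ z, dx F (z + l) = dx F z := fun z => by rw [dx, hF l hl, dx]
    have hy : ∀ z, dy F (z + l) = dy F z := fun z => by rw [dy, hF l hl, dy]
    have hnn : normal F (z + l) = normal F z := by rw [normal, hx, hy, normal]
    have hxx : fderiv ℝ (dx F) (z + l) = fderiv ℝ (dx F) z := by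
      rw [← fderiv_comp_add_right, funext hx]
    simp only [sffXX, sffXY, hnn, dx, dy]
    constructor
    · exact congrArg (fun A : ℂ →L[ℝ] ℍ[ℝ] => (inner ℝ (A 1) (normal F z) : ℝ)) hxx
    · exact congrArg (fun A : ℂ →L[ℝ] ℍ[ℝ] => (inner ℝ (A Complex.I) (normal F z) : ℝ)) hxx
  have := const_of_cauchyRiemann_periodic L dXX dXY (fun z => ?_) (fun z => ?_) (fun l hl z => ?_)
    (fun l hl z => ?_) z w
  · simpa using this
  · have c1 := h₁.codazzi₁ z
    have c2 := h₂.codazzi₁ z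
    have k := key z Complex.I
    change inner ℝ (dy (dx F₁) z) _ = inner ℝ (dy (dx F₂) z) _ at k
    rw [← hn, ← k, ← hm] at c2
    rw [fderiv_sub (h₂.differentiable_sffXX z) (h₁.differentiable_sffXX z),
      fderiv_sub (h₂.differentiable_sffXY z) (h₁.differentiable_sffXY z)]
    apply mul_left_cancel₀ (hpos z)
    simp only [sub_apply]
    linear_combination c2 - c1
  · have c1 := h₁.codazzi₂ z
    have c2 := h₂.codazzi₂ z
    have k := key z 1
    change inner ℝ (dx (dx F₁) z) _ = inner ℝ (dx (dx F₂) z) _ at k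
    rw [← hn, ← k, ← hm] at c2
    have hYY : (sffXX F₂ - sffXX F₁) = -(sffYY F₂ - sffYY F₁) := by
      ext z
      simp
      linarith [hm z]
    rw [hYY, fderiv_neg, fderiv_sub (h₂.differentiable_sffYY z) (h₁.differentiable_sffYY z),
      fderiv_sub (h₂.differentiable_sffXY z) (h₁.differentiable_sffXY z)]
    apply mul_left_cancel₀ (hpos z)
    simp only [sub_apply, neg_apply]
    linear_combination c1 - c2
  · simp [per _ p₁ l hl z, per _ p₂ l hl z]
  · simp [per _ p₁ l hl z, per _ p₂ l hl z]

/-- A minimal surface with doubly periodic frame is flat. -/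
theorem sff_eq_zero_of_minimal (L : Submodule ℤ ℂ) [DiscreteTopology L] [IsZLattice ℝ L]
    {F : ℂ → ℍ[ℝ]} (h : IsImaginaryImmersion F) (hm : ∀ z, sffXX F z + sffYY F z = 0)
    (p : IsPeriodic L (fderiv ℝ F)) (z : ℂ) :
    sffXX F z = 0 ∧ sffXY F z = 0 := by
  -- Each coordinate of a conformal minimal immersion is harmonic, so `⟨F_x, u⟩ - i⟨F_y, u⟩` is an
  -- entire periodic function, hence constant.
  have key : ∀ u : ℍ[ℝ], ∀ w, (inner ℝ (dx F w) u : ℝ) = inner ℝ (dx F 0) u := by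
    intro u w
    have d : ∀ f : ℂ → ℍ[ℝ], Differentiable ℝ f → ∀ z v,
        fderiv ℝ (fun z => (inner ℝ (f z) u : ℝ)) z v = inner ℝ (fderiv ℝ f z v) u := by
      intro f hf z v
      rw [fderiv_inner_apply ℝ (hf z) (differentiableAt_const u)]
      simp
    refine (const_of_cauchyRiemann_periodic L (p := fun z => inner ℝ (dx F z) u)
      (q := fun z => inner ℝ (dy F z) u)
      (fun z => (h.differentiable_dx z).inner ℝ (differentiableAt_const u))
      (fun z => (h.differentiable_dy z).inner ℝ (differentiableAt_const u)) (fun z => ?_)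
      (fun z => ?_) (fun l hl z => ?_) (fun l hl z => ?_) w 0).1
    · rw [d _ h.differentiable_dx, d _ h.differentiable_dy]
      have := h.dx_dy z
      simp only [dx, dy] at this ⊢
      rw [this]
    · rw [d _ h.differentiable_dx, d _ h.differentiable_dy]
      have := eq_neg_of_add_eq_zero_left (h.laplacian_eq_zero (hm z))
      rw [← inner_neg_left]
      exact congrArg (fun a => (inner ℝ a u : ℝ)) this
    · simp only [dx, p l hl]
    · simp only [dy, p l hl]
  have hc : dx F = fun _ => dx F 0 := by
    ext1 w
    exact ext_inner_right ℝ fun u => key u w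
  have h0 : fderiv ℝ (dx F) z = 0 := by
    rw [hc]; simp
  constructor
  · have : dx (dx F) z = 0 := by rw [dx, h0]; rfl
    rw [sffXX, this, inner_zero_left]
  · have : dy (dx F) z = 0 := by rw [dy, h0]; rfl
    rw [sffXY, this, inner_zero_left]

/-! ### Congruent surfaces -/

theorem inner_fderiv_right_of_eq {b b' : ℂ → ℍ[ℝ]} {u u' : ℍ[ℝ]} (hb : Differentiable ℝ b)
    (hb' : Differentiable ℝ b') (h : ∀ w, (inner ℝ u (b w) : ℝ) = inner ℝ u' (b' w)) (w v : ℂ) :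
    (inner ℝ u (fderiv ℝ b w v) : ℝ) = inner ℝ u' (fderiv ℝ b' w v) := by
  have := inner_fderiv_of_eq (differentiableAt_const u) (hb w) (differentiableAt_const u')
    (hb' w) h v
  simpa using this

theorem inner_fderiv_left_of_eq {b b' : ℂ → ℍ[ℝ]} {u u' : ℍ[ℝ]} (hb : Differentiable ℝ b)
    (hb' : Differentiable ℝ b') (h : ∀ w, (inner ℝ (b w) u : ℝ) = inner ℝ (b' w) u') (w v : ℂ) :
    (inner ℝ (fderiv ℝ b w v) u : ℝ) = inner ℝ (fderiv ℝ b' w v) u' := by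
  rw [real_inner_comm, real_inner_comm u']
  exact inner_fderiv_right_of_eq hb hb'
    (fun w => by rw [real_inner_comm, h, real_inner_comm]) w v

/-- Differentiate `|F z - F w|²`, first in `z` and then in `w`. Thus congruence is used only through
distances, without constructing the isometry. -/
theorem inner_fderiv_eq_of_congruent {F₁ F₂ : ℂ → ℍ[ℝ]} (h₁ : Differentiable ℝ F₁)
    (h₂ : Differentiable ℝ F₂) (hc : Congruent F₁ F₂) (z w v v' : ℂ) :
    (inner ℝ (fderiv ℝ F₁ z v) (fderiv ℝ F₁ w v') : ℝ) =
      inner ℝ (fderiv ℝ F₂ z v) (fderiv ℝ F₂ w v') := by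
  have step : ∀ w, (inner ℝ (fderiv ℝ F₁ z v) (F₁ z - F₁ w) : ℝ) =
      inner ℝ (fderiv ℝ F₂ z v) (F₂ z - F₂ w) := by
    intro w
    have := inner_fderiv_of_eq ((h₁ z).sub_const (F₁ w)) ((h₁ z).sub_const (F₁ w))
      ((h₂ z).sub_const (F₂ w)) ((h₂ z).sub_const (F₂ w)) (fun u => by
        have := hc.dist_eq u w
        rw [dist_eq_norm, dist_eq_norm] at this
        rw [real_inner_self_eq_norm_sq, real_inner_self_eq_norm_sq, this]) v
    rw [fderiv_sub_const, fderiv_sub_const] at this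
    linarith [real_inner_comm (fderiv ℝ F₁ z v) (F₁ z - F₁ w),
      real_inner_comm (fderiv ℝ F₂ z v) (F₂ z - F₂ w)]
  have := inner_fderiv_right_of_eq (fun w => (h₁ w).const_sub (F₁ z))
    (fun w => (h₂ w).const_sub (F₂ z)) step w v'
  rw [fderiv_const_sub, fderiv_const_sub] at this
  simpa using this

/-- The map `F₂ - S F₁ S⁻¹` has zero derivative, so the surfaces differ by a fixed rotation and a
translation. -/
theorem congruent_of_fderiv_conj {F₁ F₂ : ℂ → ℍ[ℝ]} (h₁ : Differentiable ℝ F₁)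
    (h₂ : Differentiable ℝ F₂) {S : ℍ[ℝ]} (hS : ‖S‖ = 1)
    (h : ∀ z v, fderiv ℝ F₂ z v = S * fderiv ℝ F₁ z v * star S) : Congruent F₁ F₂ := by
  have hd : ∀ z, HasFDerivAt (fun z => F₂ z - S * F₁ z * star S) (0 : ℂ →L[ℝ] ℍ[ℝ]) z := by
    intro z
    have h3 := (h₂ z).hasFDerivAt.sub (((h₁ z).hasFDerivAt.const_mul S).mul_const' (star S))
    convert! h3 using 1
    ext1 v
    simp [h z v]
  have hconst : ∀ z w, F₂ z - S * F₁ z * star S = F₂ w - S * F₁ w * star S :=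
    is_const_of_fderiv_eq_zero (𝕜 := ℝ) (fun z => (hd z).differentiableAt)
      fun z => (hd z).fderiv
  refine congruent_iff_dist_eq.2 fun z w => ?_
  rw [dist_eq_norm, dist_eq_norm]
  have : F₂ z - F₂ w = S * (F₁ z - F₁ w) * star S := by
    have := hconst z w
    rw [mul_sub, sub_mul]
    rw [sub_eq_sub_iff_add_eq_add] at this ⊢
    rw [this, add_comm]
  rw [this, norm_mul, norm_mul, norm_star, hS]
  simp

/-- Congruent surfaces have second fundamental forms equal up to sign at each point, while here only
the `xy` coefficient jumps, by `2`. This forces the `xx` and `yy` coefficients to vanish, so both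
surfaces are minimal; with periodic differentials they are flat, and then the `xy` coefficients
cannot differ. -/
theorem not_congruent_of_normalized (L : Submodule ℤ ℂ) [DiscreteTopology L] [IsZLattice ℝ L]
    {F₁ F₂ : ℂ → ℍ[ℝ]} (h₁ : IsImaginaryImmersion F₁) (h₂ : IsImaginaryImmersion F₂)
    (hm : ∀ z, sffXX F₁ z + sffYY F₁ z = sffXX F₂ z + sffYY F₂ z)
    (hh : ∀ z, sffXX F₂ z - sffXX F₁ z = 0 ∧ sffXY F₂ z - sffXY F₁ z = 2)
    (p₁ : IsPeriodic L (fderiv ℝ F₁)) (p₂ : IsPeriodic L (fderiv ℝ F₂)) :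
    ¬ Congruent F₁ F₂ := by
  intro hc
  have D₁ := h₁.smooth.differentiable (by simp)
  have D₂ := h₂.smooth.differentiable (by simp)
  have dd : ∀ F : ℂ → ℍ[ℝ], IsImaginaryImmersion F → ∀ v,
      Differentiable ℝ (fun z => fderiv ℝ F z v) := fun F hF v z =>
    (contDiffAt_fderiv_apply (hF.contDiffAt z) v).differentiableAt (by simp)
  have g1 := inner_fderiv_eq_of_congruent D₁ D₂ hc
  have g2 : ∀ z w v v' u, (inner ℝ (fderiv ℝ (fun z => fderiv ℝ F₁ z v) z u)
      (fderiv ℝ F₁ w v') : ℝ) =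
      inner ℝ (fderiv ℝ (fun z => fderiv ℝ F₂ z v) z u) (fderiv ℝ F₂ w v') :=
    fun z w v v' u => inner_fderiv_left_of_eq (dd _ h₁ v) (dd _ h₂ v)
      (fun z => g1 z w v v') z u
  have g3 : ∀ z w v v' u u', (inner ℝ (fderiv ℝ (fun z => fderiv ℝ F₁ z v) z u)
      (fderiv ℝ (fun z => fderiv ℝ F₁ z v') w u') : ℝ) =
      inner ℝ (fderiv ℝ (fun z => fderiv ℝ F₂ z v) z u)
        (fderiv ℝ (fun z => fderiv ℝ F₂ z v') w u') :=
    fun z w v v' u u' => inner_fderiv_right_of_eq (dd _ h₁ v') (dd _ h₂ v')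
      (fun w => g2 z w v v' u) w u'
  have hn : ∀ z, ‖dx F₁ z‖ ^ 2 = ‖dx F₂ z‖ ^ 2 := fun z => by
    rw [← real_inner_self_eq_norm_sq, ← real_inner_self_eq_norm_sq]
    exact g1 z z 1 1
  -- Parseval removes the tangential parts of the products of second derivatives. Products of two
  -- coefficients are compared because the congruence may reverse orientation, which changes the
  -- sign of the normal component.
  have prod : ∀ z v v' u u',
      (inner ℝ (fderiv ℝ (fun z => fderiv ℝ F₁ z v) z u) (normal F₁ z) : ℝ) *
        inner ℝ (fderiv ℝ (fun z => fderiv ℝ F₁ z v') z u') (normal F₁ z) =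
      inner ℝ (fderiv ℝ (fun z => fderiv ℝ F₂ z v) z u) (normal F₂ z) *
        inner ℝ (fderiv ℝ (fun z => fderiv ℝ F₂ z v') z u') (normal F₂ z) := by
    intro z v v' u u'
    have re : ∀ F : ℂ → ℍ[ℝ], IsImaginaryImmersion F → ∀ v u,
        (fderiv ℝ (fun z => fderiv ℝ F z v) z u).re = 0 := by
      intro F hF v u
      refine re_fderiv_eq_zero (dd F hF v) (fun z => ?_) z u
      rw [fderiv_apply_complex]
      simp [(hF.pair z).re_x, (hF.pair z).re_y]
    have e1 := (h₁.pair z).parseval (re F₁ h₁ v u) (re F₁ h₁ v' u')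
    have e2 := (h₂.pair z).parseval (re F₂ h₂ v u) (re F₂ h₂ v' u')
    have a1 := g2 z z v 1 u
    have a2 := g2 z z v Complex.I u
    have a3 := g2 z z v' 1 u'
    have a4 := g2 z z v' Complex.I u'
    rw [g3 z z v v' u u'] at e1
    simp only [dx, dy] at e1
    rw [a1, a2, a3, a4] at e1
    have e3 := e1.symm
    have := hn z
    simp only [dx] at this
    rw [this] at e3
    simp only [dx, dy] at e2
    rw [e2, ← this] at e3
    have e4 := add_left_cancel e3
    have e5 := mul_left_cancel₀ (h₁.pair z).norm_sq_pos.ne' e4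
    simp only [normal, dx, dy]
    rw [← this]
    exact e5
  have mean0 : ∀ z, sffXX F₁ z + sffYY F₁ z = 0 := by
    intro z
    -- With `r1` and `r3`, the relation `L M = L (M + 2)` gives `L = 0` for the `xx` coefficient;
    -- `p2` gives the same for `yy`.
    have p1 : sffXX F₁ z * sffXY F₁ z = sffXX F₂ z * sffXY F₂ z := prod z 1 1 1 Complex.I
    have p2 : sffYY F₁ z * sffXY F₁ z = sffYY F₂ z * sffXY F₂ z :=
      prod z Complex.I 1 Complex.I Complex.I
    obtain ⟨q1, q2⟩ := hh z
    have q3 := hm z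
    have r1 : sffXX F₂ z = sffXX F₁ z := by linarith
    have r2 : sffYY F₂ z = sffYY F₁ z := by linarith
    have r3 : sffXY F₂ z = sffXY F₁ z + 2 := by linarith
    rw [r1, r3] at p1
    rw [r2, r3] at p2
    linarith
  have f1 := (sff_eq_zero_of_minimal L h₁ mean0 p₁ 0).2
  have f2 := (sff_eq_zero_of_minimal L h₂ (fun z => (hm z) ▸ mean0 z) p₂ 0).2
  have := (hh 0).2
  rw [f1, f2] at this
  norm_num at this

/-! ### Gauge transformations between surfaces -/

/-- Near `z`, the differential of `F₂` is the differential of `F₁` conjugated by the unit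
quaternions `T`. -/
structure IsGaugeAt (F₁ F₂ T : ℂ → ℍ[ℝ]) (z : ℂ) : Prop where
  smooth : ContDiffAt ℝ ∞ T z
  unit : ∀ᶠ w in 𝓝 z, ‖T w‖ = 1
  conj : ∀ᶠ w in 𝓝 z, ∀ v, fderiv ℝ F₂ w v = T w * fderiv ℝ F₁ w v * star (T w)

theorem inner_fderiv_of_unit {T : ℂ → ℍ[ℝ]} {z : ℂ} (hT : DifferentiableAt ℝ T z)
    (h : ∀ᶠ w in 𝓝 z, ‖T w‖ = 1) (v : ℂ) : inner ℝ (T z) (fderiv ℝ T z v) = (0 : ℝ) := by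
  have h1 := fderiv_inner_apply ℝ hT hT v
  have h2 : (fun w => (inner ℝ (T w) (T w) : ℝ)) =ᶠ[𝓝 z] fun _ => 1 := by
    filter_upwards [h] with w hw
    rw [real_inner_self_eq_norm_sq, hw]
    norm_num
  rw [h2.fderiv_eq] at h1
  simp at h1
  linarith [real_inner_comm (T z) (fderiv ℝ T z v)]

theorem re_star_mul (a b : ℍ[ℝ]) : (star a * b).re = (inner ℝ a b : ℝ) := by
  rw [inner_eq]
  simp

namespace IsGaugeAt

variable {F₁ F₂ T : ℂ → ℍ[ℝ]} {z : ℂ} (g : IsGaugeAt F₁ F₂ T z)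
include g

theorem differentiableAt : DifferentiableAt ℝ T z := g.smooth.differentiableAt (by simp)

theorem norm_eq_one : ‖T z‖ = 1 := g.unit.self_of_nhds

theorem star_mul_self : star (T z) * T z = 1 := star_mul_self_of_norm g.norm_eq_one

theorem self_mul_star : T z * star (T z) = 1 := self_mul_star_of_norm g.norm_eq_one

theorem re_logDeriv (v : ℂ) : (star (T z) * fderiv ℝ T z v).re = 0 := by
  rw [re_star_mul]
  exact inner_fderiv_of_unit g.differentiableAt g.unit v

theorem fderiv_eq (v : ℂ) : fderiv ℝ T z v = T z * (star (T z) * fderiv ℝ T z v) := by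
  rw [← mul_assoc, g.self_mul_star, one_mul]

theorem star_fderiv (v : ℂ) :
    star (fderiv ℝ T z v) = -((star (T z) * fderiv ℝ T z v) * star (T z)) := by
  conv_lhs => rw [g.fderiv_eq v]
  rw [star_mul, star_eq_neg_of_re (g.re_logDeriv v)]
  simp

/-- With `α = T⁻¹ dT` imaginary, differentiating `T dF₁ T⁻¹` adds the commutator of `α` with `dF₁`
to the second derivative of `F₁`, before conjugation. -/
theorem fderiv_fderiv (h₁ : IsImaginaryImmersion F₁) (v w : ℂ) :
    fderiv ℝ (fun u => fderiv ℝ F₂ u v) z w =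
      T z * (fderiv ℝ (fun u => fderiv ℝ F₁ u v) z w +
        ((star (T z) * fderiv ℝ T z w) * fderiv ℝ F₁ z v -
          fderiv ℝ F₁ z v * (star (T z) * fderiv ℝ T z w))) * star (T z) := by
  have e : (fun u => fderiv ℝ F₂ u v) =ᶠ[𝓝 z]
      fun u => T u * fderiv ℝ F₁ u v * star (T u) := g.conj.mono fun u hu => hu v
  have d1 := (contDiffAt_fderiv_apply (h₁.contDiffAt z) v).differentiableAt (by simp)
  rw [e.fderiv_eq, fderiv_mul_apply (a := fun u => T u * fderiv ℝ F₁ u v) (g.differentiableAt.mul d1)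
    (differentiableAt_star g.differentiableAt), fderiv_mul_apply g.differentiableAt d1,
    fderiv_star_apply, g.star_fderiv w]
  nth_rewrite 1 [g.fderiv_eq w]
  generalize star (T z) * fderiv ℝ T z w = α
  noncomm_ring

theorem dx_eq : dx F₂ z = T z * dx F₁ z * star (T z) := g.conj.self_of_nhds 1

theorem dy_eq : dy F₂ z = T z * dy F₁ z * star (T z) := g.conj.self_of_nhds Complex.I

theorem norm_dx : ‖dx F₂ z‖ = ‖dx F₁ z‖ := by
  rw [g.dx_eq, norm_mul, norm_mul, norm_star, g.norm_eq_one]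
  simp

theorem normal_eq : normal F₂ z = T z * normal F₁ z * star (T z) := by
  rw [normal, normal, g.norm_dx, g.dx_eq, g.dy_eq]
  have : T z * dx F₁ z * star (T z) * (T z * dy F₁ z * star (T z)) =
      T z * dx F₁ z * (star (T z) * T z) * dy F₁ z * star (T z) := by noncomm_ring
  rw [this, g.star_mul_self]
  simp [mul_assoc]

theorem inner_normal (h₁ : IsImaginaryImmersion F₁) (v w : ℂ) :
    (inner ℝ (fderiv ℝ (fun u => fderiv ℝ F₂ u v) z w) (normal F₂ z) : ℝ) =
      inner ℝ (fderiv ℝ (fun u => fderiv ℝ F₁ u v) z w) (normal F₁ z) +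
      inner ℝ ((star (T z) * fderiv ℝ T z w) * fderiv ℝ F₁ z v -
          fderiv ℝ F₁ z v * (star (T z) * fderiv ℝ T z w)) (normal F₁ z) := by
  rw [g.fderiv_fderiv h₁, g.normal_eq, inner_conj g.norm_eq_one, inner_add_left]

theorem sffXX_sub (h₁ : IsImaginaryImmersion F₁) :
    sffXX F₂ z - sffXX F₁ z = -2 * (inner ℝ (star (T z) * dx T z) (dy F₁ z) : ℝ) := by
  rw [← (h₁.pair z).inner_commutator_x]
  exact sub_eq_iff_eq_add'.2 (g.inner_normal h₁ 1 1)

theorem sffXY_sub (h₁ : IsImaginaryImmersion F₁) :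
    sffXY F₂ z - sffXY F₁ z = -2 * (inner ℝ (star (T z) * dy T z) (dy F₁ z) : ℝ) := by
  rw [← (h₁.pair z).inner_commutator_x]
  exact sub_eq_iff_eq_add'.2 (g.inner_normal h₁ 1 Complex.I)

theorem sffXY_sub' (h₁ : IsImaginaryImmersion F₁) (h₂ : IsImaginaryImmersion F₂) :
    sffXY F₂ z - sffXY F₁ z = 2 * (inner ℝ (star (T z) * dx T z) (dx F₁ z) : ℝ) := by
  rw [← (h₁.pair z).inner_commutator_y, sffXY, sffXY, ← h₁.dx_dy, ← h₂.dx_dy]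
  exact sub_eq_iff_eq_add'.2 (g.inner_normal h₁ Complex.I 1)

theorem sffYY_sub (h₁ : IsImaginaryImmersion F₁) :
    sffYY F₂ z - sffYY F₁ z = 2 * (inner ℝ (star (T z) * dy T z) (dx F₁ z) : ℝ) := by
  rw [← (h₁.pair z).inner_commutator_y]
  exact sub_eq_iff_eq_add'.2 (g.inner_normal h₁ Complex.I Complex.I)

/-- The integrability condition for the rotated frame: mixed derivatives commute for `F₁` and for
`F₂`, so the correction terms must agree. -/
theorem commutator_eq (h₁ : IsImaginaryImmersion F₁) (h₂ : IsImaginaryImmersion F₂) :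
    star (T z) * dy T z * dx F₁ z - dx F₁ z * (star (T z) * dy T z) =
      star (T z) * dx T z * dy F₁ z - dy F₁ z * (star (T z) * dx T z) := by
  have e1 : dy (dx F₂) z = _ := g.fderiv_fderiv h₁ 1 Complex.I
  have e2 : dx (dy F₂) z = _ := g.fderiv_fderiv h₁ Complex.I 1
  rw [h₂.dx_dy, e1] at e2
  have hT : T z ≠ 0 := by
    rw [← norm_ne_zero_iff, g.norm_eq_one]
    exact one_ne_zero
  have e3 := mul_left_cancel₀ hT (mul_right_cancel₀ (star_ne_zero.2 hT) e2)
  have e4 : fderiv ℝ (fun u => fderiv ℝ F₁ u Complex.I) z 1 =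
      fderiv ℝ (fun u => fderiv ℝ F₁ u 1) z Complex.I := h₁.dx_dy z
  rw [e4] at e3
  exact add_left_cancel e3

/-- A commutator with `F_x` is orthogonal to `F_x`, and likewise for `F_y`. Pairing the
integrability condition with `F_x` and with `F_y` therefore kills one side and leaves a normal
component of `T⁻¹ dT` on the other. -/
theorem inner_logDeriv_normal (h₁ : IsImaginaryImmersion F₁) (h₂ : IsImaginaryImmersion F₂) :
    inner ℝ (star (T z) * dx T z) (dx F₁ z * dy F₁ z) = (0 : ℝ) ∧
      inner ℝ (star (T z) * dy T z) (dx F₁ z * dy F₁ z) = (0 : ℝ) := by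
  have e := g.commutator_eq h₁ h₂
  have h := h₁.pair z
  have zx : ∀ α : ℍ[ℝ], inner ℝ (α * dx F₁ z - dx F₁ z * α) (dx F₁ z) = (0 : ℝ) := by
    intro α
    rw [inner_eq]
    simp [h.re_x]
    ring
  have zy : ∀ α : ℍ[ℝ], inner ℝ (α * dy F₁ z - dy F₁ z * α) (dy F₁ z) = (0 : ℝ) := by
    intro α
    rw [inner_eq]
    simp [h.re_y]
    ring
  constructor
  · have h1 := h.inner_commutator_y_x (star (T z) * dx T z)
    rw [← e, zx] at h1
    linarith
  · have h1 := h.inner_commutator_x_y (star (T z) * dy T z)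
    rw [e, zy] at h1
    linarith

/-- Since `T⁻¹ T_x` is tangent, it is determined by its products with `F_x` and `F_y`, which are the
changes of the second fundamental form. This makes `T` depend on the Bonnet pair through first-order
data alone. -/
theorem dx_gauge (h₁ : IsImaginaryImmersion F₁) (h₂ : IsImaginaryImmersion F₂) :
    dx T z = T z * ((2 * ‖dx F₁ z‖ ^ 2)⁻¹ • ((sffXY F₂ z - sffXY F₁ z) • dx F₁ z -
      (sffXX F₂ z - sffXX F₁ z) • dy F₁ z)) := by
  have e := (h₁.pair z).expansion (g.re_logDeriv 1) (g.inner_logDeriv_normal h₁ h₂).1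
  have e' : dx T z = _ := g.fderiv_eq 1
  rw [e', e, g.sffXY_sub' h₁ h₂, g.sffXX_sub h₁, mul_inv, mul_smul, smul_comm]
  simp only [dx]
  congr 2
  module

theorem dy_gauge (h₁ : IsImaginaryImmersion F₁) (h₂ : IsImaginaryImmersion F₂) :
    dy T z = T z * ((2 * ‖dx F₁ z‖ ^ 2)⁻¹ • ((sffYY F₂ z - sffYY F₁ z) • dx F₁ z -
      (sffXY F₂ z - sffXY F₁ z) • dy F₁ z)) := by
  have e := (h₁.pair z).expansion (g.re_logDeriv Complex.I) (g.inner_logDeriv_normal h₁ h₂).2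
  have e' : dy T z = _ := g.fderiv_eq Complex.I
  rw [e', e, g.sffYY_sub h₁, g.sffXY_sub h₁, mul_inv, mul_smul, smul_comm]
  simp only [dy]
  congr 2
  module

end IsGaugeAt

/-! ### Continuous functions that agree up to sign -/

/-- The sign is that of the continuous function `⟨f, g⟩`, which is nonzero at `z`. -/
theorem eventually_eq_or_neg {f g : ℂ → ℍ[ℝ]} {z : ℂ} (hf : ContinuousAt f z)
    (hg : ContinuousAt g z) (h₀ : f z ≠ 0) (h : ∀ᶠ w in 𝓝 z, g w = f w ∨ g w = -f w) :
    (g =ᶠ[𝓝 z] f) ∨ (g =ᶠ[𝓝 z] fun w => -f w) := by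
  have hc : ContinuousAt (fun w => (inner ℝ (f w) (g w) : ℝ)) z := hf.inner hg
  have hpos : 0 < ‖f z‖ ^ 2 := by
    have := norm_pos_iff.2 h₀
    positivity
  rcases h.self_of_nhds with e | e
  · left
    have : 0 < (inner ℝ (f z) (g z) : ℝ) := by
      rw [e, real_inner_self_eq_norm_sq]
      exact hpos
    filter_upwards [h, hc.eventually (lt_mem_nhds this)] with w hw hw'
    refine hw.resolve_right fun hn => ?_
    rw [hn, inner_neg_right, real_inner_self_eq_norm_sq] at hw'
    nlinarith [sq_nonneg ‖f w‖]
  · right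
    have : (inner ℝ (f z) (g z) : ℝ) < 0 := by
      rw [e, inner_neg_right, real_inner_self_eq_norm_sq]
      linarith
    filter_upwards [h, hc.eventually (gt_mem_nhds this)] with w hw hw'
    refine hw.resolve_left fun hn => ?_
    rw [hn, real_inner_self_eq_norm_sq] at hw'
    nlinarith [sq_nonneg ‖f w‖]

/-- The set where the sign is `+` is closed and, as `f` has no zeros, also open; `ℂ` is connected.
-/
theorem eq_or_neg_of_continuous {f g : ℂ → ℍ[ℝ]} (hf : Continuous f) (hg : Continuous g)
    (h₀ : ∀ z, f z ≠ 0) (h : ∀ z, g z = f z ∨ g z = -f z) :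
    (∀ z, g z = f z) ∨ ∀ z, g z = -f z := by
  have hclopen : IsClopen {z | g z = f z} := by
    refine ⟨isClosed_eq hg hf, isOpen_iff_mem_nhds.2 fun z hz => ?_⟩
    rcases eventually_eq_or_neg hf.continuousAt hg.continuousAt (h₀ z)
      (Eventually.of_forall h) with e | e
    · exact e
    · have h1 : g z = -f z := e.self_of_nhds
      have h2 : g z = f z := hz
      rw [h2, eq_neg_iff_add_eq_zero, ← two_smul ℝ, smul_eq_zero] at h1
      exact absurd (h1.resolve_left two_ne_zero) (h₀ z)
  rcases isClopen_iff.1 hclopen with e | e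
  · right
    intro z
    refine (h z).resolve_left fun hz => ?_
    have : z ∈ {z | g z = f z} := hz
    rw [e] at this
    exact this
  · left
    intro z
    have : z ∈ {z | g z = f z} := by rw [e]; trivial
    exact this

/-! ### Unit quaternions that conjugate one orthonormal frame into another -/

/-- `q⁻¹ C q = A` and `q⁻¹ D q = B`, with a unit quaternion `q`. -/
structure Intertwines (A B C D q : ℍ[ℝ]) : Prop where
  unit : ‖q‖ = 1
  left : q * A = C * q
  right : q * B = D * q

/-- Four times the projection of `w` to the line of all `q` with `q A = C q`, `q B = D q`. -/
def intertwinerSum (A B C D w : ℍ[ℝ]) : ℍ[ℝ] :=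
  w - C * w * A - D * w * B - C * D * w * (A * B)

/-- As a linear map in `w`, the sum has trace `4`: the identity contributes `4`, and `w ↦ M w N` has
trace zero when `M` is imaginary, as `C`, `D` and `CD` are. The trace is computed in the basis `1,
e, f, g`. -/
theorem exists_intertwinerSum_ne_zero (A B : ℍ[ℝ]) {C D : ℍ[ℝ]} (h : IsConformalPair C D) :
    ∃ w, intertwinerSum A B C D w ≠ 0 := by
  by_contra! hw
  obtain ⟨e, he⟩ : ∃ e : ℍ[ℝ], e.re = 0 ∧ e.imI = 1 ∧ e.imJ = 0 ∧ e.imK = 0 :=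
    ⟨⟨0, 1, 0, 0⟩, rfl, rfl, rfl, rfl⟩
  obtain ⟨f, hf⟩ : ∃ f : ℍ[ℝ], f.re = 0 ∧ f.imI = 0 ∧ f.imJ = 1 ∧ f.imK = 0 :=
    ⟨⟨0, 0, 1, 0⟩, rfl, rfl, rfl, rfl⟩
  obtain ⟨g, hg⟩ : ∃ g : ℍ[ℝ], g.re = 0 ∧ g.imI = 0 ∧ g.imJ = 0 ∧ g.imK = 1 :=
    ⟨⟨0, 0, 0, 1⟩, rfl, rfl, rfl, rfl⟩
  have trace : ∀ M N : ℍ[ℝ], M.re = 0 →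
      (M * 1 * N).re + (M * e * N).imI + (M * f * N).imJ + (M * g * N).imK = 0 := by
    intro M N hM
    simp [hM, he, hf, hg]
    ring
  have h1 := congrArg (fun q => q.re) (hw 1)
  have h2 := congrArg (fun q => q.imI) (hw e)
  have h3 := congrArg (fun q => q.imJ) (hw f)
  have h4 := congrArg (fun q => q.imK) (hw g)
  simp only [intertwinerSum, Quaternion.re_sub, Quaternion.imI_sub, Quaternion.imJ_sub,
    Quaternion.imK_sub, Quaternion.re_zero, Quaternion.imI_zero, Quaternion.imJ_zero,
    Quaternion.imK_zero, Quaternion.re_one, he, hf, hg] at h1 h2 h3 h4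
  linarith [trace C A h.re_x, trace D B h.re_y, trace (C * D) (A * B) h.re_mul]

/-- An orthonormal pair of imaginary quaternions. -/
structure IsOrthonormalPair (A B : ℍ[ℝ]) : Prop where
  pair : IsConformalPair A B
  norm_one : ‖A‖ = 1

namespace IsOrthonormalPair

variable {A B C D : ℍ[ℝ]} (h : IsOrthonormalPair A B)
include h

theorem sq_left : A * A = -1 := by
  rw [h.pair.mul_self_x, h.norm_one]
  simp

theorem sq_right : B * B = -1 := by
  rw [h.pair.mul_self_y, h.norm_one]
  simp

/-- For orthonormal pairs, `1, A, B, AB` and their negatives form the quaternion group, and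
`intertwinerSum` sums `w` over its action by the two frames. Multiplication by `A` and `C` only
permutes the summands. -/
theorem intertwinerSum_left (h' : IsOrthonormalPair C D) (w : ℍ[ℝ]) :
    intertwinerSum A B C D w * A = C * intertwinerSum A B C D w := by
  have e1 : A * B * A = B := by
    rw [mul_assoc, h.pair.mul_comm_neg, mul_neg, ← mul_assoc, h.sq_left]
    simp
  have e2 : C * w * A * A = -(C * w) := by rw [mul_assoc, h.sq_left]; simp
  have e3 : D * w * B * A = -(D * w * (A * B)) := by
    rw [mul_assoc, h.pair.mul_comm_neg]; simp
  have e4 : C * D * w * (A * B) * A = C * D * w * B := by rw [mul_assoc, e1]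
  have e5 : C * (C * w * A) = -(w * A) := by
    rw [← mul_assoc, ← mul_assoc, h'.sq_left]; simp
  have e6 : C * (D * w * B) = C * D * w * B := by simp only [mul_assoc]
  have e7 : C * (C * D * w * (A * B)) = -(D * w * (A * B)) := by
    have : C * (C * D * w * (A * B)) = (C * C) * (D * w * (A * B)) := by simp only [mul_assoc]
    rw [this, h'.sq_left]; simp
  unfold intertwinerSum
  rw [sub_mul, sub_mul, sub_mul, mul_sub, mul_sub, mul_sub, e2, e3, e4, e5, e6, e7]
  abel

theorem intertwinerSum_right (h' : IsOrthonormalPair C D) (w : ℍ[ℝ]) :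
    intertwinerSum A B C D w * B = D * intertwinerSum A B C D w := by
  have e1 : A * B * B = -A := by rw [mul_assoc, h.sq_right]; simp
  have e2 : C * w * A * B = C * w * (A * B) := by rw [mul_assoc]
  have e3 : D * w * B * B = -(D * w) := by rw [mul_assoc, h.sq_right]; simp
  have e4 : C * D * w * (A * B) * B = -(C * D * w * A) := by rw [mul_assoc, e1]; simp
  have e5 : D * (C * w * A) = -(C * D * w * A) := by
    rw [← mul_assoc, ← mul_assoc, h'.pair.mul_comm_neg]; simp
  have e6 : D * (D * w * B) = -(w * B) := by
    rw [← mul_assoc, ← mul_assoc, h'.sq_right]; simp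
  have e7 : D * (C * D * w * (A * B)) = C * w * (A * B) := by
    have : D * (C * D * w * (A * B)) = (D * C) * (D * w * (A * B)) := by simp only [mul_assoc]
    rw [this, h'.pair.mul_comm_neg]
    have : C * D * (D * w * (A * B)) = C * (D * D) * w * (A * B) := by simp only [mul_assoc]
    rw [neg_mul, this, h'.sq_right]; simp
  unfold intertwinerSum
  rw [sub_mul, sub_mul, sub_mul, mul_sub, mul_sub, mul_sub, e2, e3, e4, e5, e6, e7]
  abel

/-- The quotient `q⁻¹ q'` commutes with `A` and `B`, so it is real, and it has norm one. -/
theorem intertwines_unique {q q' : ℍ[ℝ]} (h' : IsOrthonormalPair C D)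
    (hq : Intertwines A B C D q) (hq' : Intertwines A B C D q') : q' = q ∨ q' = -q := by
  have tr : ∀ {A C : ℍ[ℝ]}, A.re = 0 → C.re = 0 → q * A = C * q → A * star q = star q * C := by
    intro A C hA hC e
    have := congrArg star e
    rw [star_mul, star_mul, star_eq_neg_of_re hA, star_eq_neg_of_re hC] at this
    simpa using this
  set x := star q * q' with hx
  have xA : x * A - A * x = 0 := by
    rw [hx, ← mul_assoc A, tr h.pair.re_x h'.pair.re_x hq.left, mul_assoc, hq'.left, mul_assoc,
      sub_self]
  have xB : x * B - B * x = 0 := by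
    rw [hx, ← mul_assoc B, tr h.pair.re_y h'.pair.re_y hq.right, mul_assoc, hq'.right, mul_assoc,
      sub_self]
  have i1 := h.pair.inner_commutator_x x
  have i2 := h.pair.inner_commutator_y x
  have i3 := h.pair.inner_commutator_x_y x
  rw [xA, inner_zero_left] at i1 i3
  rw [xB, inner_zero_left] at i2
  have im_inner : ∀ y : ℍ[ℝ], y.re = 0 → (inner ℝ x.im y : ℝ) = inner ℝ x y := by
    intro y hy
    rw [inner_eq, inner_eq]
    simp [hy]
  have him : x.im = 0 := by
    have := h.pair.expansion (u := x.im) (by simp)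
      (by rw [im_inner _ h.pair.re_mul]; linarith)
    rw [im_inner _ h.pair.re_x, im_inner _ h.pair.re_y] at this
    rw [this, show (inner ℝ x A : ℝ) = 0 by linarith, show (inner ℝ x B : ℝ) = 0 by linarith]
    simp
  have hxr : x = (x.re : ℍ[ℝ]) := by
    conv_lhs => rw [← Quaternion.re_add_im x, him, add_zero]
  have hqx : q' = q * x := by
    rw [hx, ← mul_assoc, self_mul_star_of_norm hq.unit, one_mul]
  have hn : ‖x‖ = 1 := by
    rw [hx, norm_mul, norm_star, hq.unit, hq'.unit, one_mul]
  rw [hxr, Quaternion.norm_coe, Real.norm_eq_abs] at hn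
  rcases eq_or_eq_neg_of_abs_eq hn with e | e
  · left
    rw [hqx, hxr, e]
    simp
  · right
    rw [hqx, hxr, e]
    simp

end IsOrthonormalPair

theorem Intertwines.of_smul {A B C D s : ℍ[ℝ]} (h₀ : s ≠ 0) (hl : s * A = C * s)
    (hr : s * B = D * s) : Intertwines A B C D (‖s‖⁻¹ • s) := by
  refine ⟨?_, ?_, ?_⟩
  · rw [norm_smul, norm_inv, norm_norm, inv_mul_cancel₀ (norm_ne_zero_iff.2 h₀)]
  · rw [smul_mul_assoc, hl, mul_smul_comm]
  · rw [smul_mul_assoc, hr, mul_smul_comm]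

theorem Intertwines.neg {A B C D s : ℍ[ℝ]} (h : Intertwines A B C D s) :
    Intertwines A B C D (-s) :=
  ⟨by rw [norm_neg, h.unit], by rw [neg_mul, h.left, mul_neg],
    by rw [neg_mul, h.right, mul_neg]⟩

/-! ### Lifting a smooth change of frames to unit quaternions -/

section Lift

variable {A B C D : ℂ → ℍ[ℝ]}

/-- The projection of a fixed `w` that is nonzero at `z₀` stays nonzero nearby; normalizing it gives
a smooth local section. -/
theorem exists_local_intertwiner (hA : ContDiff ℝ ∞ A) (hB : ContDiff ℝ ∞ B)
    (hC : ContDiff ℝ ∞ C) (hD : ContDiff ℝ ∞ D) (h : ∀ z, IsOrthonormalPair (A z) (B z))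
    (h' : ∀ z, IsOrthonormalPair (C z) (D z)) (z₀ : ℂ) :
    ∃ (U : Set ℂ) (s : ℂ → ℍ[ℝ]), IsOpen U ∧ z₀ ∈ U ∧ ContDiffOn ℝ ∞ s U ∧
      ∀ z ∈ U, Intertwines (A z) (B z) (C z) (D z) (s z) := by
  obtain ⟨w, hw⟩ := exists_intertwinerSum_ne_zero (A z₀) (B z₀) (h' z₀).pair
  set t : ℂ → ℍ[ℝ] := fun z => intertwinerSum (A z) (B z) (C z) (D z) w
  have ht : ContDiff ℝ ∞ t := by
    unfold t intertwinerSum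
    fun_prop
  refine ⟨{z | t z ≠ 0}, fun z => ‖t z‖⁻¹ • t z, isOpen_ne_fun ht.continuous continuous_const,
    hw, fun z hz => ?_, fun z hz => .of_smul hz ((h z).intertwinerSum_left (h' z) w)
      ((h z).intertwinerSum_right (h' z) w)⟩
  exact (((ht.contDiffAt.norm ℝ hz).inv (norm_ne_zero_iff.2 hz)).smul
    ht.contDiffAt).contDiffWithinAt

/-- The total space of the double cover of `ℂ` by unit quaternions intertwining two frames. -/
abbrev IntertwinerSpace (A B C D : ℂ → ℍ[ℝ]) : Type :=
  {p : ℂ × ℍ[ℝ] // Intertwines (A p.1) (B p.1) (C p.1) (D p.1) p.2}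

theorem isCoveringMap_intertwiner (hA : ContDiff ℝ ∞ A) (hB : ContDiff ℝ ∞ B)
    (hC : ContDiff ℝ ∞ C) (hD : ContDiff ℝ ∞ D) (h : ∀ z, IsOrthonormalPair (A z) (B z))
    (h' : ∀ z, IsOrthonormalPair (C z) (D z)) :
    IsCoveringMap (fun p : IntertwinerSpace A B C D => p.1.1) := by
  intro z₀
  obtain ⟨U, s, hU, hz₀, hs, hsU⟩ := exists_local_intertwiner hA hB hC hD h h' z₀
  -- A local section `s` trivializes the cover: the fibre over `z` is `{s z, -s z}`, and the sheet
  -- of `q` is recorded by `⟨s z, q⟩ ∈ {1, -1}`.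
  refine IsEvenlyCovered.to_isEvenlyCovered_preimage (I := ({1, -1} : Set ℝ)) ?_
  have hcont : Continuous (fun p : IntertwinerSpace A B C D => p.1.1) := by fun_prop
  refine ⟨inferInstance, U, hz₀, hU, hU.preimage hcont, ?_⟩
  have huniq : ∀ p : (fun p : IntertwinerSpace A B C D => p.1.1) ⁻¹' U,
      p.1.1.2 = s p.1.1.1 ∨ p.1.1.2 = -s p.1.1.1 := fun p =>
    (h _).intertwines_unique (h' _) (hsU _ p.2) p.1.2
  have hself : ∀ z ∈ U, (inner ℝ (s z) (s z) : ℝ) = 1 := fun z hz => by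
    rw [real_inner_self_eq_norm_sq, (hsU z hz).unit]
    norm_num
  refine ⟨{ toFun := fun p => (⟨p.1.1.1, p.2⟩, ⟨inner ℝ (s p.1.1.1) p.1.1.2, ?_⟩)
            invFun := fun y => ⟨⟨(y.1.1, y.2.1 • s y.1.1), ?_⟩, y.1.2⟩
            left_inv := ?_
            right_inv := ?_
            continuous_toFun := ?_
            continuous_invFun := ?_ }, ?_⟩
  · rcases huniq p with e | e
    · left
      rw [e, hself _ p.2]
    · right
      rw [e, inner_neg_right, hself _ p.2]
      rfl
  · obtain ⟨⟨z, hz⟩, ⟨ε, hε⟩⟩ := y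
    rcases hε with rfl | rfl
    · simpa using hsU z hz
    · simpa using (hsU z hz).neg
  · intro p
    apply Subtype.ext
    apply Subtype.ext
    apply Prod.ext
    · rfl
    · have hp := hself _ p.2
      rcases huniq p with e | e
      · simp only [e]
        rw [hp, one_smul]
      · simp only [e]
        rw [inner_neg_right, hp, neg_smul, one_smul]
  · rintro ⟨⟨z, hz⟩, ⟨ε, hε⟩⟩
    refine Prod.ext rfl (Subtype.ext ?_)
    simp only
    rw [inner_smul_right, hself z hz, mul_one]
  · refine Continuous.prodMk (by fun_prop) (Continuous.subtype_mk ?_ _)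
    refine Continuous.inner ?_ (by fun_prop)
    exact hs.continuousOn.comp_continuous (by fun_prop) fun p => p.2
  · refine Continuous.subtype_mk (Continuous.subtype_mk (Continuous.prodMk (by fun_prop) ?_) _) _
    refine Continuous.smul (continuous_subtype_val.comp continuous_snd) ?_
    exact hs.continuousOn.comp_continuous (continuous_subtype_val.comp continuous_fst)
      fun y => y.1.2
  · intro p
    rfl

/-- Two smooth families of orthonormal frames on `ℂ` are intertwined by a smooth family of unit
quaternions. -/
theorem exists_intertwiner (hA : ContDiff ℝ ∞ A) (hB : ContDiff ℝ ∞ B)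
    (hC : ContDiff ℝ ∞ C) (hD : ContDiff ℝ ∞ D) (h : ∀ z, IsOrthonormalPair (A z) (B z))
    (h' : ∀ z, IsOrthonormalPair (C z) (D z)) :
    ∃ q : ℂ → ℍ[ℝ], ContDiff ℝ ∞ q ∧ ∀ z, Intertwines (A z) (B z) (C z) (D z) (q z) := by
  have cov := isCoveringMap_intertwiner hA hB hC hD h h'
  obtain ⟨U₀, s₀, -, h₀, -, hs₀⟩ := exists_local_intertwiner hA hB hC hD h h' 0
  -- As `ℂ` is simply connected, its identity map lifts to a global continuous section. Smoothness
  -- is local, since the lift agrees with `s` or `-s` near each point.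
  obtain ⟨Φ, ⟨-, hΦ⟩, -⟩ := cov.existsUnique_continuousMap_lifts (ContinuousMap.id ℂ) 0
    ⟨(0, s₀ 0), hs₀ 0 h₀⟩ rfl
  have hfst : ∀ z, (Φ z).1.1 = z := fun z => congrFun hΦ z
  set q : ℂ → ℍ[ℝ] := fun z => (Φ z).1.2
  have hqc : Continuous q := continuous_snd.comp (continuous_subtype_val.comp Φ.continuous)
  have hq : ∀ z, Intertwines (A z) (B z) (C z) (D z) (q z) := by
    intro z
    have := (Φ z).2
    rwa [hfst z] at this
  refine ⟨q, contDiff_iff_contDiffAt.2 fun z => ?_, hq⟩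
  obtain ⟨U, s, hU, hz, hs, hsU⟩ := exists_local_intertwiner hA hB hC hD h h' z
  have hsz : ContDiffAt ℝ ∞ s z := hs.contDiffAt (hU.mem_nhds hz)
  have hne : s z ≠ 0 := by
    rw [← norm_ne_zero_iff, (hsU z hz).unit]
    exact one_ne_zero
  have hev : ∀ᶠ w in 𝓝 z, q w = s w ∨ q w = -s w := by
    filter_upwards [hU.mem_nhds hz] with w hw
    exact (h w).intertwines_unique (h' w) (hsU w hw) (hq w)
  rcases eventually_eq_or_neg hsz.continuousAt hqc.continuousAt hne hev with e | e
  · exact hsz.congr_of_eventuallyEq e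
  · exact hsz.neg.congr_of_eventuallyEq e

end Lift

/-! ### Pointwise isothermic surfaces -/

/-- The conditions on an isothermic surface, at the point `z`. -/
structure IsIsothermicAt (f : ℂ → ℍ[ℝ]) (z : ℂ) : Prop where
  smooth : ContDiffAt ℝ ∞ f z
  immersion : dx f z ≠ 0
  equal_norm : ‖dx f z‖ = ‖dy f z‖
  orthogonal : inner ℝ (dx f z) (dy f z) = (0 : ℝ)
  mixed_tangent : dy (dx f) z ∈ Submodule.span ℝ {dx f z, dy f z}

theorem isIsothermicOn_iff {f : ℂ → ℍ[ℝ]} {U : Set ℂ} (hU : IsOpen U) :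
    IsIsothermicOn f U ↔ ∀ z ∈ U, IsIsothermicAt f z :=
  ⟨fun h z hz => ⟨h.conformal.smooth.contDiffAt (hU.mem_nhds hz), h.conformal.immersion z hz,
    h.conformal.equal_norm z hz, h.conformal.orthogonal z hz, h.mixed_tangent z hz⟩,
  fun h => ⟨⟨fun z hz => (h z hz).smooth.contDiffWithinAt, fun z hz => (h z hz).immersion,
    fun z hz => (h z hz).equal_norm, fun z hz => (h z hz).orthogonal⟩,
    fun z hz => (h z hz).mixed_tangent⟩⟩

theorem dx_congr {f g : ℂ → ℍ[ℝ]} {z : ℂ} (e : g =ᶠ[𝓝 z] f) : dx g =ᶠ[𝓝 z] dx f :=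
  e.eventuallyEq_nhds.mono fun _ h => congrArg (fun A : ℂ →L[ℝ] ℍ[ℝ] => A 1) h.fderiv_eq

theorem dy_congr {f g : ℂ → ℍ[ℝ]} {z : ℂ} (e : g =ᶠ[𝓝 z] f) : dy g =ᶠ[𝓝 z] dy f :=
  e.eventuallyEq_nhds.mono fun _ h => congrArg (fun A : ℂ →L[ℝ] ℍ[ℝ] => A Complex.I) h.fderiv_eq

theorem dx_neg (f : ℂ → ℍ[ℝ]) : dx (fun w => -f w) = fun w => -dx f w :=
  funext fun z => fderiv_neg_apply' f z 1

theorem dy_neg (f : ℂ → ℍ[ℝ]) : dy (fun w => -f w) = fun w => -dy f w :=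
  funext fun z => fderiv_neg_apply' f z Complex.I

theorem IsIsothermicAt.congr {f g : ℂ → ℍ[ℝ]} {z : ℂ} (h : IsIsothermicAt f z)
    (e : g =ᶠ[𝓝 z] f) : IsIsothermicAt g z := by
  have ex : dx g z = dx f z := (dx_congr e).self_of_nhds
  have ey : dy g z = dy f z := (dy_congr e).self_of_nhds
  have exy : dy (dx g) z = dy (dx f) z := (dy_congr (dx_congr e)).self_of_nhds
  exact ⟨h.smooth.congr_of_eventuallyEq e, ex ▸ h.immersion, by rw [ex, ey, h.equal_norm],
    by rw [ex, ey, h.orthogonal], by rw [ex, ey, exy]; exact h.mixed_tangent⟩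

theorem IsIsothermicAt.neg {f : ℂ → ℍ[ℝ]} {z : ℂ} (h : IsIsothermicAt f z) :
    IsIsothermicAt (fun w => -f w) z := by
  refine ⟨h.smooth.neg, ?_, ?_, ?_, ?_⟩
  · rw [dx_neg]; exact neg_ne_zero.2 h.immersion
  · rw [dx_neg, dy_neg, norm_neg, norm_neg, h.equal_norm]
  · rw [dx_neg, dy_neg, inner_neg_neg, h.orthogonal]
  · rw [dx_neg, dy_neg, dy_neg]
    obtain ⟨a, b, hab⟩ := Submodule.mem_span_pair.1 h.mixed_tangent
    refine Submodule.mem_span_pair.2 ⟨a, b, ?_⟩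
    simp only [← hab]
    module

theorem dualForm_congr {f g : ℂ → ℍ[ℝ]} {z : ℂ} (e : g =ᶠ[𝓝 z] f) (v : ℂ) :
    dualForm g z v = dualForm f z v := by
  rw [dualForm, (dx_congr e).self_of_nhds, (dy_congr e).self_of_nhds, dualForm]

theorem dualForm_neg (f : ℂ → ℍ[ℝ]) (z v : ℂ) :
    dualForm (fun w => -f w) z v = -dualForm f z v := by
  rw [dualForm, dx_neg, dy_neg, dualForm, inv_neg, inv_neg]
  module

/-! ### The dual one-form -/

section Orthogonal

variable {a b : ℍ[ℝ]}

/-- Up to the common factor `|a|⁻²` this is `b̄a + āb = 2⟨a, b⟩ = 0`. It is the algebraic source of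
all the closedness statements below. -/
theorem inv_mul_add_inv_mul (hn : ‖a‖ = ‖b‖) (ho : inner ℝ a b = (0 : ℝ)) :
    b⁻¹ * a = -(a⁻¹ * b) := by
  rw [Quaternion.inv_def, Quaternion.inv_def, Quaternion.normSq_eq_norm_mul_self,
    Quaternion.normSq_eq_norm_mul_self, hn, smul_mul_assoc, smul_mul_assoc, ← smul_neg]
  congr 1
  rw [inner_eq] at ho
  ext <;> simp <;> linarith

theorem inv_mul_mul_inv (hb : b ≠ 0) (hn : ‖a‖ = ‖b‖) (ho : inner ℝ a b = (0 : ℝ)) :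
    b⁻¹ * a * b⁻¹ = -a⁻¹ := by
  rw [inv_mul_add_inv_mul hn ho, neg_mul, mul_assoc, mul_inv_cancel₀ hb, mul_one]

theorem inner_inv (ho : inner ℝ a b = (0 : ℝ)) :
    inner ℝ a⁻¹ b⁻¹ = (0 : ℝ) := by
  rw [Quaternion.inv_def, Quaternion.inv_def, inner_smul_left, inner_smul_right]
  have : (inner ℝ (star a) (star b) : ℝ) = inner ℝ a b := by
    rw [inner_eq, inner_eq]
    simp
  rw [this, ho]
  simp

end Orthogonal

theorem inner_mul_right_unit {T : ℍ[ℝ]} (hT : ‖T‖ = 1) (a b : ℍ[ℝ]) :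
    inner ℝ (a * T) (b * T) = (inner ℝ a b : ℝ) := by
  rw [Quaternion.inner_def, star_mul, ← mul_assoc, mul_assoc a, self_mul_star_of_norm hT, mul_one,
    Quaternion.inner_def]

theorem dualForm_one (f : ℂ → ℍ[ℝ]) (z : ℂ) : dualForm f z 1 = -(dx f z)⁻¹ := by
  simp [dualForm]

theorem dualForm_I (f : ℂ → ℍ[ℝ]) (z : ℂ) : dualForm f z Complex.I = (dy f z)⁻¹ := by
  simp [dualForm]

namespace IsIsothermicAt

variable {T : ℂ → ℍ[ℝ]} {z : ℂ} (h : IsIsothermicAt T z)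
include h

theorem dy_ne_zero : dy T z ≠ 0 := by
  rw [← norm_ne_zero_iff, ← h.equal_norm]
  exact norm_ne_zero_iff.2 h.immersion

theorem differentiableAt : DifferentiableAt ℝ T z := h.smooth.differentiableAt (by simp)

theorem contDiffAt_dualForm_one : ContDiffAt ℝ ∞ (fun w => dualForm T w 1) z := by
  simp only [dualForm_one]
  exact (contDiffAt_quaternion_inv (contDiffAt_dx h.smooth) h.immersion).neg

theorem contDiffAt_dualForm_I : ContDiffAt ℝ ∞ (fun w => dualForm T w Complex.I) z := by
  simp only [dualForm_I]
  exact contDiffAt_quaternion_inv (contDiffAt_dy h.smooth) h.dy_ne_zero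

/-- The dual one-form of an isothermic surface is closed. -/
theorem fderiv_dualForm :
    fderiv ℝ (fun w => dualForm T w 1) z Complex.I =
      fderiv ℝ (fun w => dualForm T w Complex.I) z 1 := by
  simp only [dualForm_one, dualForm_I]
  rw [fderiv_neg_apply', fderiv_inv_apply ((contDiffAt_dx h.smooth).differentiableAt (by simp))
    h.immersion, fderiv_inv_apply ((contDiffAt_dy h.smooth).differentiableAt (by simp))
    h.dy_ne_zero]
  change - -((dx T z)⁻¹ * dy (dx T) z * (dx T z)⁻¹) = -((dy T z)⁻¹ * dx (dy T) z * (dy T z)⁻¹)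
  rw [← dy_dx_eq_dx_dy h.smooth]
  -- For `T_xy = s T_x + t T_y` both sides equal `s T_x⁻¹ - t T_y⁻¹`, because `a⁻¹ b a⁻¹ = -b⁻¹` for
  -- orthogonal `a, b` of the same length.
  obtain ⟨s, t, hst⟩ := Submodule.mem_span_pair.1 h.mixed_tangent
  rw [← hst]
  have e1 := inv_mul_mul_inv h.dy_ne_zero h.equal_norm h.orthogonal
  have e2 := inv_mul_mul_inv h.immersion h.equal_norm.symm
    ((real_inner_comm _ _).trans h.orthogonal)
  simp only [mul_add, add_mul, mul_smul_comm, smul_mul_assoc, e1, e2,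
    inv_mul_cancel₀ h.immersion, inv_mul_cancel₀ h.dy_ne_zero, one_mul]
  module

/-- Given that `dT*` is closed, what is left is `T_x⁻¹ T_y + T_y⁻¹ T_x = 0`. -/
theorem fderiv_dualForm_mul :
    fderiv ℝ (fun w => dualForm T w 1 * T w) z Complex.I =
      fderiv ℝ (fun w => dualForm T w Complex.I * T w) z 1 := by
  rw [fderiv_mul_apply (h.contDiffAt_dualForm_one.differentiableAt (by simp)) h.differentiableAt,
    fderiv_mul_apply (h.contDiffAt_dualForm_I.differentiableAt (by simp)) h.differentiableAt,
    h.fderiv_dualForm, dualForm_one, dualForm_I]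
  congr 1
  change _ * dy T z = _ * dx T z
  rw [inv_mul_add_inv_mul h.equal_norm h.orthogonal, neg_mul]

theorem fderiv_mul_dualForm :
    fderiv ℝ (fun w => T w * dualForm T w 1) z Complex.I =
      fderiv ℝ (fun w => T w * dualForm T w Complex.I) z 1 := by
  rw [fderiv_mul_apply h.differentiableAt (h.contDiffAt_dualForm_one.differentiableAt (by simp)),
    fderiv_mul_apply h.differentiableAt (h.contDiffAt_dualForm_I.differentiableAt (by simp)),
    h.fderiv_dualForm, dualForm_one, dualForm_I]
  congr 1
  change dy T z * _ = dx T z * _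
  have h1 := h.immersion
  have h2 := h.dy_ne_zero
  have e := inv_mul_add_inv_mul h.equal_norm h.orthogonal
  have e1 : dx T z = -(dy T z * ((dx T z)⁻¹ * dy T z)) := by
    rw [← mul_neg, ← e, mul_inv_cancel_left₀ h2]
  conv_rhs => rw [e1]
  rw [neg_mul, mul_assoc, mul_assoc, mul_inv_cancel₀ h2, mul_one, mul_neg]

theorem pair_right (hu : ∀ᶠ w in 𝓝 z, ‖T w‖ = 1) :
    IsConformalPair (dualForm T z 1 * T z) (dualForm T z Complex.I * T z) := by
  have hT : ‖T z‖ = 1 := hu.self_of_nhds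
  have hT0 : T z ≠ 0 := by
    rw [← norm_ne_zero_iff, hT]
    exact one_ne_zero
  -- The real part is a multiple of `⟨T_v, T⟩`, which vanishes because `T` has constant length.
  have re : ∀ v, ((fderiv ℝ T z v)⁻¹ * T z).re = 0 := by
    intro v
    have e := inner_fderiv_of_unit h.differentiableAt hu v
    rw [Quaternion.inv_def, smul_mul_assoc, Quaternion.re_smul, re_star_mul, real_inner_comm, e]
    simp
  rw [dualForm_one, dualForm_I]
  refine ⟨mul_ne_zero (neg_ne_zero.2 (inv_ne_zero h.immersion)) hT0, ?_, re Complex.I, ?_, ?_⟩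
  · rw [neg_mul, Quaternion.re_neg, neg_eq_zero]
    exact re 1
  · rw [norm_mul, norm_mul, norm_neg, norm_inv, norm_inv, h.equal_norm]
  · rw [inner_mul_right_unit hT, inner_neg_left, inner_inv h.orthogonal, neg_zero]

end IsIsothermicAt

theorem IsConformalPair.conj {X Y T : ℍ[ℝ]} (h : IsConformalPair X Y) (hT : ‖T‖ = 1) :
    IsConformalPair (T * X * star T) (T * Y * star T) := by
  have re : ∀ X : ℍ[ℝ], X.re = 0 → (T * X * star T).re = 0 := by
    intro X hX
    apply re_eq_zero_of_star
    rw [star_mul, star_mul, star_star, star_eq_neg_of_re hX]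
    simp [mul_assoc]
  have hT0 : T ≠ 0 := by
    rw [← norm_ne_zero_iff, hT]
    exact one_ne_zero
  exact ⟨mul_ne_zero (mul_ne_zero hT0 h.ne_zero) (star_ne_zero.2 hT0), re X h.re_x, re Y h.re_y,
    by rw [norm_mul, norm_mul, norm_mul, norm_mul, h.norm_eq],
    by rw [inner_conj hT, h.inner_eq_zero]⟩

theorem IsConformalPair.orthonormal {X Y : ℍ[ℝ]} (h : IsConformalPair X Y) :
    IsOrthonormalPair (‖X‖⁻¹ • X) (‖X‖⁻¹ • Y) := by
  have hX := norm_ne_zero_iff.2 h.ne_zero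
  refine ⟨⟨smul_ne_zero (inv_ne_zero hX) h.ne_zero, by simp [h.re_x], by simp [h.re_y], ?_, ?_⟩, ?_⟩
  · rw [norm_smul, norm_smul, h.norm_eq]
  · rw [inner_smul_left, inner_smul_right, h.inner_eq_zero]
    simp
  · rw [norm_smul, norm_inv, norm_norm, inv_mul_cancel₀ hX]

/-- A rotation of `ℝ³` is determined by two orthogonal vectors, and its unit quaternion by the
rotation up to sign. This is where `ℝP³` enters. -/
theorem IsConformalPair.eq_or_neg_of_conj_eq {X Y T T' : ℍ[ℝ]} (h : IsConformalPair X Y)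
    (hT : ‖T‖ = 1) (hT' : ‖T'‖ = 1) (hX : T * X * star T = T' * X * star T')
    (hY : T * Y * star T = T' * Y * star T') : T' = T ∨ T' = -T := by
  have h1 := h.orthonormal
  have h2 := (h.conj hT).orthonormal
  have key : ∀ {S Z : ℍ[ℝ]} {r : ℝ}, ‖S‖ = 1 → S * (r • Z) = r • (S * Z * star S) * S := by
    intro S Z r hS
    rw [smul_mul_assoc, mul_assoc (S * Z), star_mul_self_of_norm hS, mul_one, mul_smul_comm]
  have hn : ‖T * X * star T‖ = ‖X‖ := by rw [norm_mul, norm_mul, norm_star, hT]; simp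
  rw [hn] at h2
  exact h1.intertwines_unique h2 ⟨hT, key hT, key hT⟩
    ⟨hT', by rw [hX]; exact key hT', by rw [hY]; exact key hT'⟩

/-! ### From isothermic surfaces to Bonnet pairs and back -/

/-- `dF₁ = dT* T` and `dF₂ = T dT*` at the point `z`. -/
def IsDualAt (θ₁ θ₂ : Form) (T : ℂ → ℍ[ℝ]) (z : ℂ) : Prop :=
  ∀ v, θ₁ z v = dualForm T z v * T z ∧ θ₂ z v = T z * dualForm T z v

theorem IsDualAt.conj {θ₁ θ₂ : Form} {T : ℂ → ℍ[ℝ]} {z : ℂ} (h : IsDualAt θ₁ θ₂ T z)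
    (hT : ‖T z‖ = 1) (v : ℂ) : θ₂ z v = T z * θ₁ z v * star (T z) := by
  rw [(h v).1, (h v).2, mul_assoc, mul_assoc, self_mul_star_of_norm hT, mul_one]

theorem isGaugeAt_of_isDualAt {F₁ F₂ T : ℂ → ℍ[ℝ]} {z : ℂ} (h : IsIsothermicAt T z)
    (hu : ∀ᶠ w in 𝓝 z, ‖T w‖ = 1)
    (hd : ∀ᶠ w in 𝓝 z, IsDualAt (fderiv ℝ F₁) (fderiv ℝ F₂) T w) : IsGaugeAt F₁ F₂ T z :=
  ⟨h.smooth, hu, by filter_upwards [hu, hd] with w h1 h2 using h2.conj h1⟩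

theorem IsConformalPair.inv_x {X Y : ℍ[ℝ]} (h : IsConformalPair X Y) :
    X⁻¹ = -((‖X‖ ^ 2)⁻¹ • X) := by
  rw [Quaternion.inv_def, Quaternion.normSq_eq_norm_mul_self, star_eq_neg_of_re h.re_x, sq,
    smul_neg]

theorem IsConformalPair.inv_y {X Y : ℍ[ℝ]} (h : IsConformalPair X Y) :
    Y⁻¹ = -((‖X‖ ^ 2)⁻¹ • Y) := by
  rw [Quaternion.inv_def, Quaternion.normSq_eq_norm_mul_self, star_eq_neg_of_re h.re_y, sq,
    smul_neg, h.norm_eq]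

/-- The surfaces with differentials `dT* T` and `T dT*` form a normalized Bonnet pair. -/
theorem sff_of_isDualAt {F₁ F₂ T : ℂ → ℍ[ℝ]} {z : ℂ} (h₁ : IsImaginaryImmersion F₁)
    (h : IsIsothermicAt T z)
    (hu : ∀ᶠ w in 𝓝 z, ‖T w‖ = 1)
    (hd : ∀ᶠ w in 𝓝 z, IsDualAt (fderiv ℝ F₁) (fderiv ℝ F₂) T w) :
    sffXX F₂ z - sffXX F₁ z = 0 ∧ sffXY F₂ z - sffXY F₁ z = 2 ∧
      sffYY F₂ z - sffYY F₁ z = 0 := by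
  have g := isGaugeAt_of_isDualAt h hu hd
  have hT := inv_eq_star_of_norm g.norm_eq_one
  have p := h₁.pair z
  have ex : dx F₁ z = -(dx T z)⁻¹ * T z := by
    rw [← dualForm_one]; exact (hd.self_of_nhds 1).1
  have ey : dy F₁ z = (dy T z)⁻¹ * T z := by
    rw [← dualForm_I]; exact (hd.self_of_nhds Complex.I).1
  -- Inverting `F_x = -T_x⁻¹ T` gives `T⁻¹ T_x = -F_x⁻¹ = F_x / |F_x|²`, and similarly `T⁻¹ T_y =
  -- -F_y / |F_x|²`; the gauge formulas then yield `0, 2, 0`.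
  have ax : star (T z) * dx T z = (‖dx F₁ z‖ ^ 2)⁻¹ • dx F₁ z := by
    have := p.inv_x
    conv_lhs at this => rw [ex]
    rw [mul_inv_rev, inv_neg, inv_inv, hT, mul_neg] at this
    exact neg_injective this
  have ay : star (T z) * dy T z = -((‖dx F₁ z‖ ^ 2)⁻¹ • dy F₁ z) := by
    have := p.inv_y
    conv_lhs at this => rw [ey]
    rwa [mul_inv_rev, inv_inv, hT] at this
  refine ⟨?_, ?_, ?_⟩
  · rw [g.sffXX_sub h₁, ax, inner_smul_left, p.inner_eq_zero]
    simp
  · have := p.norm_sq_pos.ne'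
    rw [g.sffXY_sub h₁, ay, inner_neg_left, inner_smul_left, real_inner_self_eq_norm_sq,
      ← p.norm_eq]
    simp only [conj_trivial]
    rw [inv_mul_cancel₀ this]
    norm_num
  · rw [g.sffYY_sub h₁, ay, inner_neg_left, inner_smul_left, real_inner_comm, p.inner_eq_zero]
    simp

/-- The unit quaternions that conjugate one surface of a normalized Bonnet pair into the other form
an isothermic surface, of which the Bonnet pair is obtained. -/
theorem isothermic_of_gauge {F₁ F₂ T : ℂ → ℍ[ℝ]} (h₁ : IsImaginaryImmersion F₁)
    (h₂ : IsImaginaryImmersion F₂)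
    (hm : ∀ z, sffXX F₁ z + sffYY F₁ z = sffXX F₂ z + sffYY F₂ z)
    (hh : ∀ z, sffXX F₂ z - sffXX F₁ z = 0 ∧ sffXY F₂ z - sffXY F₁ z = 2)
    (hT : ContDiff ℝ ∞ T) (hu : ∀ z, ‖T z‖ = 1)
    (hc : ∀ z v, fderiv ℝ F₂ z v = T z * fderiv ℝ F₁ z v * star (T z)) (z : ℂ) :
    IsIsothermicAt T z ∧ IsDualAt (fderiv ℝ F₁) (fderiv ℝ F₂) T z := by
  have g : ∀ z, IsGaugeAt F₁ F₂ T z := fun z =>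
    ⟨hT.contDiffAt, Eventually.of_forall hu, Eventually.of_forall hc⟩
  have hE : ∀ z, ‖dx F₁ z‖ ^ 2 ≠ 0 := fun z => (h₁.pair z).norm_sq_pos.ne'
  have ex : ∀ z, dx T z = T z * ((‖dx F₁ z‖ ^ 2)⁻¹ • dx F₁ z) := by
    intro z
    rw [(g z).dx_gauge h₁ h₂, (hh z).1, (hh z).2, zero_smul, sub_zero, smul_smul]
    congr 2
    field_simp
  have ey : ∀ z, dy T z = -(T z * ((‖dx F₁ z‖ ^ 2)⁻¹ • dy F₁ z)) := by
    intro z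
    have : sffYY F₂ z - sffYY F₁ z = 0 := by linarith [hm z, (hh z).1]
    rw [(g z).dy_gauge h₁ h₂, this, (hh z).2, zero_smul, zero_sub, smul_neg, mul_neg, smul_smul]
    congr 3
    field_simp
  have hT0 : T z ≠ 0 := by
    rw [← norm_ne_zero_iff, hu z]
    exact one_ne_zero
  have p := h₁.pair z
  constructor
  · refine ⟨hT.contDiffAt, ?_, ?_, ?_, ?_⟩
    · rw [ex]
      exact mul_ne_zero hT0 (smul_ne_zero (inv_ne_zero (hE z)) p.ne_zero)
    · rw [ex, ey, norm_neg, norm_mul, norm_mul, norm_smul, norm_smul, p.norm_eq]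
    · have hl : ∀ a b : ℍ[ℝ], (inner ℝ (T z * a) (T z * b) : ℝ) = inner ℝ a b := by
        intro a b
        rw [← re_star_mul, star_mul, mul_assoc, ← mul_assoc (star (T z)),
          star_mul_self_of_norm (hu z), one_mul, re_star_mul]
      rw [ex, ey, inner_neg_right, hl, inner_smul_left, inner_smul_right, p.inner_eq_zero]
      simp
    -- Differentiate `E T_x = T F_x` in `y` and `E T_y = -T F_y` in `x`. The terms in `F_xy` cancel
    -- in the sum, and so do the others because `T_y F_x = T_x F_y`. Hence `2E T_xy = -E_y T_x - E_x
    -- T_y`.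
    · set E : ℂ → ℝ := fun w => ‖dx F₁ w‖ ^ 2 with hEdef
      have dE : DifferentiableAt ℝ E z := (h₁.differentiable_dx z).norm_sq ℝ
      have dT := hT.differentiable (by simp) z
      have fx : (fun w => E w • dx T w) = fun w => T w * dx F₁ w := by
        ext1 w
        rw [ex, mul_smul_comm, smul_smul, mul_inv_cancel₀ (hE w), one_smul]
      have fy : (fun w => E w • dy T w) = fun w => -(T w * dy F₁ w) := by
        ext1 w
        rw [ey, mul_smul_comm, smul_neg, smul_smul, mul_inv_cancel₀ (hE w), one_smul]
      have dTx : DifferentiableAt ℝ (dx T) z :=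
        (contDiffAt_dx hT.contDiffAt).differentiableAt (by simp)
      have dTy : DifferentiableAt ℝ (dy T) z :=
        (contDiffAt_dy hT.contDiffAt).differentiableAt (by simp)
      have e1 : fderiv ℝ E z Complex.I • dx T z + E z • dy (dx T) z =
          dy T z * dx F₁ z + T z * dy (dx F₁) z := by
        have := fderiv_smul_apply' dE dTx Complex.I
        rw [fx, fderiv_mul_apply dT (h₁.differentiable_dx z)] at this
        exact this.symm
      have e2 : fderiv ℝ E z 1 • dy T z + E z • dy (dx T) z =
          -(dx T z * dy F₁ z + T z * dy (dx F₁) z) := by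
        have := fderiv_smul_apply' dE dTy 1
        rw [fy, fderiv_neg_apply', fderiv_mul_apply dT (h₁.differentiable_dy z)] at this
        rw [dy_dx_eq_dx_dy (hT.contDiffAt (x := z)), ← h₁.dx_dy]
        exact this.symm
      have e3 : dy T z * dx F₁ z = dx T z * dy F₁ z := by
        rw [ex, ey, neg_mul, mul_assoc, mul_assoc, smul_mul_assoc, smul_mul_assoc, p.mul_comm_neg,
          smul_neg, mul_neg, neg_neg]
      rw [e3] at e1
      refine Submodule.mem_span_pair.2
        ⟨-(fderiv ℝ E z Complex.I) / (2 * E z), -(fderiv ℝ E z 1) / (2 * E z), ?_⟩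
      have hEz : (2 * E z) ≠ 0 := mul_ne_zero two_ne_zero (hE z)
      rw [← sub_eq_zero]
      have e4 : fderiv ℝ E z Complex.I • dx T z + E z • dy (dx T) z +
          (fderiv ℝ E z 1 • dy T z + E z • dy (dx T) z) = 0 := by
        rw [e1, e2]; abel
      have e5 : (2 * E z)⁻¹ • (fderiv ℝ E z Complex.I • dx T z + E z • dy (dx T) z +
          (fderiv ℝ E z 1 • dy T z + E z • dy (dx T) z)) = 0 := by rw [e4, smul_zero]
      have e6 : (2 * E z)⁻¹ * E z = 1 / 2 := by
        rw [mul_inv, mul_assoc, inv_mul_cancel₀ (hE z)]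
        norm_num
      simp only [smul_add, smul_smul, e6] at e5
      rw [← neg_eq_zero, ← e5]
      simp only [div_eq_inv_mul]
      module
  · have hinv := inv_eq_star_of_norm (hu z)
    have d1 : (dx T z)⁻¹ = -(dx F₁ z * star (T z)) := by
      have : (‖dx F₁ z‖ ^ 2)⁻¹ • dx F₁ z = -(dx F₁ z)⁻¹ := by rw [p.inv_x, neg_neg]
      rw [ex, this, mul_neg, inv_neg, mul_inv_rev, inv_inv, hinv]
    have d2 : (dy T z)⁻¹ = dy F₁ z * star (T z) := by
      have : (‖dx F₁ z‖ ^ 2)⁻¹ • dy F₁ z = -(dy F₁ z)⁻¹ := by rw [p.inv_y, neg_neg]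
      rw [ey, this, mul_neg, neg_neg, mul_inv_rev, inv_inv, hinv]
    have key : ∀ v, dualForm T z v = fderiv ℝ F₁ z v * star (T z) := by
      intro v
      rw [dualForm, d1, d2, fderiv_apply_complex, smul_neg, neg_neg, add_mul, smul_mul_assoc,
        smul_mul_assoc]
    intro v
    rw [key, mul_assoc, star_mul_self_of_norm (hu z), mul_one, hc, mul_assoc]
    exact ⟨rfl, rfl⟩

/-! ### Stereographic projection -/

theorem inner_mul_mul (w a b : ℍ[ℝ]) :
    inner ℝ (w * a * w) (w * b * w) = ‖w‖ ^ 4 * (inner ℝ a b : ℝ) := by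
  have : ‖w‖ ^ 4 = (‖w‖ ^ 2) ^ 2 := by ring
  rw [this, norm_sq_eq, inner_eq, inner_eq]
  simp
  ring

/-- The polarized form of `a x̄ a = 2⟨a, x⟩ a - |a|² x`. It makes the quadratic term in the second
derivative of the stereographic projection tangential. -/
theorem mul_mul_add_mul_mul {a b : ℍ[ℝ]} (ho : inner ℝ a b = (0 : ℝ)) (w : ℍ[ℝ]) :
    a * w * b + b * w * a =
      (2 * (inner ℝ a (star w) : ℝ)) • b + (2 * (inner ℝ b (star w) : ℝ)) • a := by
  rw [inner_eq] at ho
  rw [inner_eq, inner_eq]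
  ext <;> simp
  · linear_combination (-2 * w.re) * ho
  · linear_combination (2 * w.imI) * ho
  · linear_combination (2 * w.imJ) * ho
  · linear_combination (2 * w.imK) * ho

theorem one_sub_ne_zero_of_re {R : ℍ[ℝ]} (h : R.re = 0) : 1 - R ≠ 0 := by
  intro e
  have := congrArg (fun q => q.re) e
  simp [h] at this

theorem one_sub_eq_of_cayley {T R : ℍ[ℝ]} (h : R.re = 0) (hT : T = (1 + R) * (1 - R)⁻¹) :
    T + 1 ≠ 0 ∧ 1 - R = (2 : ℝ) • (T + 1)⁻¹ := by
  have h0 := one_sub_ne_zero_of_re h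
  have e : T + 1 = (2 : ℝ) • (1 - R)⁻¹ := by
    calc T + 1 = (1 + R) * (1 - R)⁻¹ + (1 - R) * (1 - R)⁻¹ := by rw [hT, mul_inv_cancel₀ h0]
      _ = (2 : ℝ) • (1 - R)⁻¹ := by
        rw [← add_mul, add_add_sub_cancel, one_add_one_eq_two, two_smul, two_mul]
  rw [e]
  refine ⟨smul_ne_zero two_ne_zero (inv_ne_zero h0), ?_⟩
  rw [smul_inv₀, inv_inv, smul_smul, mul_inv_cancel₀ two_ne_zero, one_smul]

/-- Here `R = 1 - 2 (T + 1)⁻¹` and `2 (T + 1)⁻¹ = 1 - R`. -/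
theorem fderiv_cayley {T R : ℂ → ℍ[ℝ]} {z : ℂ} (hT : DifferentiableAt ℝ T z)
    (hR : ∀ᶠ w in 𝓝 z, (R w).re = 0 ∧ T w = (1 + R w) * (1 - R w)⁻¹) (v : ℂ) :
    fderiv ℝ R z v = (1 / 2 : ℝ) • ((1 - R z) * fderiv ℝ T z v * (1 - R z)) := by
  have e : R =ᶠ[𝓝 z] fun w => 1 - (2 : ℝ) • (T w + 1)⁻¹ := by
    filter_upwards [hR] with w hw
    rw [← (one_sub_eq_of_cayley hw.1 hw.2).2, sub_sub_cancel]
  obtain ⟨h1, h2⟩ := hR.self_of_nhds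
  obtain ⟨h3, h4⟩ := one_sub_eq_of_cayley h1 h2
  have d := differentiableAt_quaternion_inv (hT.add_const 1) h3
  rw [e.fderiv_eq, fderiv_const_sub, fderiv_fun_const_smul d, h4]
  simp only [neg_apply, smul_apply]
  rw [fderiv_inv_apply (hT.add_const 1) h3, fderiv_add_const]
  simp only [smul_mul_assoc, mul_smul_comm, smul_smul, smul_neg, neg_neg]
  norm_num

/-- The stereographic projection of an isothermic surface in `S³` is isothermic. -/
theorem IsIsothermicAt.cayley {T R : ℂ → ℍ[ℝ]} {z : ℂ} (h : ∀ᶠ w in 𝓝 z, IsIsothermicAt T w)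
    (hR : ∀ᶠ w in 𝓝 z, (R w).re = 0 ∧ T w = (1 + R w) * (1 - R w)⁻¹) :
    IsIsothermicAt R z ∧
      ∀ v, dualForm T z v = (1 / 2 : ℝ) • ((1 - R z) * dualForm R z v * (1 - R z)) := by
  have hz := h.self_of_nhds
  obtain ⟨r1, r2⟩ := hR.self_of_nhds
  have h0 := one_sub_ne_zero_of_re r1
  have h3 := (one_sub_eq_of_cayley r1 r2).1
  have hs : ContDiffAt ℝ ∞ R z := by
    have e : R =ᶠ[𝓝 z] fun w => 1 - (2 : ℝ) • (T w + 1)⁻¹ := by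
      filter_upwards [hR] with w hw
      rw [← (one_sub_eq_of_cayley hw.1 hw.2).2, sub_sub_cancel]
    refine ContDiffAt.congr_of_eventuallyEq ?_ e
    exact contDiffAt_const.sub
      ((contDiffAt_quaternion_inv (hz.smooth.add contDiffAt_const) h3).const_smul (2 : ℝ))
  have dR : ∀ᶠ w in 𝓝 z, ∀ v,
      fderiv ℝ R w v = (1 / 2 : ℝ) • ((1 - R w) * fderiv ℝ T w v * (1 - R w)) := by
    filter_upwards [h, hR.eventually_nhds] with w hw hw' v
    exact fderiv_cayley hw.differentiableAt hw' v
  have ex : dx R z = (1 / 2 : ℝ) • ((1 - R z) * dx T z * (1 - R z)) := dR.self_of_nhds 1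
  have ey : dy R z = (1 / 2 : ℝ) • ((1 - R z) * dy T z * (1 - R z)) :=
    dR.self_of_nhds Complex.I
  -- Applied to `a = T_x` and `a = T_y`, this gives `dT* = ½ (1 - R) dR* (1 - R)`.
  have inv : ∀ a : ℍ[ℝ], a⁻¹ = (1 / 2 : ℝ) •
      ((1 - R z) * ((1 / 2 : ℝ) • ((1 - R z) * a * (1 - R z)))⁻¹ * (1 - R z)) := by
    intro a
    rw [smul_inv₀, mul_inv_rev, mul_inv_rev, mul_smul_comm, smul_mul_assoc, smul_smul,
      mul_assoc, mul_assoc, mul_assoc, inv_mul_cancel₀ h0, mul_one, mul_inv_cancel_left₀ h0]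
    norm_num
  refine ⟨⟨hs, ?_, ?_, ?_, ?_⟩, ?_⟩
  · rw [ex]
    exact smul_ne_zero (by norm_num) (mul_ne_zero (mul_ne_zero h0 hz.immersion) h0)
  · rw [ex, ey, norm_smul, norm_smul, norm_mul, norm_mul, norm_mul, norm_mul, hz.equal_norm]
  · rw [ex, ey, inner_smul_left, inner_smul_right, inner_mul_mul, hz.orthogonal]
    simp
  · have dRz : DifferentiableAt ℝ R z := hs.differentiableAt (by simp)
    have dW : DifferentiableAt ℝ (fun w => 1 - R w) z := dRz.const_sub 1
    have dTx : DifferentiableAt ℝ (dx T) z :=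
      (contDiffAt_dx hz.smooth).differentiableAt (by simp)
    have e : dx R =ᶠ[𝓝 z] fun w => (1 / 2 : ℝ) • ((1 - R w) * dx T w * (1 - R w)) :=
      dR.mono fun w hw => hw 1
    have fW : fderiv ℝ (fun w => 1 - R w) z Complex.I = -dy R z := by
      rw [fderiv_const_sub]
      rfl
    have exy : dy (dx R) z = (1 / 2 : ℝ) • ((1 - R z) * (dy (dx T) z - (1 / 2 : ℝ) •
        (dx T z * (1 - R z) * dy T z + dy T z * (1 - R z) * dx T z)) * (1 - R z)) := by
      have e1 : dy (dx R) z = _ := congrArg (fun A : ℂ →L[ℝ] ℍ[ℝ] => A Complex.I) e.fderiv_eq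
      have d : DifferentiableAt ℝ (fun w => (1 - R w) * dx T w * (1 - R w)) z :=
        (dW.mul dTx).mul dW
      rw [fderiv_fun_const_smul d] at e1
      simp only [smul_apply] at e1
      rw [fderiv_mul_apply (a := fun w => (1 - R w) * dx T w) (dW.mul dTx) dW,
        fderiv_mul_apply dW dTx, fW, ey] at e1
      rw [e1]
      congr 1
      change (_ * _ + _ * dy (dx T) z) * _ + _ = _
      generalize 1 - R z = W
      simp only [mul_sub, sub_mul, mul_add, add_mul, smul_mul_assoc, mul_smul_comm, neg_mul,
        mul_neg, smul_add, mul_assoc]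
      abel
    obtain ⟨s, t, hst⟩ := Submodule.mem_span_pair.1 hz.mixed_tangent
    rw [mul_mul_add_mul_mul hz.orthogonal, ← hst] at exy
    rw [exy, ex, ey]
    refine Submodule.mem_span_pair.2 ⟨s - inner ℝ (dy T z) (star (1 - R z)),
      t - inner ℝ (dx T z) (star (1 - R z)), ?_⟩
    simp only [mul_sub, sub_mul, mul_add, add_mul, smul_mul_assoc, mul_smul_comm, smul_add,
      smul_sub, smul_smul]
    module
  · intro v
    rw [dualForm, dualForm, inv (dx T z), inv (dy T z), ← ex, ← ey]
    simp only [mul_add, add_mul, mul_neg, neg_mul, smul_mul_assoc, mul_smul_comm, smul_add,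
      smul_neg]
    module

/-! ### Primitives of closed one-forms -/

theorem form_apply (A : ℂ →L[ℝ] ℍ[ℝ]) (v : ℂ) : A v = v.re • A 1 + v.im • A Complex.I := by
  have : v = v.re • (1 : ℂ) + v.im • Complex.I := by simp
  conv_lhs => rw [this]
  rw [map_add, map_smul, map_smul]

theorem form_ext {A B : ℂ →L[ℝ] ℍ[ℝ]} (h₁ : A 1 = B 1) (h₂ : A Complex.I = B Complex.I) :
    A = B := by
  ext1 v
  rw [form_apply A, form_apply B, h₁, h₂]

/-- The one-form `X dx + Y dy`. -/
def formOf (X Y : ℍ[ℝ]) : ℂ →L[ℝ] ℍ[ℝ] :=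
  Complex.reCLM.smulRight X + Complex.imCLM.smulRight Y

theorem formOf_apply (X Y : ℍ[ℝ]) (v : ℂ) : formOf X Y v = v.re • X + v.im • Y := by
  simp [formOf]

theorem exists_primitive {θ : Form} (hx : ContDiff ℝ ∞ fun z => θ z 1)
    (hy : ContDiff ℝ ∞ fun z => θ z Complex.I)
    (hc : ∀ z, fderiv ℝ (fun z => θ z 1) z Complex.I = fderiv ℝ (fun z => θ z Complex.I) z 1)
    (hre : ∀ z v, (θ z v).re = 0) :
    ∃ F : ℂ → ℍ[ℝ], ContDiff ℝ ∞ F ∧ fderiv ℝ F = θ ∧ ∀ z, (F z).re = 0 := by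
  have hθ : θ = fun z => formOf (θ z 1) (θ z Complex.I) := by
    ext1 z
    exact form_ext (by simp [formOf_apply]) (by simp [formOf_apply])
  have hs : ContDiff ℝ ∞ θ := by
    rw [hθ]
    unfold formOf
    fun_prop
  have hd : Differentiable ℝ θ := hs.differentiable (by simp)
  have happ : ∀ z u v, fderiv ℝ θ z u v = fderiv ℝ (fun w => θ w v) z u := by
    intro z u v
    rw [fderiv_clm_apply (hd z) (differentiableAt_const v)]
    simp
  have hsymm : ∀ z u v, fderiv ℝ θ z u v = fderiv ℝ θ z v u := by
    intro z u v
    have e : ∀ u, fderiv ℝ θ z u = u.re • fderiv ℝ θ z 1 + u.im • fderiv ℝ θ z Complex.I := by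
      intro u
      have : u = u.re • (1 : ℂ) + u.im • Complex.I := by simp
      conv_lhs => rw [this]
      rw [map_add, map_smul, map_smul]
    have c : fderiv ℝ θ z Complex.I 1 = fderiv ℝ θ z 1 Complex.I := by
      rw [happ, happ, hc]
    rw [e u, e v]
    simp only [add_apply, smul_apply]
    rw [form_apply (fderiv ℝ θ z 1) v, form_apply (fderiv ℝ θ z 1) u,
      form_apply (fderiv ℝ θ z Complex.I) v, form_apply (fderiv ℝ θ z Complex.I) u, c]
    module
  -- The Poincaré lemma. The primitive has constant real part since `θ` is imaginary, and
  -- subtracting its value at `0` makes it imaginary.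
  obtain ⟨F, hF⟩ := convex_univ.exists_forall_hasFDerivAt_of_fderiv_symmetric isOpen_univ
    hd.differentiableOn fun z _ u v => hsymm z u v
  have hF' : ∀ z, HasFDerivAt (fun w => F w - ((F 0).re : ℍ[ℝ])) (θ z) z := fun z =>
    (hF z trivial).sub_const _
  have hfd : fderiv ℝ (fun w => F w - ((F 0).re : ℍ[ℝ])) = θ := funext fun z => (hF' z).fderiv
  have hdiff : Differentiable ℝ (fun w => F w - ((F 0).re : ℍ[ℝ])) := fun z =>
    (hF' z).differentiableAt
  refine ⟨_, contDiff_infty_iff_fderiv.2 ⟨hdiff, hfd ▸ hs⟩, hfd, fun z => ?_⟩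
  have hconst : (F z - ((F 0).re : ℍ[ℝ])).re = (F 0 - ((F 0).re : ℍ[ℝ])).re := by
    have hdr : Differentiable ℝ (fun w => (F w - ((F 0).re : ℍ[ℝ])).re) := by
      have : (fun w => (F w - ((F 0).re : ℍ[ℝ])).re) =
          fun w => inner ℝ (F w - ((F 0).re : ℍ[ℝ])) (1 : ℍ[ℝ]) := by
        ext w
        simp [Quaternion.inner_def]
      rw [this]
      exact hdiff.inner ℝ (differentiable_const _)
    refine is_const_of_fderiv_eq_zero hdr (fun w => ?_) z 0
    ext1 v
    rw [fderiv_re_apply (hdiff w), hfd, hre]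
    rfl
  rw [hconst]
  simp

/-! ### Isothermic tori and their Bonnet pairs -/

theorem S3.norm_coe (p : S3) : ‖(p : ℍ[ℝ])‖ = 1 := by
  simp

theorem S3.coe_ne_zero (p : S3) : (p : ℍ[ℝ]) ≠ 0 := by
  rw [← norm_ne_zero_iff, S3.norm_coe]
  exact one_ne_zero

theorem RP3.mk_eq_iff {p q : S3} : RP3.mk p = RP3.mk q ↔ q = p ∨ q = -p :=
  Quotient.eq (r := antipodal)

theorem RP3.mk_eq_iff_coe {p q : S3} :
    RP3.mk p = RP3.mk q ↔ (q : ℍ[ℝ]) = p ∨ (q : ℍ[ℝ]) = -p := by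
  rw [RP3.mk_eq_iff, Subtype.ext_iff, Subtype.ext_iff]
  rfl

section Torus

variable {L : Submodule ℤ ℂ}

theorem mkQ_add (l : ℂ) (hl : l ∈ L) (z : ℂ) : L.mkQ (z + l) = L.mkQ z := by
  rw [map_add, (Submodule.Quotient.mk_eq_zero L (x := l)).2 hl |> fun h => (h : L.mkQ l = 0),
    add_zero]

theorem exists_descent {α : Type*} (f : ℂ → α) (h : ∀ l ∈ L, ∀ z, f (z + l) = f z) :
    ∃ g : ℂ ⧸ L → α, ∀ z, g (L.mkQ z) = f z := by
  refine ⟨fun q => f (Quotient.out q), fun z => ?_⟩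
  have e : L.mkQ (Quotient.out (L.mkQ z)) = L.mkQ z := Quotient.out_eq' (L.mkQ z)
  have hm : Quotient.out (L.mkQ z) - z ∈ L := (Submodule.Quotient.eq L).1 e
  have := h _ hm z
  rwa [add_sub_cancel] at this

variable {τ : ℂ ⧸ L → RP3}

theorem IsLiftOn.eventually_eq_or_neg {T T' : ℂ → S3} {U U' : Set ℂ} (h : IsLiftOn L τ T U)
    (h' : IsLiftOn L τ T' U') (hU : IsOpen U) (hU' : IsOpen U') {z : ℂ} (hz : z ∈ U)
    (hz' : z ∈ U') :
    ((fun w => (T' w : ℍ[ℝ])) =ᶠ[𝓝 z] fun w => (T w : ℍ[ℝ])) ∨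
      ((fun w => (T' w : ℍ[ℝ])) =ᶠ[𝓝 z] fun w => -(T w : ℍ[ℝ])) := by
  refine BonnetIsothermic.eventually_eq_or_neg
    (h.smooth.contDiffAt (hU.mem_nhds hz)).continuousAt
    (h'.smooth.contDiffAt (hU'.mem_nhds hz')).continuousAt (S3.coe_ne_zero _) ?_
  filter_upwards [hU.mem_nhds hz, hU'.mem_nhds hz'] with w hw hw'
  exact RP3.mk_eq_iff_coe.1 ((h.lifts w hw).trans (h'.lifts w hw').symm)

theorem IsDualAt.congr {θ₁ θ₂ : Form} {T T' : ℂ → ℍ[ℝ]} {z : ℂ} (h : IsDualAt θ₁ θ₂ T z)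
    (e : T' =ᶠ[𝓝 z] T) : IsDualAt θ₁ θ₂ T' z := by
  intro v
  rw [dualForm_congr e, e.self_of_nhds]
  exact h v

theorem IsDualAt.neg {θ₁ θ₂ : Form} {T : ℂ → ℍ[ℝ]} {z : ℂ} (h : IsDualAt θ₁ θ₂ T z) :
    IsDualAt θ₁ θ₂ (fun w => -T w) z := by
  intro v
  rw [dualForm_neg, neg_mul_neg, neg_mul_neg]
  exact h v

theorem IsIsothermicRP3.isIsothermicAt (hτ : IsIsothermicRP3 L τ) {T : ℂ → S3} {U : Set ℂ}
    (hU : IsOpen U) (h : IsLiftOn L τ T U) {z : ℂ} (hz : z ∈ U) :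
    IsIsothermicAt (fun w => (T w : ℍ[ℝ])) z := by
  obtain ⟨U', T', hU', hz', h', hi⟩ := hτ z
  have hi' := (isIsothermicOn_iff hU').1 hi z hz'
  rcases h'.eventually_eq_or_neg h hU' hU hz' hz with e | e
  · exact hi'.congr e
  · exact hi'.neg.congr e

/-- The pair `θ` of one-forms is given by `dT* T`, `T dT*` for all local lifts of `τ`. -/
def IsDualPair (L : Submodule ℤ ℂ) (τ : ℂ ⧸ L → RP3) (θ : Form × Form) : Prop :=
  ∀ (U : Set ℂ) (T : ℂ → S3), IsOpen U → IsLiftOn L τ T U →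
    ∀ z ∈ U, IsDualAt θ.1 θ.2 (fun w => (T w : ℍ[ℝ])) z

/-- A lift is chosen separately around each point, with no compatibility. The values do not depend
on the choice, because `dT* T` and `T dT*` are even in `T`. -/
theorem IsIsothermicRP3.exists_isDualPair (hτ : IsIsothermicRP3 L τ) :
    ∃ θ, IsDualPair L τ θ := by
  choose U T hU hz h hi using hτ
  refine ⟨(fun z => formOf (dualForm (fun w => (T z w : ℍ[ℝ])) z 1 * T z z)
      (dualForm (fun w => (T z w : ℍ[ℝ])) z Complex.I * T z z),
    fun z => formOf (T z z * dualForm (fun w => (T z w : ℍ[ℝ])) z 1)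
      (T z z * dualForm (fun w => (T z w : ℍ[ℝ])) z Complex.I)), ?_⟩
  intro U' T' hU' h' z hz'
  have key : IsDualAt
      (fun z => formOf (dualForm (fun w => (T z w : ℍ[ℝ])) z 1 * T z z)
        (dualForm (fun w => (T z w : ℍ[ℝ])) z Complex.I * T z z))
      (fun z => formOf (T z z * dualForm (fun w => (T z w : ℍ[ℝ])) z 1)
        (T z z * dualForm (fun w => (T z w : ℍ[ℝ])) z Complex.I))
      (fun w => (T z w : ℍ[ℝ])) z := by
    intro v
    have e : dualForm (fun w => (T z w : ℍ[ℝ])) z v =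
        v.re • dualForm (fun w => (T z w : ℍ[ℝ])) z 1 +
        v.im • dualForm (fun w => (T z w : ℍ[ℝ])) z Complex.I := by
      rw [dualForm_one, dualForm_I, dualForm, smul_neg]
    rw [e, formOf_apply, formOf_apply, add_mul, mul_add]
    simp only [smul_mul_assoc, mul_smul_comm, and_self]
  rcases (h z).eventually_eq_or_neg h' (hU z) hU' (hz z) hz' with e | e
  · exact key.congr e
  · exact key.neg.congr e

theorem IsDualPair.isBonnetRelation {θ : Form × Form} (hτ : IsIsothermicRP3 L τ)
    (h : IsDualPair L τ θ) : IsBonnetRelation L τ θ := by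
  refine ⟨h, fun U T R hU hl hR => ?_⟩
  have key : ∀ z ∈ U, _ := fun z hz => IsIsothermicAt.cayley
    (T := fun w => (T w : ℍ[ℝ])) (R := R) (z := z)
    ((hU.eventually_mem hz).mono fun w hw => hτ.isIsothermicAt hU hl hw)
    ((hU.eventually_mem hz).mono fun w hw => hR w hw)
  refine ⟨(isIsothermicOn_iff hU).2 fun z hz => (key z hz).1, fun z hz v => ?_⟩
  obtain ⟨e1, e2⟩ := h U T hU hl z hz v
  obtain ⟨r1, r2⟩ := hR z hz
  have h0 := one_sub_ne_zero_of_re r1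
  have hcomm : (1 - R z) * (1 + R z) = (1 + R z) * (1 - R z) := by
    simp only [mul_add, add_mul, mul_sub, sub_mul, one_mul, mul_one]
    abel
  rw [e1, e2, (key z hz).2 v]
  -- Into `dT* = ½ (1 - R) dR* (1 - R)` substitute `T = (1 + R)(1 - R)⁻¹`. The factors `1 + R` and
  -- `1 - R` commute, so one `1 - R` cancels in each product.
  simp only [r2]
  constructor
  · rw [smul_mul_assoc, mul_assoc, ← mul_assoc (1 - R z) (1 + R z), hcomm, mul_assoc (1 + R z),
      mul_inv_cancel₀ h0, mul_one]
  · rw [mul_smul_comm, mul_assoc (1 - R z) _ (1 - R z), ← mul_assoc, mul_assoc (1 + R z),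
      inv_mul_cancel₀ h0, mul_one, ← mul_assoc]

theorem IsDualPair.unique {θ θ' : Form × Form} (hτ : IsIsothermicRP3 L τ)
    (h : IsDualPair L τ θ) (h' : IsDualPair L τ θ') : θ = θ' := by
  have key : ∀ z v, θ.1 z v = θ'.1 z v ∧ θ.2 z v = θ'.2 z v := by
    intro z v
    obtain ⟨U, T, hU, hz, hl, -⟩ := hτ z
    have e := h U T hU hl z hz v
    have e' := h' U T hU hl z hz v
    exact ⟨e.1.trans e'.1.symm, e.2.trans e'.2.symm⟩
  exact Prod.ext (funext fun z => ContinuousLinearMap.ext fun v => (key z v).1)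
    (funext fun z => ContinuousLinearMap.ext fun v => (key z v).2)

theorem IsLiftOn.translate {T : ℂ → S3} {U : Set ℂ} (h : IsLiftOn L τ T U) {l : ℂ} (hl : l ∈ L) :
    IsLiftOn L τ (fun z => T (z + l)) ((fun z => z + l) ⁻¹' U) := by
  refine ⟨?_, fun z hz => ?_⟩
  · exact h.smooth.comp (by fun_prop) (Set.mapsTo_preimage _ _)
  · rw [h.lifts _ hz, mkQ_add l hl]

theorem dualForm_translate (f : ℂ → ℍ[ℝ]) (l z v : ℂ) :
    dualForm (fun w => f (w + l)) z v = dualForm f (z + l) v := by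
  simp only [dualForm, dx, dy, fderiv_comp_add_right]

/-! ### The Bonnet pair of an isothermic torus in `ℝP³` -/

section Pair

variable {θ : Form × Form} (hτ : IsIsothermicRP3 L τ) (h : IsDualPair L τ θ)
include hτ h

theorem IsDualPair.isPeriodic : IsPeriodic L θ.1 ∧ IsPeriodic L θ.2 := by
  have key : ∀ l ∈ L, ∀ z v, θ.1 (z + l) v = θ.1 z v ∧ θ.2 (z + l) v = θ.2 z v := by
    intro l hl z v
    obtain ⟨U, T, hU, hz, hlift, -⟩ := hτ (z + l)
    have e := h U T hU hlift (z + l) hz v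
    -- A translate of a local lift by a period is again a local lift of `τ`, and the forms can be
    -- computed from any lift.
    have e' := h _ _ (hU.preimage (by fun_prop)) (hlift.translate hl) z hz v
    have ed := dualForm_translate (fun w => (T w : ℍ[ℝ])) l z v
    rw [ed] at e'
    exact ⟨e.1.trans e'.1.symm, e.2.trans e'.2.symm⟩
  exact ⟨fun l hl z => ContinuousLinearMap.ext fun v => (key l hl z v).1,
    fun l hl z => ContinuousLinearMap.ext fun v => (key l hl z v).2⟩

theorem IsDualPair.exists_local (z : ℂ) : ∃ T : ℂ → ℍ[ℝ], IsIsothermicAt T z ∧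
    (∀ᶠ w in 𝓝 z, ‖T w‖ = 1) ∧ (∀ᶠ w in 𝓝 z, IsDualAt θ.1 θ.2 T w) := by
  obtain ⟨U, T, hU, hz, hl, hi⟩ := hτ z
  refine ⟨fun w => T w, (isIsothermicOn_iff hU).1 hi z hz,
    Eventually.of_forall fun w => S3.norm_coe _, ?_⟩
  filter_upwards [hU.mem_nhds hz] with w hw using h U T hU hl w hw

theorem IsDualPair.pair (z : ℂ) :
    IsConformalPair (θ.1 z 1) (θ.1 z Complex.I) ∧ IsConformalPair (θ.2 z 1) (θ.2 z Complex.I) := by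
  obtain ⟨T, hi, hu, hd⟩ := h.exists_local hτ z
  have hd' := hd.self_of_nhds
  have p := hi.pair_right hu
  rw [← (hd' 1).1, ← (hd' Complex.I).1] at p
  refine ⟨p, ?_⟩
  rw [hd'.conj hu.self_of_nhds, hd'.conj hu.self_of_nhds]
  exact p.conj hu.self_of_nhds

theorem IsDualPair.exists_primitives :
    (∃ F : ℂ → ℍ[ℝ], ContDiff ℝ ∞ F ∧ fderiv ℝ F = θ.1 ∧ ∀ z, (F z).re = 0) ∧
      ∃ F : ℂ → ℍ[ℝ], ContDiff ℝ ∞ F ∧ fderiv ℝ F = θ.2 ∧ ∀ z, (F z).re = 0 := by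
  have re : ∀ z v, (θ.1 z v).re = 0 ∧ (θ.2 z v).re = 0 := by
    intro z v
    obtain ⟨p, q⟩ := h.pair hτ z
    rw [form_apply (θ.1 z), form_apply (θ.2 z)]
    simp [p.re_x, p.re_y, q.re_x, q.re_y]
  have loc := h.exists_local hτ
  constructor
  · refine exists_primitive (contDiff_iff_contDiffAt.2 fun z => ?_)
      (contDiff_iff_contDiffAt.2 fun z => ?_) (fun z => ?_) fun z v => (re z v).1
    all_goals
      obtain ⟨T, hi, -, hd⟩ := loc z
      have e1 : (fun w => θ.1 w 1) =ᶠ[𝓝 z] fun w => dualForm T w 1 * T w :=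
        hd.mono fun w hw => (hw 1).1
      have e2 : (fun w => θ.1 w Complex.I) =ᶠ[𝓝 z] fun w => dualForm T w Complex.I * T w :=
        hd.mono fun w hw => (hw Complex.I).1
    · exact (hi.contDiffAt_dualForm_one.mul hi.smooth).congr_of_eventuallyEq e1
    · exact (hi.contDiffAt_dualForm_I.mul hi.smooth).congr_of_eventuallyEq e2
    · rw [e1.fderiv_eq, e2.fderiv_eq, hi.fderiv_dualForm_mul]
  · refine exists_primitive (contDiff_iff_contDiffAt.2 fun z => ?_)
      (contDiff_iff_contDiffAt.2 fun z => ?_) (fun z => ?_) fun z v => (re z v).2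
    all_goals
      obtain ⟨T, hi, -, hd⟩ := loc z
      have e1 : (fun w => θ.2 w 1) =ᶠ[𝓝 z] fun w => T w * dualForm T w 1 :=
        hd.mono fun w hw => (hw 1).2
      have e2 : (fun w => θ.2 w Complex.I) =ᶠ[𝓝 z] fun w => T w * dualForm T w Complex.I :=
        hd.mono fun w hw => (hw Complex.I).2
    · exact (hi.smooth.mul hi.contDiffAt_dualForm_one).congr_of_eventuallyEq e1
    · exact (hi.smooth.mul hi.contDiffAt_dualForm_I).congr_of_eventuallyEq e2
    · rw [e1.fderiv_eq, e2.fderiv_eq, hi.fderiv_mul_dualForm]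

theorem IsDualPair.mem_bonnetFrames [DiscreteTopology L] [IsZLattice ℝ L] :
    θ ∈ BonnetFrames L := by
  obtain ⟨⟨F₁, s₁, d₁, r₁⟩, ⟨F₂, s₂, d₂, r₂⟩⟩ := h.exists_primitives hτ
  obtain ⟨p₁, p₂⟩ := h.isPeriodic hτ
  have x₁ : ∀ z v, fderiv ℝ F₁ z v = θ.1 z v := fun z v => by rw [d₁]
  have x₂ : ∀ z v, fderiv ℝ F₂ z v = θ.2 z v := fun z v => by rw [d₂]
  have i₁ : IsImaginaryImmersion F₁ :=
    ⟨s₁, fun z => by rw [dx, dy, x₁, x₁]; exact (h.pair hτ z).1⟩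
  have i₂ : IsImaginaryImmersion F₂ :=
    ⟨s₂, fun z => by rw [dx, dy, x₂, x₂]; exact (h.pair hτ z).2⟩
  have conf : ∀ F, IsImaginaryImmersion F → IsConformalImmersionOn F Set.univ := fun F hF =>
    ⟨hF.smooth.contDiffOn, fun z _ => (hF.pair z).ne_zero, fun z _ => (hF.pair z).norm_eq,
      fun z _ => (hF.pair z).inner_eq_zero⟩
  have sff : ∀ z, sffXX F₂ z - sffXX F₁ z = 0 ∧ sffXY F₂ z - sffXY F₁ z = 2 ∧
      sffYY F₂ z - sffYY F₁ z = 0 := by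
    intro z
    obtain ⟨T, hi, hu, hd⟩ := h.exists_local hτ z
    rw [← d₁, ← d₂] at hd
    exact sff_of_isDualAt i₁ hi hu hd
  have hn : ∀ z, ‖dx F₁ z‖ = ‖dx F₂ z‖ := by
    intro z
    obtain ⟨T, hi, hu, hd⟩ := h.exists_local hτ z
    rw [← d₁, ← d₂] at hd
    exact (isGaugeAt_of_isDualAt hi hu hd).norm_dx.symm
  have hm : ∀ z, sffXX F₁ z + sffYY F₁ z = sffXX F₂ z + sffYY F₂ z := fun z => by
    linarith [(sff z).1, (sff z).2.2]
  refine ⟨p₁, p₂, F₁, F₂, ⟨fun z => ⟨r₁ z, r₂ z⟩, conf F₁ i₁, conf F₂ i₂, hn, fun z =>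
    (mean_eq_iff (i₁.pair z).ne_zero (hn z)).2 (hm z), ?_⟩, fun z =>
    (hopf_sub_eq_neg_I_iff (hm z)).2 ⟨(sff z).1, (sff z).2.1⟩, d₁, d₂⟩
  exact not_congruent_of_normalized L i₁ i₂ hm (fun z => ⟨(sff z).1, (sff z).2.1⟩)
    (d₁ ▸ p₁) (d₂ ▸ p₂)

end Pair

/-- The torus is determined by its Bonnet pair. -/
theorem IsDualPair.injective {τ' : ℂ ⧸ L → RP3} {θ : Form × Form} (hτ : IsIsothermicRP3 L τ)
    (hτ' : IsIsothermicRP3 L τ') (h : IsDualPair L τ θ) (h' : IsDualPair L τ' θ) : τ = τ' := by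
  ext1 q
  obtain ⟨z, rfl⟩ := L.mkQ_surjective q
  obtain ⟨U, T, hU, hz, hl, -⟩ := hτ z
  obtain ⟨U', T', hU', hz', hl', -⟩ := hτ' z
  have e := fun v => (h U T hU hl z hz).conj (S3.norm_coe _) v
  have e' := fun v => (h' U' T' hU' hl' z hz').conj (S3.norm_coe _) v
  rw [← hl.lifts z hz, ← hl'.lifts z hz', RP3.mk_eq_iff_coe]
  exact (h.pair hτ z).1.eq_or_neg_of_conj_eq (S3.norm_coe _) (S3.norm_coe _)
    ((e 1).symm.trans (e' 1)) ((e Complex.I).symm.trans (e' Complex.I))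

end Torus

/-- Two immersions with the same metric are related by a smooth family of unit quaternions. -/
theorem exists_gauge {F₁ F₂ : ℂ → ℍ[ℝ]} (h₁ : IsImaginaryImmersion F₁)
    (h₂ : IsImaginaryImmersion F₂) (hn : ∀ z, ‖dx F₁ z‖ = ‖dx F₂ z‖) :
    ∃ T : ℂ → ℍ[ℝ], ContDiff ℝ ∞ T ∧ (∀ z, ‖T z‖ = 1) ∧
      ∀ z v, fderiv ℝ F₂ z v = T z * fderiv ℝ F₁ z v * star (T z) := by
  have sm : ∀ F, IsImaginaryImmersion F → ContDiff ℝ ∞ (fun z => ‖dx F z‖⁻¹ • dx F z) ∧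
      ContDiff ℝ ∞ (fun z => ‖dx F z‖⁻¹ • dy F z) := by
    intro F hF
    have : ContDiff ℝ ∞ (fun z => ‖dx F z‖⁻¹) :=
      (hF.contDiff_dx.norm ℝ fun z => (hF.pair z).ne_zero).inv
        fun z => norm_ne_zero_iff.2 (hF.pair z).ne_zero
    exact ⟨this.smul hF.contDiff_dx, this.smul hF.contDiff_dy⟩
  obtain ⟨T, hT, hi⟩ := exists_intertwiner (sm F₁ h₁).1 (sm F₁ h₁).2 (sm F₂ h₂).1 (sm F₂ h₂).2
    (fun z => (h₁.pair z).orthonormal) (fun z => (h₂.pair z).orthonormal)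
  refine ⟨T, hT, fun z => (hi z).unit, fun z v => ?_⟩
  have key : ∀ {A C : ℍ[ℝ]}, T z * (‖dx F₁ z‖⁻¹ • A) = ‖dx F₂ z‖⁻¹ • C * T z →
      C = T z * A * star (T z) := by
    intro A C e
    rw [mul_smul_comm, smul_mul_assoc, hn z] at e
    have := smul_right_injective ℍ[ℝ] (inv_ne_zero (norm_ne_zero_iff.2 (h₂.pair z).ne_zero)) e
    rw [this, mul_assoc, self_mul_star_of_norm (hi z).unit, mul_one]
  rw [fderiv_apply_complex F₂, fderiv_apply_complex F₁, key (hi z).left, key (hi z).right]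
  simp only [mul_add, add_mul, mul_smul_comm, smul_mul_assoc]

/-- The unit quaternions conjugating one surface of a normalized Bonnet pair into the other form an
isothermic surface. -/
theorem IsBonnetPair.isothermic {F₁ F₂ T : ℂ → ℍ[ℝ]} (hb : IsBonnetPair F₁ F₂)
    (hnorm : IsNormalized F₁ F₂) (hT : ContDiff ℝ ∞ T) (hu : ∀ z, ‖T z‖ = 1)
    (hc : ∀ z v, fderiv ℝ F₂ z v = T z * fderiv ℝ F₁ z v * star (T z)) (z : ℂ) :
    IsIsothermicAt T z ∧ IsDualAt (fderiv ℝ F₁) (fderiv ℝ F₂) T z := by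
  have hm : ∀ z, sffXX F₁ z + sffYY F₁ z = sffXX F₂ z + sffYY F₂ z := fun z =>
    (mean_eq_iff (hb.immersion₁.pair z).ne_zero (hb.isometric z)).1 (hb.mean_eq z)
  exact isothermic_of_gauge hb.immersion₁ hb.immersion₂ hm
    (fun z => (hopf_sub_eq_neg_I_iff (hm z)).1 (hnorm z)) hT hu hc z

theorem isDualPair_of_global {L : Submodule ℤ ℂ} {τ : ℂ ⧸ L → RP3} {θ : Form × Form} {T : ℂ → S3}
    (hT : ContDiff ℝ ∞ fun z => (T z : ℍ[ℝ])) (hl : ∀ z, τ (L.mkQ z) = RP3.mk (T z))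
    (hi : ∀ z, IsIsothermicAt (fun w => (T w : ℍ[ℝ])) z)
    (hd : ∀ z, IsDualAt θ.1 θ.2 (fun w => (T w : ℍ[ℝ])) z) :
    IsIsothermicRP3 L τ ∧ IsDualPair L τ θ := by
  have hlift : IsLiftOn L τ T Set.univ := ⟨hT.contDiffOn, fun z _ => (hl z).symm⟩
  refine ⟨fun z => ⟨Set.univ, T, isOpen_univ, trivial, hlift,
    (isIsothermicOn_iff isOpen_univ).2 fun z _ => hi z⟩, fun U T' hU h' z hz => ?_⟩
  rcases hlift.eventually_eq_or_neg h' isOpen_univ hU trivial hz with e | e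
  · exact (hd z).congr e
  · exact (hd z).neg.congr e

theorem exists_torus {L : Submodule ℤ ℂ} {θ : Form × Form} (hθ : θ ∈ BonnetFrames L) :
    ∃ τ : ℂ ⧸ L → RP3, IsIsothermicRP3 L τ ∧ IsDualPair L τ θ := by
  obtain ⟨p₁, p₂, F₁, F₂, hb, hnorm, d₁, d₂⟩ := hθ
  obtain ⟨T, hT, hu, hc⟩ := exists_gauge hb.immersion₁ hb.immersion₂ hb.isometric
  have hi := hb.isothermic hnorm hT hu hc
  set S : ℂ → S3 := fun z => ⟨T z, by simpa using hu z⟩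
  -- Both `T (z + l)` and `T z` conjugate the same frame of `F₁` into the same frame of `F₂`, so
  -- they agree up to sign, and `T` descends to `ℝP³`.
  obtain ⟨τ, hτ⟩ := exists_descent (L := L) (fun z => RP3.mk (S z)) fun l hl z => by
    rw [RP3.mk_eq_iff_coe]
    have e : ∀ v, T (z + l) * fderiv ℝ F₁ z v * star (T (z + l)) =
        T z * fderiv ℝ F₁ z v * star (T z) := by
      intro v
      rw [← hc, d₂, ← p₂ l hl, ← d₂, hc, d₁, p₁ l hl]
    exact (hb.immersion₁.pair z).eq_or_neg_of_conj_eq (hu _) (hu _) (e 1) (e Complex.I)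
  refine ⟨τ, isDualPair_of_global (T := S) hT hτ (fun z => (hi z).1) fun z => ?_⟩
  rw [← d₁, ← d₂]
  exact (hi z).2

/-! ### Change of the conformal coordinate -/

theorem fderiv_comp_mul {V : Type*} [NormedAddCommGroup V] [NormedSpace ℝ V] {f : ℂ → V}
    (hf : Differentiable ℝ f) (c z v : ℂ) :
    fderiv ℝ (fun w => f (c * w)) z v = fderiv ℝ f (c * z) (c * v) := by
  have h1 : HasFDerivAt (fun w : ℂ => c * w) (c • ContinuousLinearMap.id ℝ ℂ) z :=
    (hasFDerivAt_id z).const_mul c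
  have h2 : fderiv ℝ (fun w => f (c * w)) z = _ := ((hf (c * z)).hasFDerivAt.comp z h1).fderiv
  rw [h2]
  simp

section Reparametrization

variable {F : ℂ → ℍ[ℝ]} (c : ℂ)

theorem dx_comp_mul (hF : Differentiable ℝ F) (z : ℂ) :
    dx (fun w => F (c * w)) z = c.re • dx F (c * z) + c.im • dy F (c * z) := by
  rw [dx, fderiv_comp_mul hF, fderiv_apply_complex, mul_one]

theorem dy_comp_mul (hF : Differentiable ℝ F) (z : ℂ) :
    dy (fun w => F (c * w)) z = -(c.im • dx F (c * z)) + c.re • dy F (c * z) := by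
  rw [dy, fderiv_comp_mul hF, fderiv_apply_complex]
  simp

namespace IsImaginaryImmersion

theorem re_sq_add_im_sq_pos {c : ℂ} (hc : c ≠ 0) : 0 < c.re ^ 2 + c.im ^ 2 := by
  have := Complex.normSq_pos.2 hc
  rw [Complex.normSq_apply] at this
  linarith

variable (h : IsImaginaryImmersion F)
include h

theorem differentiable : Differentiable ℝ F := h.smooth.differentiable (by simp)

theorem norm_sq_dx_comp_mul (z : ℂ) :
    ‖dx (fun w => F (c * w)) z‖ ^ 2 = (c.re ^ 2 + c.im ^ 2) * ‖dx F (c * z)‖ ^ 2 := by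
  have p := h.pair (c * z)
  rw [dx_comp_mul c h.differentiable, ← real_inner_self_eq_norm_sq]
  simp only [inner_add_left, inner_add_right, inner_smul_left, inner_smul_right,
    real_inner_self_eq_norm_sq, p.inner_eq_zero, real_inner_comm (dx F (c * z)) (dy F (c * z)),
    ← p.norm_eq, conj_trivial]
  ring

theorem norm_sq_dy_comp_mul (z : ℂ) :
    ‖dy (fun w => F (c * w)) z‖ ^ 2 = (c.re ^ 2 + c.im ^ 2) * ‖dx F (c * z)‖ ^ 2 := by
  have p := h.pair (c * z)
  rw [dy_comp_mul c h.differentiable, ← real_inner_self_eq_norm_sq]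
  simp only [inner_add_left, inner_add_right, inner_smul_left, inner_smul_right, inner_neg_left,
    inner_neg_right, real_inner_self_eq_norm_sq, p.inner_eq_zero,
    real_inner_comm (dx F (c * z)) (dy F (c * z)), ← p.norm_eq, conj_trivial]
  ring

variable {c} (hc : c ≠ 0)
include hc

theorem comp_mul : IsImaginaryImmersion (fun w => F (c * w)) := by
  refine ⟨h.smooth.comp (by fun_prop), fun z => ?_⟩
  have p := h.pair (c * z)
  have e := h.norm_sq_dx_comp_mul c z
  refine ⟨fun h0 => ?_, ?_, ?_, ?_, ?_⟩
  · rw [h0, norm_zero] at e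
    have := mul_pos (re_sq_add_im_sq_pos hc) p.norm_sq_pos
    rw [← e] at this
    norm_num at this
  · rw [dx_comp_mul c h.differentiable]
    simp [p.re_x, p.re_y]
  · rw [dy_comp_mul c h.differentiable]
    simp [p.re_x, p.re_y]
  · rw [← h.norm_sq_dy_comp_mul c z] at e
    exact (pow_left_inj₀ (norm_nonneg _) (norm_nonneg _) two_ne_zero).1 e
  · rw [dx_comp_mul c h.differentiable, dy_comp_mul c h.differentiable]
    simp only [inner_add_left, inner_add_right, inner_smul_left, inner_smul_right,
      inner_neg_right, real_inner_self_eq_norm_sq, p.inner_eq_zero,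
      real_inner_comm (dx F (c * z)) (dy F (c * z)), ← p.norm_eq, conj_trivial]
    ring

theorem normal_comp_mul (z : ℂ) : normal (fun w => F (c * w)) z = normal F (c * z) := by
  have p := h.pair (c * z)
  rw [normal, h.norm_sq_dx_comp_mul, dx_comp_mul c h.differentiable, dy_comp_mul c h.differentiable,
    mul_inv, normal]
  have : (c.re • dx F (c * z) + c.im • dy F (c * z)) *
      (-(c.im • dx F (c * z)) + c.re • dy F (c * z)) =
      (c.re ^ 2 + c.im ^ 2) • (dx F (c * z) * dy F (c * z)) := by
    simp only [mul_add, add_mul, mul_neg, smul_mul_assoc, mul_smul_comm, p.mul_self_x,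
      p.mul_self_y, p.mul_comm_neg]
    module
  rw [this, smul_smul, mul_right_comm, inv_mul_cancel₀ (re_sq_add_im_sq_pos hc).ne', one_mul]

/-- The normal is unchanged, and the second fundamental form is evaluated on the rotated and scaled
frame `c`, `ic`. -/
theorem sff_comp_mul (z : ℂ) :
    sffXX (fun w => F (c * w)) z = c.re ^ 2 * sffXX F (c * z) +
      2 * c.re * c.im * sffXY F (c * z) + c.im ^ 2 * sffYY F (c * z) ∧
    sffXY (fun w => F (c * w)) z = -(c.re * c.im) * sffXX F (c * z) +
      (c.re ^ 2 - c.im ^ 2) * sffXY F (c * z) + c.re * c.im * sffYY F (c * z) ∧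
    sffYY (fun w => F (c * w)) z = c.im ^ 2 * sffXX F (c * z) -
      2 * c.re * c.im * sffXY F (c * z) + c.re ^ 2 * sffYY F (c * z) := by
  have ddx : ∀ z v, fderiv ℝ (fun w => dx F (c * w)) z v = fderiv ℝ (dx F) (c * z) (c * v) :=
    fderiv_comp_mul h.differentiable_dx c
  have ddy : ∀ z v, fderiv ℝ (fun w => dy F (c * w)) z v = fderiv ℝ (dy F) (c * z) (c * v) :=
    fderiv_comp_mul h.differentiable_dy c
  have dX : Differentiable ℝ (fun w => dx F (c * w)) :=
    h.differentiable_dx.comp (differentiable_id.const_mul c)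
  have dY : Differentiable ℝ (fun w => dy F (c * w)) :=
    h.differentiable_dy.comp (differentiable_id.const_mul c)
  have comb : ∀ (s t : ℝ) (z v : ℂ),
      fderiv ℝ (fun w => s • dx F (c * w) + t • dy F (c * w)) z v =
      s • fderiv ℝ (dx F) (c * z) (c * v) + t • fderiv ℝ (dy F) (c * z) (c * v) := by
    intro s t z v
    rw [fderiv_add_apply' (a := fun w => s • dx F (c * w)) (b := fun w => t • dy F (c * w))
        ((dX z).const_smul s) ((dY z).const_smul t),
      fderiv_fun_const_smul (dX z), fderiv_fun_const_smul (dY z)]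
    simp only [smul_apply, ddx, ddy]
  have ex : dx (fun w => F (c * w)) = fun w => c.re • dx F (c * w) + c.im • dy F (c * w) :=
    funext (dx_comp_mul c h.differentiable)
  have ey : dy (fun w => F (c * w)) = fun w => (-c.im) • dx F (c * w) + c.re • dy F (c * w) := by
    funext w
    rw [dy_comp_mul c h.differentiable, neg_smul]
  have a1 : ∀ f : ℂ → ℍ[ℝ], fderiv ℝ f (c * z) (c * 1) = c.re • dx f (c * z) + c.im • dy f (c * z) :=
    fun f => by rw [fderiv_apply_complex, mul_one]
  have a2 : ∀ f : ℂ → ℍ[ℝ], fderiv ℝ f (c * z) (c * Complex.I) =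
      (-c.im) • dx f (c * z) + c.re • dy f (c * z) :=
    fun f => by rw [fderiv_apply_complex]; simp
  have exx : dx (dx (fun w => F (c * w))) z =
      c.re • (c.re • dx (dx F) (c * z) + c.im • dy (dx F) (c * z)) +
        c.im • (c.re • dy (dx F) (c * z) + c.im • dy (dy F) (c * z)) := by
    rw [ex, dx, comb, a1, a1, h.dx_dy]
  have exy : dy (dx (fun w => F (c * w))) z =
      c.re • ((-c.im) • dx (dx F) (c * z) + c.re • dy (dx F) (c * z)) +
        c.im • ((-c.im) • dy (dx F) (c * z) + c.re • dy (dy F) (c * z)) := by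
    rw [ex, dy, comb, a2, a2, h.dx_dy]
  have eyy : dy (dy (fun w => F (c * w))) z =
      (-c.im) • ((-c.im) • dx (dx F) (c * z) + c.re • dy (dx F) (c * z)) +
        c.re • ((-c.im) • dy (dx F) (c * z) + c.re • dy (dy F) (c * z)) := by
    rw [ey, dy, comb, a2, a2, h.dx_dy]
  simp only [sffXX, sffXY, sffYY, h.normal_comp_mul hc, exx, exy, eyy, inner_add_left,
    inner_smul_left, conj_trivial]
  refine ⟨?_, ?_, ?_⟩ <;> ring

theorem hopf_comp_mul (z : ℂ) : hopf (fun w => F (c * w)) z = c ^ 2 * hopf F (c * z) := by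
  obtain ⟨e1, e2, e3⟩ := h.sff_comp_mul hc z
  have hsq : c ^ 2 = (c.re + c.im * Complex.I) ^ 2 := by rw [Complex.re_add_im]
  rw [hopf_eq, hopf_eq, e1, e2, e3, hsq]
  push_cast
  linear_combination ((c.re * c.im : ℂ) * sffXY F (c * z) -
    (c.im ^ 2 : ℂ) * (sffXX F (c * z) - sffYY F (c * z)) / 4 +
    (c.im ^ 2 : ℂ) * Complex.I * sffXY F (c * z) / 2) * Complex.I_sq

end IsImaginaryImmersion

end Reparametrization

theorem IsBonnetPair.comp_mul {F₁ F₂ : ℂ → ℍ[ℝ]} (hb : IsBonnetPair F₁ F₂) {c : ℂ} (hc : c ≠ 0) :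
    IsBonnetPair (fun z => F₁ (c * z)) (fun z => F₂ (c * z)) := by
  have i₁ := hb.immersion₁
  have i₂ := hb.immersion₂
  have j₁ := i₁.comp_mul hc
  have j₂ := i₂.comp_mul hc
  have conf : ∀ F, IsImaginaryImmersion F → IsConformalImmersionOn F Set.univ := fun F hF =>
    ⟨hF.smooth.contDiffOn, fun z _ => (hF.pair z).ne_zero, fun z _ => (hF.pair z).norm_eq,
      fun z _ => (hF.pair z).inner_eq_zero⟩
  have hn : ∀ z, ‖dx (fun z => F₁ (c * z)) z‖ = ‖dx (fun z => F₂ (c * z)) z‖ := by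
    intro z
    have e := i₁.norm_sq_dx_comp_mul c z
    rw [hb.isometric, ← i₂.norm_sq_dx_comp_mul c z] at e
    exact (pow_left_inj₀ (norm_nonneg _) (norm_nonneg _) two_ne_zero).1 e
  refine ⟨fun z => hb.imaginary _, conf _ j₁, conf _ j₂, hn, fun z => ?_, fun hcong => ?_⟩
  · rw [mean_eq_iff (j₁.pair z).ne_zero (hn z)]
    have hm := (mean_eq_iff (i₁.pair (c * z)).ne_zero (hb.isometric _)).1 (hb.mean_eq (c * z))
    obtain ⟨e1, -, e3⟩ := i₁.sff_comp_mul hc z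
    obtain ⟨e1', -, e3'⟩ := i₂.sff_comp_mul hc z
    rw [e1, e3, e1', e3']
    linear_combination (c.re ^ 2 + c.im ^ 2) * hm
  · refine hb.not_congruent fun z w => ?_
    have := hcong (c⁻¹ * z) (c⁻¹ * w)
    simpa only [mul_inv_cancel_left₀ hc] using this

theorem hopf_eq_of_fderiv_eq {F G : ℂ → ℍ[ℝ]} (h : fderiv ℝ F = fderiv ℝ G) : hopf F = hopf G := by
  have ex : dx F = dx G := by unfold dx; rw [h]
  have ey : dy F = dy G := by unfold dy; rw [h]
  have en : normal F = normal G := by unfold normal; rw [ex, ey]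
  unfold hopf
  rw [ex, ey, en]

/-- Membership provides some primitives, not the given ones, but the Hopf differential depends only
on the differential of the surface. Each side excludes `c = 0`. -/
theorem IsBonnetPair.comp_mul_mem_iff {L : Submodule ℤ ℂ} {F₁ F₂ : ℂ → ℍ[ℝ]}
    (hb : IsBonnetPair F₁ F₂) (p₁ : IsPeriodic L (fderiv ℝ F₁)) (p₂ : IsPeriodic L (fderiv ℝ F₂))
    (c : ℂ) :
    (fderiv ℝ (fun z => F₁ (c * z)), fderiv ℝ (fun z => F₂ (c * z))) ∈
        BonnetFrames (L.comap (LinearMap.mulLeft ℤ c)) ↔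
      ∀ z, c ^ 2 * (hopf F₂ (c * z) - hopf F₁ (c * z)) = -Complex.I := by
  have norm_iff : c ≠ 0 → (IsNormalized (fun z => F₁ (c * z)) (fun z => F₂ (c * z)) ↔
      ∀ z, c ^ 2 * (hopf F₂ (c * z) - hopf F₁ (c * z)) = -Complex.I) := fun hc =>
    forall_congr' fun z => by
      rw [hb.immersion₁.hopf_comp_mul hc, hb.immersion₂.hopf_comp_mul hc, mul_sub]
  constructor
  · rintro ⟨-, -, G₁, G₂, hG, hnorm, d₁, d₂⟩
    have hc : c ≠ 0 := by
      rintro rfl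
      refine hG.conformal₁.immersion 0 trivial ?_
      rw [dx, d₁]
      simp
    rw [← norm_iff hc]
    intro z
    rw [← hopf_eq_of_fderiv_eq d₁, ← hopf_eq_of_fderiv_eq d₂]
    exact hnorm z
  · intro h
    have hc : c ≠ 0 := by
      rintro rfl
      have := h 0
      simp at this
    have per : ∀ F : ℂ → ℍ[ℝ], Differentiable ℝ F → IsPeriodic L (fderiv ℝ F) →
        IsPeriodic (L.comap (LinearMap.mulLeft ℤ c)) (fderiv ℝ (fun z => F (c * z))) := by
      intro F hF hp l hl z
      ext1 v
      rw [fderiv_comp_mul hF, fderiv_comp_mul hF, mul_add, hp (c * l) hl]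
    exact ⟨per _ hb.immersion₁.differentiable p₁, per _ hb.immersion₂.differentiable p₂, _, _,
      hb.comp_mul hc, (norm_iff hc).2 h, rfl, rfl⟩

/-- The Hopf differentials of a Bonnet pair with doubly periodic frames differ by a nonzero
constant. -/
theorem IsBonnetPair.hopf_sub_const {L : Submodule ℤ ℂ} [DiscreteTopology L] [IsZLattice ℝ L]
    {F₁ F₂ : ℂ → ℍ[ℝ]} (hb : IsBonnetPair F₁ F₂) (p₁ : IsPeriodic L (fderiv ℝ F₁))
    (p₂ : IsPeriodic L (fderiv ℝ F₂)) :
    ∃ h : ℂ, h ≠ 0 ∧ ∀ z, hopf F₂ z - hopf F₁ z = h := by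
  have i₁ := hb.immersion₁
  have i₂ := hb.immersion₂
  have hm : ∀ z, sffXX F₁ z + sffYY F₁ z = sffXX F₂ z + sffYY F₂ z := fun z =>
    (mean_eq_iff (i₁.pair z).ne_zero (hb.isometric z)).1 (hb.mean_eq z)
  have hconst := fun z => sff_sub_const L i₁ i₂ hb.isometric hm p₁ p₂ z 0
  refine ⟨hopf F₂ 0 - hopf F₁ 0, fun h0 => hb.not_congruent ?_, fun z => ?_⟩
  · rw [hopf_sub_eq (hm 0), Complex.ext_iff] at h0
    simp at h0
    obtain ⟨T, hT, hu, hc⟩ := exists_gauge i₁ i₂ hb.isometric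
    have hTd : Differentiable ℝ T := hT.differentiable (by simp)
    -- If the Hopf differentials coincide, the gauge formulas give `dT = 0`, so the surfaces differ
    -- by one fixed rotation and a translation.
    have hT0 : ∀ z, fderiv ℝ T z = 0 := by
      intro z
      have g : IsGaugeAt F₁ F₂ T z :=
        ⟨hT.contDiffAt, Eventually.of_forall hu, Eventually.of_forall hc⟩
      have e1 : sffXX F₂ z - sffXX F₁ z = 0 := by rw [(hconst z).1]; linarith [h0.1]
      have e2 : sffXY F₂ z - sffXY F₁ z = 0 := by rw [(hconst z).2]; linarith [h0.2]
      have e3 : sffYY F₂ z - sffYY F₁ z = 0 := by linarith [hm z]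
      have ex := g.dx_gauge i₁ i₂
      have ey := g.dy_gauge i₁ i₂
      rw [e1, e2] at ex
      rw [e2, e3] at ey
      refine form_ext (ex.trans ?_) (ey.trans ?_) <;> simp
    have hTc : ∀ z, T z = T 0 := fun z => is_const_of_fderiv_eq_zero hTd hT0 z 0
    exact congruent_of_fderiv_conj i₁.differentiable i₂.differentiable (hu 0)
      fun z v => by rw [hc, hTc z]
  · rw [hopf_sub_eq (hm z), hopf_sub_eq (hm 0), (hconst z).1, (hconst z).2]

/-! ### Spin structures -/

theorem isOrthonormalPair_quatI_quatJ : IsOrthonormalPair quatI quatJ := by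
  have hI : ‖quatI‖ ^ 2 = 1 := by rw [norm_sq_eq]; simp [quatI]
  have hJ : ‖quatJ‖ ^ 2 = 1 := by rw [norm_sq_eq]; simp [quatJ]
  have hI' : ‖quatI‖ = 1 := (pow_eq_one_iff_of_nonneg (norm_nonneg _) two_ne_zero).1 hI
  have hJ' : ‖quatJ‖ = 1 := (pow_eq_one_iff_of_nonneg (norm_nonneg _) two_ne_zero).1 hJ
  refine ⟨⟨?_, rfl, rfl, hI'.trans hJ'.symm, ?_⟩, hI'⟩
  · rw [← norm_ne_zero_iff, hI']
    exact one_ne_zero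
  · rw [inner_eq]
    simp [quatI, quatJ]

theorem neg_one_pow_val_cases (a : ZMod 2) :
    ((-1 : ℍ[ℝ]) ^ a.val = 1) ∨ ((-1 : ℍ[ℝ]) ^ a.val = -1) :=
  neg_one_pow_eq_or _ _

theorem eq_add_of_neg_one_pow {a b c : ZMod 2}
    (h : (-1 : ℍ[ℝ]) ^ a.val = (-1) ^ b.val * (-1) ^ c.val) : a = b + c := by
  have h' : (((-1) ^ a.val : ℤ) : ℍ[ℝ]) = (((-1) ^ b.val * (-1) ^ c.val : ℤ) : ℍ[ℝ]) := by
    push_cast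
    exact h
  have key : ∀ a b c : ZMod 2, ((-1 : ℤ) ^ a.val) = (-1) ^ b.val * (-1) ^ c.val → a = b + c := by
    decide
  have : CharZero ℍ[ℝ] := charZero_of_injective_algebraMap (algebraMap ℝ ℍ[ℝ]).injective
  exact key a b c (Int.cast_injective h')

/-- For each period the sign is constant in `z` by connectedness, and signs multiply under addition
of periods because `Φ` has no zeros. -/
theorem exists_spin {L : Submodule ℤ ℂ} {Φ : ℂ → ℍ[ℝ]} (hΦ : Continuous Φ)
    (hu : ∀ z, ‖Φ z‖ = 1) (h : ∀ l ∈ L, ∀ z, Φ (z + l) = Φ z ∨ Φ (z + l) = -Φ z) :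
    ∃ p : L →+ ZMod 2, ∀ (l : L) (z : ℂ), Φ (z + l) = (-1) ^ (p l).val * Φ z := by
  have h0 : ∀ z, Φ z ≠ 0 := fun z => by
    rw [← norm_ne_zero_iff, hu]
    exact one_ne_zero
  have key : ∀ l : L, ∃ a : ZMod 2, ∀ z : ℂ, Φ (z + l) = (-1) ^ a.val * Φ z := by
    intro l
    rcases eq_or_neg_of_continuous hΦ (hΦ.comp (continuous_add_const (l : ℂ))) h0
      (h l l.2) with e | e
    · exact ⟨0, fun z => by simpa using e z⟩
    · refine ⟨1, fun z => ?_⟩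
      have : (1 : ZMod 2).val = 1 := rfl
      rw [this, pow_one, neg_one_mul]
      exact e z
  choose p hp using key
  refine ⟨AddMonoidHom.mk' p fun l m => ?_, hp⟩
  apply eq_add_of_neg_one_pow
  apply mul_right_cancel₀ (h0 0)
  rw [← hp, mul_assoc, ← hp m 0, ← hp l, Submodule.coe_add, zero_add, zero_add, add_comm]

section Spin

variable {L : Submodule ℤ ℂ} {θ : Form × Form} {T : ℂ → ℍ[ℝ]}

/-- If `Φ` frames `F₁`, then `Φ T⁻¹` frames `F₂`, and a periodic `T` leaves the signs of `Φ`
unchanged. -/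
theorem sameSpin_of_conj (hs : ContDiff ℝ ∞ fun z => θ.1 z 1)
    (hs' : ContDiff ℝ ∞ fun z => θ.1 z Complex.I)
    (hp : ∀ z, IsConformalPair (θ.1 z 1) (θ.1 z Complex.I)) (per : IsPeriodic L θ.1)
    (hT : ContDiff ℝ ∞ T) (hu : ∀ z, ‖T z‖ = 1) (hTp : ∀ l ∈ L, ∀ z, T (z + l) = T z)
    (hc : ∀ z v, θ.2 z v = T z * θ.1 z v * star (T z)) : SameSpin L θ := by
  have hn : ContDiff ℝ ∞ (fun z => ‖θ.1 z 1‖⁻¹) :=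
    (hs.norm ℝ fun z => (hp z).ne_zero).inv fun z => norm_ne_zero_iff.2 (hp z).ne_zero
  obtain ⟨Φ, hΦ, hi⟩ := exists_intertwiner (hn.smul hs) (hn.smul hs')
    (C := fun _ => quatI) (D := fun _ => quatJ) contDiff_const contDiff_const
    (fun z => (hp z).orthonormal) fun _ => isOrthonormalPair_quatI_quatJ
  obtain ⟨p, hΦp⟩ := exists_spin (L := L) hΦ.continuous (fun z => (hi z).unit) fun l hl z => by
    have e := hi (z + l)
    simp only [Pi.smul_apply', per l hl] at e
    exact (hp z).orthonormal.intertwines_unique isOrthonormalPair_quatI_quatJ (hi z) e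
  have key : ∀ {z : ℂ} {A C : ℍ[ℝ]}, Φ z * (‖θ.1 z 1‖⁻¹ • A) = C * Φ z →
      A = ‖θ.1 z 1‖ • ((Φ z)⁻¹ * C * Φ z) := by
    intro z A C e
    have hz := norm_ne_zero_iff.2 (hp z).ne_zero
    have h0 : Φ z ≠ 0 := by
      rw [← norm_ne_zero_iff, (hi z).unit]
      exact one_ne_zero
    rw [mul_assoc, ← e, inv_mul_cancel_left₀ h0, smul_smul, mul_inv_cancel₀ hz, one_smul]
  have hx : ∀ z, θ.1 z 1 = ‖θ.1 z 1‖ • ((Φ z)⁻¹ * quatI * Φ z) := fun z => key (hi z).left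
  have hy : ∀ z, θ.1 z Complex.I = ‖θ.1 z Complex.I‖ • ((Φ z)⁻¹ * quatJ * Φ z) := fun z => by
    rw [← (hp z).norm_eq]
    exact key (hi z).right
  have hnorm : ∀ z v, ‖θ.2 z v‖ = ‖θ.1 z v‖ := fun z v => by
    rw [hc, norm_mul, norm_mul, norm_star, hu]
    simp
  have conj : ∀ {z : ℂ} {C : ℍ[ℝ]} {r : ℝ}, T z * (r • ((Φ z)⁻¹ * C * Φ z)) * star (T z) =
      r • ((Φ z * star (T z))⁻¹ * C * (Φ z * star (T z))) := by
    intro z C r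
    have : (star (T z))⁻¹ = T z := by
      rw [← inv_eq_star_of_norm (hu z), inv_inv]
    rw [mul_inv_rev, this, mul_smul_comm, smul_mul_assoc]
    simp only [mul_assoc]
  have hTs : ContDiff ℝ ∞ fun z => star (T z) :=
    (starL' ℝ : ℍ[ℝ] ≃L[ℝ] ℍ[ℝ]).contDiff.comp hT
  refine ⟨p, ⟨Φ, ⟨hΦ, fun z => (hi z).unit, hx, hy⟩, hΦp⟩, fun z => Φ z * star (T z),
    ⟨hΦ.mul hTs, fun z => ?_, fun z => ?_, fun z => ?_⟩, fun l z => ?_⟩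
  · rw [norm_mul, norm_star, (hi z).unit, hu, one_mul]
  · rw [hnorm]
    conv_lhs => rw [hc, hx z]
    exact conj
  · rw [hnorm]
    conv_lhs => rw [hc, hy z]
    exact conj
  · simp only
    rw [hΦp, hTp l l.2, mul_assoc]

/-- The quotient `T = Ψ⁻¹ Φ` of the two spin frames conjugates `dF₁` into `dF₂`, and the equal signs
of `Φ` and `Ψ` under each period cancel. -/
theorem exists_periodic_gauge (hn : ∀ z v, v = 1 ∨ v = Complex.I → ‖θ.2 z v‖ = ‖θ.1 z v‖)
    (h : SameSpin L θ) :
    ∃ T : ℂ → ℍ[ℝ], ContDiff ℝ ∞ T ∧ (∀ z, ‖T z‖ = 1) ∧ (∀ l ∈ L, ∀ z, T (z + l) = T z) ∧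
      ∀ z v, θ.2 z v = T z * θ.1 z v * star (T z) := by
  obtain ⟨p, ⟨Φ, hΦ, hp⟩, ⟨Ψ, hΨ, hq⟩⟩ := h
  have hΨs : ContDiff ℝ ∞ fun z => star (Ψ z) :=
    (starL' ℝ : ℍ[ℝ] ≃L[ℝ] ℍ[ℝ]).contDiff.comp hΨ.smooth
  have conj : ∀ {z : ℂ} {C : ℍ[ℝ]} {r : ℝ},
      star (Ψ z) * Φ z * (r • ((Φ z)⁻¹ * C * Φ z)) * star (star (Ψ z) * Φ z) =
      r • ((Ψ z)⁻¹ * C * Ψ z) := by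
    intro z C r
    have h1 := self_mul_star_of_norm (hΦ.unitary z)
    rw [inv_eq_star_of_norm (hΦ.unitary z), inv_eq_star_of_norm (hΨ.unitary z), star_mul,
      star_star, mul_smul_comm, smul_mul_assoc]
    congr 1
    calc star (Ψ z) * Φ z * (star (Φ z) * C * Φ z) * (star (Φ z) * Ψ z)
        = star (Ψ z) * (Φ z * star (Φ z)) * C * (Φ z * star (Φ z)) * Ψ z := by
          simp only [mul_assoc]
      _ = star (Ψ z) * C * Ψ z := by rw [h1, mul_one, mul_one]
  refine ⟨fun z => star (Ψ z) * Φ z, hΨs.mul hΦ.smooth, fun z => ?_, fun l hl z => ?_,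
    fun z v => ?_⟩
  · rw [norm_mul, norm_star, hΨ.unitary, hΦ.unitary, one_mul]
  · have e1 := hp ⟨l, hl⟩ z
    have e2 := hq ⟨l, hl⟩ z
    simp only at e1 e2 ⊢
    rw [e1, e2]
    rcases neg_one_pow_val_cases (p ⟨l, hl⟩) with e | e <;> rw [e] <;> simp
  · have e1 : θ.2 z 1 = star (Ψ z) * Φ z * θ.1 z 1 * star (star (Ψ z) * Φ z) := by
      conv_rhs => rw [hΦ.frame_x z]
      rw [conj, ← hn z 1 (Or.inl rfl)]
      exact hΨ.frame_x z
    have e2 : θ.2 z Complex.I =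
        star (Ψ z) * Φ z * θ.1 z Complex.I * star (star (Ψ z) * Φ z) := by
      conv_rhs => rw [hΦ.frame_y z]
      rw [conj, ← hn z Complex.I (Or.inr rfl)]
      exact hΨ.frame_y z
    rw [form_apply (θ.2 z), form_apply (θ.1 z), e1, e2]
    simp only [mul_add, add_mul, mul_smul_comm, smul_mul_assoc]

end Spin

/-! ### The bijections -/

section Bijections

variable (L : Submodule ℤ ℂ)

/-- The pair of one-forms `(dT* T, T dT*)` of an isothermic torus in `ℝP³`. -/
def bonnetForms {τ : ℂ ⧸ L → RP3} (hτ : IsIsothermicRP3 L τ) : Form × Form :=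
  hτ.exists_isDualPair.choose

theorem bonnetForms_spec {τ : ℂ ⧸ L → RP3} (hτ : IsIsothermicRP3 L τ) :
    IsDualPair L τ (bonnetForms L hτ) :=
  hτ.exists_isDualPair.choose_spec

theorem IsIsothermicS3.contDiff {T : ℂ ⧸ L → S3} (hT : IsIsothermicS3 L T) :
    ContDiff ℝ ∞ fun z => (T (L.mkQ z) : ℍ[ℝ]) :=
  contDiffOn_univ.1 hT.conformal.smooth

theorem IsIsothermicS3.isLiftOn {T : ℂ ⧸ L → S3} (hT : IsIsothermicS3 L T) :
    IsLiftOn L (fun q => RP3.mk (T q)) (fun z => T (L.mkQ z)) Set.univ :=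
  ⟨(hT.contDiff L).contDiffOn, fun _ _ => rfl⟩

theorem IsIsothermicS3.isIsothermicRP3 {T : ℂ ⧸ L → S3} (hT : IsIsothermicS3 L T) :
    IsIsothermicRP3 L (fun q => RP3.mk (T q)) := fun _ =>
  ⟨Set.univ, fun z => T (L.mkQ z), isOpen_univ, trivial, (hT.isLiftOn L), hT⟩

variable [DiscreteTopology L] [IsZLattice ℝ L]

/-- Rescaling the coordinate of a Bonnet pair with doubly periodic frames normalizes it, in two
ways. -/
theorem exists_normalization {F₁ F₂ : ℂ → ℍ[ℝ]} (hb : IsBonnetPair F₁ F₂)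
    (p₁ : IsPeriodic L (fderiv ℝ F₁)) (p₂ : IsPeriodic L (fderiv ℝ F₂)) :
    ∃ c : ℂ, c ≠ 0 ∧ ∀ c' : ℂ,
      ((fderiv ℝ (fun z => F₁ (c' * z)), fderiv ℝ (fun z => F₂ (c' * z))) ∈
        BonnetFrames (L.comap (LinearMap.mulLeft ℤ c')) ↔ c' = c ∨ c' = -c) := by
  -- Scaling by `c'` multiplies the constant `h = Q₂ - Q₁` by `c'²`, so `c` is a square root of `-i
  -- / h`.
  obtain ⟨h, h0, hh⟩ := hb.hopf_sub_const p₁ p₂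
  obtain ⟨c, hc⟩ := IsAlgClosed.exists_pow_nat_eq (-Complex.I / h) (n := 2) two_pos
  refine ⟨c, ?_, fun c' => ?_⟩
  · rintro rfl
    rw [zero_pow two_ne_zero, eq_comm, div_eq_zero_iff, neg_eq_zero] at hc
    exact hc.elim Complex.I_ne_zero h0
  · rw [hb.comp_mul_mem_iff p₁ p₂, ← sq_eq_sq_iff_eq_or_eq_neg, hc, eq_div_iff h0]
    simp only [hh, forall_const]

/-- The map from isothermic tori in `ℝP³` to normalized Bonnet pairs. -/
def bonnetMap (τ : {τ : ℂ ⧸ L → RP3 // IsIsothermicRP3 L τ}) : BonnetFrames L :=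
  ⟨bonnetForms L τ.2, (bonnetForms_spec L τ.2).mem_bonnetFrames τ.2⟩

theorem bonnetMap_bijective : Function.Bijective (bonnetMap L) := by
  constructor
  · intro τ τ' e
    have e' : bonnetForms L τ.2 = bonnetForms L τ'.2 := congrArg Subtype.val e
    exact Subtype.ext (IsDualPair.injective τ.2 τ'.2 (bonnetForms_spec L τ.2)
      (e' ▸ bonnetForms_spec L τ'.2))
  · rintro ⟨θ, hθ⟩
    obtain ⟨τ, hτ, h⟩ := exists_torus hθ
    exact ⟨⟨τ, hτ⟩, Subtype.ext ((bonnetForms_spec L hτ).unique hτ h)⟩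

theorem IsIsothermicS3.sameSpin {T : ℂ ⧸ L → S3} (hT : IsIsothermicS3 L T) {θ : Form × Form}
    (h : IsDualPair L (fun q => RP3.mk (T q)) θ) : SameSpin L θ := by
  have hτ := hT.isIsothermicRP3 L
  obtain ⟨_, _, F₁, F₂, hb, -, d₁, -⟩ := h.mem_bonnetFrames hτ
  have hx : (fun z => θ.1 z 1) = dx F₁ := by rw [← d₁]; rfl
  have hy : (fun z => θ.1 z Complex.I) = dy F₁ := by rw [← d₁]; rfl
  refine sameSpin_of_conj (hx ▸ hb.immersion₁.contDiff_dx) (hy ▸ hb.immersion₁.contDiff_dy)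
    (fun z => (h.pair hτ z).1) (h.isPeriodic hτ).1 (hT.contDiff L) (fun z => S3.norm_coe _)
    (fun l hl z => by rw [mkQ_add l hl]) fun z v => ?_
  exact (h _ _ isOpen_univ (hT.isLiftOn L) z trivial).conj (S3.norm_coe _) v

/-- The map from isothermic tori in `S³` to normalized Bonnet pairs with the same spin
structures. -/
def bonnetMapS3 (T : {T : ℂ ⧸ L → S3 // IsIsothermicS3 L T}) :
    {θ : BonnetFrames L // SameSpin L θ.1} :=
  ⟨bonnetMap L ⟨_, (T.2.isIsothermicRP3 L)⟩, T.2.sameSpin L (bonnetForms_spec L ((T.2.isIsothermicRP3 L)))⟩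

/-- By injectivity on `ℝP³` the tori agree up to a pointwise sign, which is globally constant
because the pull-backs to `ℂ` are continuous. Hence the fibres are exactly the classes of
`antipodalTori`. -/
theorem bonnetMapS3_eq_iff (T T' : {T : ℂ ⧸ L → S3 // IsIsothermicS3 L T}) :
    bonnetMapS3 L T = bonnetMapS3 L T' ↔ T'.1 = T.1 ∨ T'.1 = -T.1 := by
  have h1 : bonnetMapS3 L T = bonnetMapS3 L T' ↔
      (fun q => RP3.mk (T.1 q)) = fun q => RP3.mk (T'.1 q) := by
    rw [Subtype.ext_iff]
    exact Iff.trans (bonnetMap_bijective L).1.eq_iff Subtype.ext_iff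
  rw [h1]
  constructor
  · intro e
    rcases eq_or_neg_of_continuous (T.2.contDiff L).continuous (T'.2.contDiff L).continuous
      (fun z => S3.coe_ne_zero _)
      (fun z => RP3.mk_eq_iff_coe.1 (congrFun e (L.mkQ z))) with h | h
    · left
      ext1 q
      obtain ⟨z, rfl⟩ := L.mkQ_surjective q
      exact Subtype.ext (h z)
    · right
      ext1 q
      obtain ⟨z, rfl⟩ := L.mkQ_surjective q
      exact Subtype.ext (h z)
  · rintro (e | e) <;> funext q <;> rw [RP3.mk_eq_iff, e]
    · exact Or.inl rfl
    · exact Or.inr rfl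

theorem bonnetMapS3_surjective : Function.Surjective (bonnetMapS3 L) := by
  rintro ⟨⟨θ, hθ⟩, hspin⟩
  obtain ⟨p₁, p₂, F₁, F₂, hb, hnorm, d₁, d₂⟩ := hθ
  have hn : ∀ z v, v = 1 ∨ v = Complex.I → ‖θ.2 z v‖ = ‖θ.1 z v‖ := by
    rintro z v (rfl | rfl)
    · rw [← d₁, ← d₂]
      exact (hb.isometric z).symm
    · rw [← d₁, ← d₂]
      exact ((hb.immersion₂.pair z).norm_eq.symm.trans (hb.isometric z).symm).trans
        (hb.immersion₁.pair z).norm_eq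
  obtain ⟨T, hT, hu, hp, hc⟩ := exists_periodic_gauge hn hspin
  have hi := hb.isothermic hnorm hT hu (by rw [d₁, d₂]; exact hc)
  rw [d₁, d₂] at hi
  obtain ⟨S, hS⟩ := exists_descent (L := L) (fun z => (⟨T z, by simpa using hu z⟩ : S3))
    fun l hl z => Subtype.ext (hp l hl z)
  have hS' : (fun z => (S (L.mkQ z) : ℍ[ℝ])) = T := funext fun z => by rw [hS]
  have hiso : IsIsothermicS3 L S := by
    unfold IsIsothermicS3
    rw [hS']
    exact (isIsothermicOn_iff isOpen_univ).2 fun z _ => (hi z).1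
  refine ⟨⟨S, hiso⟩, Subtype.ext (Subtype.ext ?_)⟩
  change bonnetForms L (hiso.isIsothermicRP3 L) = θ
  refine (bonnetForms_spec L (hiso.isIsothermicRP3 L)).unique (hiso.isIsothermicRP3 L) ?_
  refine (isDualPair_of_global (T := fun z => S (L.mkQ z)) (by rw [hS']; exact hT)
    (fun z => rfl) (fun z => ?_) fun z => ?_).2
  · rw [hS']
    exact (hi z).1
  · rw [hS']
    exact (hi z).2

/-- The map of `bonnetMapS3` on isothermic tori up to sign. -/
def bonnetMapQuotient (T : Quotient (antipodalTori L)) : {θ : BonnetFrames L // SameSpin L θ.1} :=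
  Quotient.lift (bonnetMapS3 L) (fun T T' h => (bonnetMapS3_eq_iff L T T').2 h) T

theorem bonnetMapQuotient_bijective : Function.Bijective (bonnetMapQuotient L) := by
  constructor
  · rintro ⟨T⟩ ⟨T'⟩ h
    exact Quotient.sound ((bonnetMapS3_eq_iff L T T').1 h)
  · intro θ
    obtain ⟨T, hT⟩ := bonnetMapS3_surjective L θ
    exact ⟨Quotient.mk _ T, hT⟩

end Bijections

end BonnetIsothermic

end

theorem mainTheorem5 (L : Submodule ℤ ℂ) [DiscreteTopology L] [IsZLattice ℝ L] :
    -- normalizing the coordinate of an arbitrary Bonnet pair with doubly periodic frames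
    (∀ F₁ F₂ : ℂ → ℍ[ℝ], BonnetIsothermic.IsBonnetPair F₁ F₂ →
      BonnetIsothermic.IsPeriodic L (fderiv ℝ F₁) → BonnetIsothermic.IsPeriodic L (fderiv ℝ F₂) →
      ∃ c : ℂ, c ≠ 0 ∧ ∀ c' : ℂ,
        ((fderiv ℝ (fun z => F₁ (c' * z)), fderiv ℝ (fun z => F₂ (c' * z))) ∈
          BonnetIsothermic.BonnetFrames (L.comap (LinearMap.mulLeft ℤ c')) ↔ c' = c ∨ c' = -c)) ∧
    -- all isothermic tori in `ℝP³`
    (∃ e : {τ : ℂ ⧸ L → BonnetIsothermic.RP3 // BonnetIsothermic.IsIsothermicRP3 L τ} ≃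
        BonnetIsothermic.BonnetFrames L,
      ∀ τ, BonnetIsothermic.IsBonnetRelation L τ.1 (e τ).1) ∧
    -- isothermic tori in `S³`
    (∃ e : Quotient (BonnetIsothermic.antipodalTori L) ≃
        {θ : BonnetIsothermic.BonnetFrames L // BonnetIsothermic.SameSpin L θ.1},
      ∀ T : {T : ℂ ⧸ L → BonnetIsothermic.S3 // BonnetIsothermic.IsIsothermicS3 L T},
        BonnetIsothermic.IsBonnetRelation L (fun z => BonnetIsothermic.RP3.mk (T.1 z))
          (e (Quotient.mk _ T)).1.1) := by
  refine ⟨fun F₁ F₂ hb p₁ p₂ => BonnetIsothermic.exists_normalization L hb p₁ p₂,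
    ⟨Equiv.ofBijective _ (BonnetIsothermic.bonnetMap_bijective L), fun τ =>
      (BonnetIsothermic.bonnetForms_spec L τ.2).isBonnetRelation τ.2⟩,
    ⟨Equiv.ofBijective _ (BonnetIsothermic.bonnetMapQuotient_bijective L), fun T =>
      (BonnetIsothermic.bonnetForms_spec L (T.2.isIsothermicRP3 L)).isBonnetRelation (T.2.isIsothermicRP3 L)⟩⟩
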